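/- Let $\mathbb{R}^{2,1}$ be $\mathbb{R}^3$ with $B(x,y)=x_1y_1+x_2y_2-x_3y_3$, with one of its two orientations fixed, and let $SO(2,1)^o$ be the group of linear isometries of $B$ of determinant $1$ that preserve the positive cone $\{B(v,v)<0,\ v_3>0\}$. Let $\mathbb{S}(\mathbb{R}^4)=(\mathbb{R}^4\setminus\{0\})/\mathbb{R}_{>0}$ be the $3$-sphere of rays, with $\mathbb{R}^{2,1}$ embedded in it by $x\mapsto[1:x]$. Its boundary is the sphere $\mathbb{S}=\{[0:v]\}$ of directions, and $\mathbb{S}_+\subset\mathbb{S}$ is the open disk of directions of the positive cone (the Klein model of the hyperbolic plane), with boundary circle $\partial\mathbb{S}_+$, which carries the boundary orientation. For $p\in\partial\mathbb{S}_+$ let $\zeta_p$ be the accordant great segment at $p$: the open great semicircle in $\mathbb{S}$ from $p$ to its antipode that is tangent to $\partial\mathbb{S}_+$ at $p$ and leaves $p$ in the direction of the orientation of $\partial\mathbb{S}_+$. Let $\Pi_+$ be the map from $\bigcup_{p\in\partial\mathbb{S}_+}\overline{\zeta_p}$ to $\partial\mathbb{S}_+$ that sends each point of $\overline{\zeta_p}$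 to $p$. Let $\Gamma$ be a group of affine transformations of $\mathbb{R}^{2,1}$ with linear parts $\mathcal{L}(\gamma)\in SO(2,1)^o$, $\gamma\in\Gamma$, that is free of finite rank $\ge 2$ and acts properly discontinuously on $\mathbb{R}^{2,1}$; parabolic linear parts are allowed. A hyperbolic $\gamma\in\Gamma$ has the Margulis invariant $\alpha(\gamma)=B(\gamma(x)-x,x_0(\gamma))$, which is independent of $x$. Here $x_0(\gamma)=(x_-\times x_+)/\sqrt{B(x_-\times x_+,x_-\times x_+)}$, where $x_\pm$ are null eigenvectors of $\mathcal{L}(\gamma)$ in the boundary of the positive cone, with eigenvalue $>1$ for $x_+$ and $<1$ for $x_-$, and the Lorentzian cross product is given by $B(u\times v,w)=\det(u,v,w)$, with the determinant taken for the fixed orientation. Assume that the orientation is chosen so that $\alpha(\gamma)>0$ for some hyperbolic $\gamma\in\Gamma$ (always possible for one of the two orientations). Let $\Lambda_{\Gamma}=\bigcup_{x\in\mathbb{R}^{2,1}}\bigl(\overline{\Gamma(x)}\setminus\Gamma(x)\bigr)$, with closures in $\mathbb{S}(\mathbb{R}^4)$, be the Lorentzian limit set of $\Gamma$, and let $\Lambda_{\Gamma,\mathbb{S}_+}\subset\partial\mathbb{S}_+$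 be the limit set of the Fuchsian group $\mathcal{L}(\Gamma)$ acting on $\mathbb{S}_+$ (the set of accumulation points of orbits of points of $\mathbb{S}_+$). Then $$\Lambda_\Gamma\subset\Pi_+^{-1}(\Lambda_{\Gamma,\mathbb{S}_+})=\bigcup_{p\in\Lambda_{\Gamma,\mathbb{S}_+}}\overline{\zeta_p}.$$ -/

import Mathlib

open Set Topology

namespace Margulis

noncomputable section

/-- The flat Lorentzian space `ℝ^{2,1}` with its standard coordinates. -/
abbrev LSpace : Type := Fin 3 → ℝ

/-- The Lorentzian inner product `x₁y₁ + x₂y₂ - x₃y₃`. -/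
def lorentz (x y : LSpace) : ℝ := x 0 * y 0 + x 1 * y 1 - x 2 * y 2

/-- Vectors in the open positive cone (positive time-like vectors). -/
def FutureTimelike (v : LSpace) : Prop := lorentz v v < 0 ∧ 0 < v 2

/-- Nonzero vectors in the boundary of the positive cone. -/
def FutureNull (v : LSpace) : Prop := lorentz v v = 0 ∧ 0 < v 2

/-- `SO(2,1)ᵒ`: linear maps preserving the Lorentzian inner product, of determinant one, and
acting on the positive cone. -/
def IsSO21o (A : LSpace ≃ₗ[ℝ] LSpace) : Prop :=
  (∀ x y, lorentz (A x) (A y) = lorentz x y) ∧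
  LinearMap.det (A : LSpace →ₗ[ℝ] LSpace) = 1 ∧
  ∀ v, FutureTimelike v → FutureTimelike (A v)

/-- `Γ` is a free group of rank `g` that acts properly discontinuously on `ℝ^{2,1}` by affine
maps. -/
def IsProperAffineFree (g : ℕ) (Γ : Subgroup (LSpace ≃ᵃ[ℝ] LSpace)) : Prop :=
  Nonempty (FreeGroup (Fin g) ≃* Γ) ∧
  ∀ K : Set LSpace, IsCompact K → {γ | γ ∈ Γ ∧ ((γ '' K) ∩ K).Nonempty}.Finite

/-! ### The sphere of rays in `ℝ⁴` -/

/-- The space `𝕊(ℝ⁴)` of rays `(ℝ⁴ ∖ {0}) / ℝ_{>0}`, a 3-sphere. -/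
abbrev RaySphere : Type := Module.Ray ℝ (Fin 4 → ℝ)

/-- The quotient topology on the space of rays. -/
instance : TopologicalSpace RaySphere :=
  TopologicalSpace.coinduced
    (fun v : {v : Fin 4 → ℝ // v ≠ 0} => rayOfNeZero ℝ v.1 v.2) inferInstance

lemma cons_one_ne_zero (x : LSpace) : (Fin.cons 1 x : Fin 4 → ℝ) ≠ 0 := fun h => by
  simpa using congrFun h 0

lemma cons_zero_ne_zero {v : LSpace} (hv : v ≠ 0) : (Fin.cons 0 v : Fin 4 → ℝ) ≠ 0 := fun h =>
  hv (funext fun i => by simpa using congrFun h i.succ)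

/-- The embedding `x ↦ [1 : x]` of `ℝ^{2,1}` as an open hemisphere. -/
def affinePoint (x : LSpace) : RaySphere := rayOfNeZero ℝ (Fin.cons 1 x) (cons_one_ne_zero x)

/-- The point `[0 : v]` of the sphere at infinity (the sphere of directions). -/
def idealPoint (v : LSpace) (hv : v ≠ 0) : RaySphere :=
  rayOfNeZero ℝ (Fin.cons 0 v) (cons_zero_ne_zero hv)

/-- The orbit `Γ(x)`, inside the 3-sphere. -/
def affineOrbit (Γ : Subgroup (LSpace ≃ᵃ[ℝ] LSpace)) (x : LSpace) : Set RaySphere :=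
  {q | ∃ γ ∈ Γ, q = affinePoint (γ x)}

/-- The Lorentzian limit set `⋃ₓ (clo Γ(x) ∖ Γ(x))`, closures being taken in the 3-sphere. -/
def lorentzianLimitSet (Γ : Subgroup (LSpace ≃ᵃ[ℝ] LSpace)) : Set RaySphere :=
  ⋃ x : LSpace, closure (affineOrbit Γ x) \ affineOrbit Γ x

/-- The orbit of the ideal point `[0 : v]` under the linear parts of the elements of `Γ`. -/
def linearOrbit (Γ : Subgroup (LSpace ≃ᵃ[ℝ] LSpace)) (v : LSpace) : Set RaySphere :=
  {q | ∃ γ ∈ Γ, ∃ h : γ.linear v ≠ 0, q = idealPoint (γ.linear v) h}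

/-- The limit set of the Fuchsian group of linear parts of `Γ`, acting on the Klein model of the
hyperbolic plane formed by the directions of positive time-like vectors: the accumulation points
of the orbits of points of that plane. -/
def fuchsianLimitSet (Γ : Subgroup (LSpace ≃ᵃ[ℝ] LSpace)) : Set RaySphere :=
  {q | ∃ v, FutureTimelike v ∧ AccPt q (Filter.principal (linearOrbit Γ v))}

/-! ### Orientation, Margulis invariants and accordant segments

The sign `ε ∈ {1, -1}` selects one of the two orientations of `ℝ^{2,1}`; the value `1` is the
standard one. -/

/-- The Lorentzian cross product for the standard orientation: the vector with
`lorentz (lorentzCross u v) w = det (u, v, w)`. -/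
def lorentzCross (u v : LSpace) : LSpace :=
  ![u 1 * v 2 - u 2 * v 1, u 2 * v 0 - u 0 * v 2, -(u 0 * v 1 - u 1 * v 0)]

lemma lorentz_lorentzCross (u v w : LSpace) :
    lorentz (lorentzCross u v) w = Matrix.det (Matrix.of ![u, v, w]) := by
  simp [lorentz, lorentzCross, Matrix.det_fin_three]
  ring

/-- The unit space-like vector `x₋ × x₊ / ‖x₋ × x₊‖`, for the orientation `ε`. -/
def neutralVector (ε : ℝ) (xm xp : LSpace) : LSpace :=
  (ε / √(lorentz (lorentzCross xm xp) (lorentzCross xm xp))) • lorentzCross xm xp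

/-- `γ` is hyperbolic, and its Margulis invariant for the orientation `ε` is `α`: here `xp`, `xm`
are eigenvectors of the linear part of `γ` in the boundary of the positive cone, with eigenvalues
`l > 1` and `1 / l`, and `α = B(γ x - x, x₀)` for `x₀` the neutral vector of `γ` and any `x`. -/
def HasMargulisInvariant (ε : ℝ) (γ : LSpace ≃ᵃ[ℝ] LSpace) (α : ℝ) : Prop :=
  ∃ (l : ℝ) (xm xp : LSpace), 1 < l ∧ FutureNull xm ∧ FutureNull xp ∧
    γ.linear xp = l • xp ∧ γ.linear xm = l⁻¹ • xm ∧
    ∀ x, lorentz (γ x - x) (neutralVector ε xm xp) = α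

/-- For `v` in the boundary of the positive cone, the velocity at `v` of the horizontal circle
`θ ↦ (r cos θ, r sin θ, r)` through `v`. This is the direction of the boundary orientation of
the disk of positive time-like directions for the standard orientation. -/
def boundaryTangent (v : LSpace) : LSpace := ![-v 1, v 0, 0]

/-- The accordant great segment at `[0 : v]`, for `v` in the boundary of the positive cone and the
orientation `ε`: the open great semicircle in the sphere at infinity from `[0 : v]` to its
antipode `[0 : -v]` that is tangent to the circle of null directions and leaves `[0 : v]` in the
direction of the orientation of that circle. -/
def accordantSegment (ε : ℝ) (v : LSpace) : Set RaySphere :=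
  {q | ∃ a b : ℝ, 0 < b ∧ ∃ h : a • v + b • ε • boundaryTangent v ≠ 0, q = idealPoint _ h}

/-- `Π₊⁻¹(A)` for a set `A` of null directions, where the map `Π₊` sends all points of the closed
accordant segment at `p` to `p`: the union of the closed accordant segments at the points of
`A`. -/
def accordantPreimage (ε : ℝ) (A : Set RaySphere) : Set RaySphere :=
  {q | ∃ (v : LSpace) (hv : v ≠ 0), FutureNull v ∧ idealPoint v hv ∈ A ∧
    q ∈ closure (accordantSegment ε v)}

end

end Margulis

namespace Margulis
open Filter

/-! ### Lorentzian algebra -/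

/-! Limit points are read off from degenerating sequences in `Γ` and constrained by the signs of
Margulis invariants. Signs first. If two hyperbolic elements `γ`, `δ` had invariants of opposite
signs, products `γ ^ k * δ ^ m`, with exponents tuned so that the translations cancel, would return
to one compact set infinitely often (`not_opposite`). So every invariant times `ε` is nonnegative
(`nonnegInvariants`). Moreover `Γ` is not solvable, so its linear parts preserve no line (`irred`).
Together these facts make the linear holonomy faithful and discrete (`isDiscrete`). A point of the
limit set is an ideal point `u = lim s n • γ n x` with `s n → 0` (`exists_divergence`). Along a
subsequence the rescaled linear parts converge to `x ↦ -⟨x, r⟩ a` with `a`, `r` null, and `a` lies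
in the Fuchsian limit set. For `f ∈ Γ` with `f r` not parallel to `a`, a subsequence of `γ n * f⁻¹`
is hyperbolic with eigenvectors tending to the directions of `f r` and `a`, and the signs of the
invariants give `ε det (f r, a, u) ≥ 0` in the limit (`RankOne.star`). If `u ⟂ a`, then `u` is a
combination of `a` and the tangent vector at `a`, and this inequality is exactly the sign condition
that puts `u` on the closed accordant segment. The heart is the orthogonality `u ⟂ a`
(`RankOne.orthogonal`). If it fails, `RankOne.star` puts the orbit of `r` on one side of the plane
spanned by `a` and `u`. In the upper half-plane with `a` at infinity, the limit set lies in a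
half-line and is unbounded there, so `a` is an endpoint of a gap. As `Γ` is finitely generated, a
nontrivial element then fixes the direction of `a`: by pigeonhole, two elements `h ≠ h'` have `h⁻¹
a` parallel to `h'⁻¹ a` (`coincidence_of_visible`, `coincidence_of_conical`). This element is not
parabolic, since a parabolic would push the orbit across the plane. If it is a hyperbolic `β`, with
second fixed direction `e`, then `β ^ k n * γ n`, for suitable `k n`, diverges along the line of `e`
while its attracting direction `a'` is neither `a` nor `e`. The sign inequality for this sequence,
tested at `a` and at `β a'`, gives contradictory signs (`RankOne.orthogonal_of_isHyp`). -/

lemma lorentz_comm (x y : LSpace) : lorentz x y = lorentz y x := by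
  simp only [lorentz]; ring

lemma lorentz_add_left (x y z : LSpace) : lorentz (x + y) z = lorentz x z + lorentz y z := by
  simp only [lorentz, Pi.add_apply]; ring

lemma lorentz_add_right (x y z : LSpace) : lorentz x (y + z) = lorentz x y + lorentz x z := by
  simp only [lorentz, Pi.add_apply]; ring

lemma lorentz_sub_left (x y z : LSpace) : lorentz (x - y) z = lorentz x z - lorentz y z := by
  simp only [lorentz, Pi.sub_apply]; ring

lemma lorentz_sub_right (x y z : LSpace) : lorentz x (y - z) = lorentz x y - lorentz x z := by
  simp only [lorentz, Pi.sub_apply]; ring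

lemma lorentz_smul_left (c : ℝ) (x y : LSpace) : lorentz (c • x) y = c * lorentz x y := by
  simp only [lorentz, Pi.smul_apply, smul_eq_mul]; ring

lemma lorentz_smul_right (c : ℝ) (x y : LSpace) : lorentz x (c • y) = c * lorentz x y := by
  simp only [lorentz, Pi.smul_apply, smul_eq_mul]; ring

lemma lorentz_neg_left (x y : LSpace) : lorentz (-x) y = -lorentz x y := by
  simp only [lorentz, Pi.neg_apply]; ring

lemma lorentz_neg_right (x y : LSpace) : lorentz x (-y) = -lorentz x y := by
  simp only [lorentz, Pi.neg_apply]; ring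

lemma lorentz_zero_left (x : LSpace) : lorentz 0 x = 0 := by simp [lorentz]

/-- Coordinates of the Lorentzian cross product. -/
lemma lorentzCross_zero (u v : LSpace) : lorentzCross u v 0 = u 1 * v 2 - u 2 * v 1 := rfl
lemma lorentzCross_one (u v : LSpace) : lorentzCross u v 1 = u 2 * v 0 - u 0 * v 2 := rfl
lemma lorentzCross_two (u v : LSpace) : lorentzCross u v 2 = -(u 0 * v 1 - u 1 * v 0) := rfl

/-- The determinant of three vectors. -/
def vol (u v w : LSpace) : ℝ :=
  u 0 * (v 1 * w 2 - v 2 * w 1) - u 1 * (v 0 * w 2 - v 2 * w 0) + u 2 * (v 0 * w 1 - v 1 * w 0)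

lemma lorentz_cross_eq_vol (u v w : LSpace) : lorentz (lorentzCross u v) w = vol u v w := by
  simp only [lorentz, lorentzCross_zero, lorentzCross_one, lorentzCross_two, vol]; ring

lemma lorentz_cross_cross (u v w z : LSpace) :
    lorentz (lorentzCross u v) (lorentzCross w z) =
      -(lorentz u w * lorentz v z - lorentz u z * lorentz v w) := by
  simp only [lorentz, lorentzCross_zero, lorentzCross_one, lorentzCross_two]; ring

lemma lorentzCross_smul_left (c : ℝ) (u v : LSpace) :
    lorentzCross (c • u) v = c • lorentzCross u v := by
  funext i
  fin_cases i <;> simp [lorentzCross] <;> ring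

lemma lorentzCross_smul_right (c : ℝ) (u v : LSpace) :
    lorentzCross u (c • v) = c • lorentzCross u v := by
  funext i
  fin_cases i <;> simp [lorentzCross] <;> ring

lemma lorentzCross_swap (u v : LSpace) : lorentzCross u v = -lorentzCross v u := by
  funext i
  fin_cases i <;> simp [lorentzCross] <;> ring

lemma ext_coord {u v : LSpace} (h0 : u 0 = v 0) (h1 : u 1 = v 1) (h2 : u 2 = v 2) : u = v := by
  funext i
  fin_cases i
  · exact h0
  · exact h1
  · exact h2

lemma ext_lorentz {u v : LSpace} (h : ∀ w, lorentz u w = lorentz v w) : u = v := by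
  funext i
  have h0 := h ![1, 0, 0]
  have h1 := h ![0, 1, 0]
  have h2 := h ![0, 0, 1]
  simp [lorentz] at h0 h1 h2
  fin_cases i <;> simpa

/-- The base point of the hyperbolic plane. -/
def origin : LSpace := ![0, 0, 1]

lemma lorentz_origin (w : LSpace) : lorentz w origin = -w 2 := by simp [lorentz, origin]

lemma origin_lorentz (w : LSpace) : lorentz origin w = -w 2 := by simp [lorentz, origin]

lemma origin_two : origin 2 = 1 := rfl

lemma lorentz_origin_origin : lorentz origin origin = -1 := by simp [lorentz, origin]

lemma origin_future : FutureTimelike origin := by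
  constructor <;> simp [lorentz, origin]

/-! ### Causal vectors -/

lemma planar_le {u : LSpace} (hu : lorentz u u ≤ 0) : u 0 ^ 2 + u 1 ^ 2 ≤ u 2 ^ 2 := by
  simp only [lorentz] at hu; nlinarith

lemma lorentz_nonpos {u v : LSpace} (hu : lorentz u u ≤ 0) (hu2 : 0 ≤ u 2)
    (hv : lorentz v v ≤ 0) (hv2 : 0 ≤ v 2) : lorentz u v ≤ 0 := by
  have h1 := planar_le hu
  have h2 := planar_le hv
  have : (u 0 * v 0 + u 1 * v 1) ^ 2 ≤ (u 2 * v 2) ^ 2 := by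
    have e : (u 0 * v 0 + u 1 * v 1) ^ 2 ≤ (u 0 ^ 2 + u 1 ^ 2) * (v 0 ^ 2 + v 1 ^ 2) := by
      nlinarith [sq_nonneg (u 0 * v 1 - u 1 * v 0)]
    have e2 : (u 0 ^ 2 + u 1 ^ 2) * (v 0 ^ 2 + v 1 ^ 2) ≤ u 2 ^ 2 * v 2 ^ 2 := by
      gcongr
    nlinarith
  have := abs_le_of_sq_le_sq this (by positivity)
  simp only [lorentz]
  linarith [le_abs_self (u 0 * v 0 + u 1 * v 1)]

lemma FutureNull.lorentz_nonpos {u v : LSpace} (hu : FutureNull u) (hv : FutureNull v) :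
    lorentz u v ≤ 0 :=
  Margulis.lorentz_nonpos hu.1.le hu.2.le hv.1.le hv.2.le

lemma FutureNull.lorentz_neg {u v : LSpace} (hu : FutureNull u) (hv : FutureNull v)
    (h : lorentz u v ≠ 0) : lorentz u v < 0 :=
  lt_of_le_of_ne (hu.lorentz_nonpos hv) h

/-- A null vector orthogonal to a future null vector is parallel to it. -/
lemma FutureNull.parallel {u v : LSpace} (hu : FutureNull u) (hv : lorentz v v = 0)
    (h : lorentz u v = 0) : v = (v 2 / u 2) • u := by
  have h2 : u 2 ≠ 0 := hu.2.ne'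
  obtain ⟨h1, -⟩ := hu
  simp only [lorentz] at h1 hv h
  have key : (v 0 * u 2 - v 2 * u 0) ^ 2 + (v 1 * u 2 - v 2 * u 1) ^ 2 = 0 := by
    linear_combination u 2 ^ 2 * hv + v 2 ^ 2 * h1 - 2 * u 2 * v 2 * h
  have k0 : v 0 * u 2 - v 2 * u 0 = 0 := by nlinarith [sq_nonneg (v 0 * u 2 - v 2 * u 0), sq_nonneg (v 1 * u 2 - v 2 * u 1)]
  have k1 : v 1 * u 2 - v 2 * u 1 = 0 := by nlinarith [sq_nonneg (v 0 * u 2 - v 2 * u 0), sq_nonneg (v 1 * u 2 - v 2 * u 1)]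
  funext i
  fin_cases i <;> simp <;> field_simp <;> linarith

lemma FutureNull.smul {u : LSpace} (hu : FutureNull u) {c : ℝ} (hc : 0 < c) :
    FutureNull (c • u) := by
  refine ⟨?_, ?_⟩
  · rw [lorentz_smul_left, lorentz_smul_right, hu.1]; simp
  · simpa using mul_pos hc hu.2

lemma FutureNull.ne_zero {u : LSpace} (hu : FutureNull u) : u ≠ 0 := by
  rintro rfl; simpa using hu.2

lemma FutureNull.exists_smul {u v : LSpace} (hu : FutureNull u) (hv : FutureNull v)
    (h : lorentz u v = 0) : ∃ c : ℝ, 0 < c ∧ v = c • u :=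
  ⟨_, div_pos hv.2 hu.2, hu.parallel hv.1 h⟩

lemma FutureTimelike.lorentz_null_neg {w u : LSpace} (hw : FutureTimelike w) (hu : FutureNull u) :
    lorentz w u < 0 := by
  refine lt_of_le_of_ne (Margulis.lorentz_nonpos hw.1.le hw.2.le hu.1.le hu.2.le) fun h => ?_
  have h2 := hu.2
  have hw2 := hw.2
  obtain ⟨h1, -⟩ := hu
  obtain ⟨h3, -⟩ := hw
  simp only [lorentz] at h1 h3 h
  have hk : (w 0 * u 0 + w 1 * u 1) ^ 2 = (w 2 * u 2) ^ 2 := by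
    rw [show w 0 * u 0 + w 1 * u 1 = w 2 * u 2 by linarith]
  have e : (w 0 * u 0 + w 1 * u 1) ^ 2 ≤ (w 0 ^ 2 + w 1 ^ 2) * (u 0 ^ 2 + u 1 ^ 2) := by
    nlinarith [sq_nonneg (w 0 * u 1 - w 1 * u 0)]
  have e3 : u 0 ^ 2 + u 1 ^ 2 = u 2 ^ 2 := by linarith
  rw [e3, hk] at e
  have : w 2 ^ 2 ≤ w 0 ^ 2 + w 1 ^ 2 := by
    have hp : 0 < u 2 ^ 2 := by positivity
    by_contra hc
    push Not at hc
    nlinarith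
  linarith

/-- A nonzero causal vector with negative product with a future timelike vector is future. -/
lemma future_of_lorentz_neg {w v : LSpace} (hw : FutureTimelike w) (hv : lorentz v v ≤ 0)
    (h : lorentz w v < 0) : 0 < v 2 := by
  by_contra hc
  push Not at hc
  have := Margulis.lorentz_nonpos (u := w) (v := -v) hw.1.le hw.2.le
    (by rw [lorentz_neg_left, lorentz_neg_right]; linarith) (by simpa using hc)
  rw [lorentz_neg_right] at this
  linarith

/-! ### The group `SO(2,1)ᵒ` -/

namespace IsSO21o
variable {A : LSpace ≃ₗ[ℝ] LSpace}

lemma inner (hA : IsSO21o A) (x y : LSpace) : lorentz (A x) (A y) = lorentz x y := hA.1 x y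

lemma inner_symm_left (hA : IsSO21o A) (x y : LSpace) :
    lorentz (A.symm x) y = lorentz x (A y) := by
  rw [← hA.inner, A.apply_symm_apply]

lemma inner_symm_right (hA : IsSO21o A) (x y : LSpace) :
    lorentz x (A.symm y) = lorentz (A x) y := by
  rw [← hA.inner, A.apply_symm_apply]

/-- Only the open cone is assumed to be preserved; the sign of the last coordinate of `A v` comes
from pairing with `A origin`. -/
lemma null (hA : IsSO21o A) {v : LSpace} (hv : FutureNull v) : FutureNull (A v) := by
  refine ⟨by rw [hA.inner, hv.1], ?_⟩
  refine future_of_lorentz_neg (hA.2.2 _ origin_future) (by rw [hA.inner, hv.1]) ?_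
  rw [hA.inner]
  exact origin_future.lorentz_null_neg hv

lemma vol_map (hA : IsSO21o A) (u v w : LSpace) : vol (A u) (A v) (A w) = vol u v w := by
  have e : ∀ u v w : LSpace, vol u v w = Matrix.det (Matrix.of ![u, v, w]) := fun u v w => by
    rw [← lorentz_cross_eq_vol, lorentz_lorentzCross]
  rw [e, e]
  have hM : Matrix.det (LinearMap.toMatrix' (A : LSpace →ₗ[ℝ] LSpace)) = 1 := by
    rw [LinearMap.det_toMatrix']; exact hA.2.1
  have key : Matrix.of ![A u, A v, A w] = Matrix.of ![u, v, w] *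
      (LinearMap.toMatrix' (A : LSpace →ₗ[ℝ] LSpace)).transpose := by
    have hx : ∀ x : LSpace, (LinearMap.toMatrix' (A : LSpace →ₗ[ℝ] LSpace)).mulVec x = A x := by
      intro x
      rw [LinearMap.toMatrix'_mulVec]
      rfl
    ext i j
    rw [Matrix.mul_apply_eq_vecMul, Matrix.vecMul_transpose]
    fin_cases i
    · exact (congrFun (hx u) j).symm
    · exact (congrFun (hx v) j).symm
    · exact (congrFun (hx w) j).symm
  rw [key, Matrix.det_mul, Matrix.det_transpose, hM, mul_one]

lemma cross (hA : IsSO21o A) (u v : LSpace) :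
    A (lorentzCross u v) = lorentzCross (A u) (A v) := by
  refine ext_lorentz fun w => ?_
  rw [← A.apply_symm_apply w, hA.inner, lorentz_cross_eq_vol, lorentz_cross_eq_vol, hA.vol_map]

end IsSO21o

/-! ### Linear parts -/

lemma linear_mul (γ δ : LSpace ≃ᵃ[ℝ] LSpace) (v : LSpace) :
    (γ * δ).linear v = γ.linear (δ.linear v) := rfl

lemma linear_one (v : LSpace) : (1 : LSpace ≃ᵃ[ℝ] LSpace).linear v = v := rfl

lemma linear_inv (γ : LSpace ≃ᵃ[ℝ] LSpace) : (γ⁻¹).linear = γ.linear.symm := rfl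

lemma linear_inv_apply (γ : LSpace ≃ᵃ[ℝ] LSpace) (v : LSpace) :
    (γ⁻¹).linear (γ.linear v) = v := γ.linear.symm_apply_apply v

lemma linear_apply_inv (γ : LSpace ≃ᵃ[ℝ] LSpace) (v : LSpace) :
    γ.linear ((γ⁻¹).linear v) = v := γ.linear.apply_symm_apply v

lemma affine_apply_sub (γ : LSpace ≃ᵃ[ℝ] LSpace) (x y : LSpace) :
    γ x - γ y = γ.linear (x - y) := by
  have := γ.toAffineMap.linearMap_vsub x y
  simpa using this.symm

lemma affine_apply_add (γ : LSpace ≃ᵃ[ℝ] LSpace) (x v : LSpace) :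
    γ (x + v) = γ x + γ.linear v := by
  have := affine_apply_sub γ (x + v) x
  rw [add_sub_cancel_left] at this
  rw [← this]; abel

lemma affine_inv_apply (γ : LSpace ≃ᵃ[ℝ] LSpace) (x : LSpace) : γ⁻¹ (γ x) = x :=
  γ.symm_apply_apply x

lemma affine_apply_inv (γ : LSpace ≃ᵃ[ℝ] LSpace) (x : LSpace) : γ (γ⁻¹ x) = x :=
  γ.apply_symm_apply x

lemma affine_mul_apply (γ δ : LSpace ≃ᵃ[ℝ] LSpace) (x : LSpace) : (γ * δ) x = γ (δ x) := rfl

/-! ### Irreducibility of the linear holonomy -/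

lemma vol_add_right (u v w w' : LSpace) : vol u v (w + w') = vol u v w + vol u v w' := by
  simp only [vol, Pi.add_apply]; ring
lemma vol_smul_left (c : ℝ) (u v w : LSpace) : vol (c • u) v w = c * vol u v w := by
  simp only [vol, Pi.smul_apply, smul_eq_mul]; ring
lemma vol_smul_mid (c : ℝ) (u v w : LSpace) : vol u (c • v) w = c * vol u v w := by
  simp only [vol, Pi.smul_apply, smul_eq_mul]; ring
lemma vol_smul_right (c : ℝ) (u v w : LSpace) : vol u v (c • w) = c * vol u v w := by
  simp only [vol, Pi.smul_apply, smul_eq_mul]; ring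

/-- Cramer's rule. -/
lemma vol_cramer (u v w x : LSpace) :
    vol u v w • x = vol x v w • u + vol u x w • v + vol u v x • w := by
  funext i
  fin_cases i <;> simp [vol] <;> ring

/-- A vector `w` such that `w`, `v × w`, `v × (v × w)` form a basis. -/
lemma exists_cyclic {v : LSpace} (hv : v ≠ 0) :
    ∃ w, vol w (lorentzCross v w) (lorentzCross v (lorentzCross v w)) ≠ 0 := by
  have key : ∀ w, vol w (lorentzCross v w) (lorentzCross v (lorentzCross v w)) =
      lorentz v w * (lorentz v v * lorentz w w - lorentz v w ^ 2) := by
    intro w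
    simp only [vol, lorentz, lorentzCross_zero, lorentzCross_one, lorentzCross_two]; ring
  -- By `key` it suffices that `w` be neither orthogonal to `v` nor in a degenerate plane with it;
  -- each case exhibits an explicit such `w`.
  by_cases h2 : v 2 = 0
  · refine ⟨![v 0, v 1, 1], ?_⟩
    rw [key]
    have hs : 0 < v 0 ^ 2 + v 1 ^ 2 := by
      rcases eq_or_ne (v 0) 0 with h0 | h0
      · rcases eq_or_ne (v 1) 0 with h1 | h1
        · exact absurd (by funext i; fin_cases i <;> simpa) hv
        · positivity
      · positivity
    have e : lorentz v ![v 0, v 1, 1] * (lorentz v v * lorentz ![v 0, v 1, 1] ![v 0, v 1, 1] -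
        lorentz v ![v 0, v 1, 1] ^ 2) = -(v 0 ^ 2 + v 1 ^ 2) ^ 2 := by
      simp [lorentz, h2]; ring
    rw [e]
    exact neg_ne_zero.2 (pow_ne_zero _ hs.ne')
  · by_cases h01 : v 0 ^ 2 + v 1 ^ 2 = 0
    · have h0 : v 0 = 0 := by nlinarith [sq_nonneg (v 0), sq_nonneg (v 1)]
      have h1 : v 1 = 0 := by nlinarith [sq_nonneg (v 0), sq_nonneg (v 1)]
      refine ⟨![1, 0, 1], ?_⟩
      rw [key]
      simp [lorentz, h0, h1, h2]
    · refine ⟨![v 0, v 1, -v 2], ?_⟩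
      rw [key]
      have hs : 0 < v 0 ^ 2 + v 1 ^ 2 := lt_of_le_of_ne (by positivity) (Ne.symm h01)
      have h2' : 0 < v 2 ^ 2 := by positivity
      have e : lorentz v ![v 0, v 1, -v 2] * (lorentz v v * lorentz ![v 0, v 1, -v 2] ![v 0, v 1, -v 2] -
        lorentz v ![v 0, v 1, -v 2] ^ 2) = -((v 0 ^ 2 + v 1 ^ 2 + v 2 ^ 2) *
          (4 * (v 0 ^ 2 + v 1 ^ 2) * v 2 ^ 2)) := by
        simp [lorentz]; ring
      rw [e]
      exact neg_ne_zero.2 (by positivity)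

/-- Elements of `SO(2,1)ᵒ` with a common nonzero fixed vector commute. -/
lemma IsSO21o.commute_of_fix {A C : LSpace ≃ₗ[ℝ] LSpace} (hA : IsSO21o A) (hC : IsSO21o C)
    {v : LSpace} (hv : v ≠ 0) (hAv : A v = v) (hCv : C v = v) (x : LSpace) :
    A (C x) = C (A x) := by
  obtain ⟨w, hw⟩ := exists_cyclic hv
  set N : LSpace → LSpace := lorentzCross v with hN
  have hAN : ∀ x, A (N x) = N (A x) := fun x => by rw [hN, hA.cross, hAv]
  have hCN : ∀ x, C (N x) = N (C x) := fun x => by rw [hN, hC.cross, hCv]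
  have hNadd : ∀ x y, N (x + y) = N x + N y := fun x y => by
    funext i; fin_cases i <;> simp [hN, lorentzCross] <;> ring
  have hNsmul : ∀ (c : ℝ) x, N (c • x) = c • N x := fun c x => by
    rw [hN, lorentzCross_smul_right]
  have span : ∀ x, ∃ a b c : ℝ, x = a • w + b • N w + c • N (N w) := fun x => by
    have := vol_cramer w (N w) (N (N w)) x
    have e : x = (vol w (N w) (N (N w)))⁻¹ • vol w (N w) (N (N w)) • x := by
      rw [smul_smul, inv_mul_cancel₀ hw, one_smul]
    rw [this, smul_add, smul_add, smul_smul, smul_smul, smul_smul] at e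
    exact ⟨_, _, _, e⟩
  obtain ⟨a, b, c, hAw⟩ := span (A w)
  -- `A` commutes with `N`, for which `w` is a cyclic vector, so `A` is a polynomial in `N`; `C`
  -- also commutes with `N`, hence with `A`.
  have hpoly : ∀ y, A y = a • y + b • N y + c • N (N y) := by
    intro y
    obtain ⟨p, q, r, rfl⟩ := span y
    simp only [map_add, map_smul, hAN, hAw, hNadd, hNsmul, smul_add, smul_smul]
    simp only [mul_comm, add_assoc]
    abel
  rw [hpoly (C x), hpoly x]
  simp only [map_add, map_smul, hCN]

/-- A 5-cycle and an adjacent transposition generate `S₅`, so two free generators suffice to map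
onto a nonsolvable group. -/
lemma not_isSolvable_freeGroup {g : ℕ} (hg : 2 ≤ g) : ¬ Group.IsSolvable (FreeGroup (Fin g)) := by
  intro h
  let τ : Equiv.Perm (Fin 5) := finRotate 5
  let σ : Equiv.Perm (Fin 5) := Equiv.swap 0 (τ 0)
  let f : FreeGroup (Fin g) →* Equiv.Perm (Fin 5) :=
    FreeGroup.lift fun i => if i.1 = 0 then τ else σ
  have hf : Function.Surjective f := by
    rw [← MonoidHom.range_eq_top, eq_top_iff]
    have hc := Equiv.Perm.closure_cycle_adjacent_swap (σ := τ) (isCycle_finRotate)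
      (support_finRotate) (0 : Fin 5)
    rw [← hc, Subgroup.closure_le]
    rintro x (rfl | rfl)
    · exact ⟨FreeGroup.of ⟨0, by omega⟩, by simp [f]⟩
    · exact ⟨FreeGroup.of ⟨1, by omega⟩, by simp [f, σ]⟩
  have := Group.isSolvable_of_surjective hf
  exact Equiv.Perm.not_isSolvable_fin_5 this

/-- No line is invariant under all linear parts. -/
def Irred (Γ : Subgroup (LSpace ≃ᵃ[ℝ] LSpace)) : Prop :=
  ∀ v : LSpace, v ≠ 0 → ∃ γ ∈ Γ, ∀ c : ℝ, γ.linear v ≠ c • v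

lemma apply_eq_add_of_linear_eq {γ : LSpace ≃ᵃ[ℝ] LSpace} (h : ∀ v, γ.linear v = v) (x : LSpace) :
    γ x = x + γ 0 := by
  have := affine_apply_add γ 0 x
  rw [zero_add, h] at this
  rw [this, add_comm]

lemma mul_comm_of_linear_eq_one {γ δ : LSpace ≃ᵃ[ℝ] LSpace} (hγ : ∀ v, γ.linear v = v)
    (hδ : ∀ v, δ.linear v = v) : γ * δ = δ * γ := by
  ext1 x
  rw [affine_mul_apply, affine_mul_apply, apply_eq_add_of_linear_eq hγ (δ x),
    apply_eq_add_of_linear_eq hδ x, apply_eq_add_of_linear_eq hδ (γ x),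
    apply_eq_add_of_linear_eq hγ x]
  abel

/-- With an invariant line, commutators fix `v`, since scalars commute. Isometries fixing `v`
commute, so the second derived group has trivial linear parts. It therefore consists of translations
and is abelian, which would make the free group solvable. -/
lemma irred {g : ℕ} (hg : 2 ≤ g) {Γ : Subgroup (LSpace ≃ᵃ[ℝ] LSpace)}
    (hfree : Nonempty (FreeGroup (Fin g) ≃* Γ)) (hlin : ∀ γ ∈ Γ, IsSO21o γ.linear) :
    Irred Γ := by
  intro v hv
  by_contra hcon
  push Not at hcon
  obtain ⟨e⟩ := hfree
  refine not_isSolvable_freeGroup hg ?_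
  suffices h : Group.IsSolvable Γ from Group.isSolvable_of_isSolvable_injective (f := e.toMonoidHom) e.injective
  let K : Subgroup Γ :=
    { carrier := {γ | γ.1.linear v = v}
      one_mem' := linear_one v
      mul_mem' := fun {a b} ha hb => by
        change (a.1 * b.1).linear v = v
        rw [linear_mul, show b.1.linear v = v from hb, show a.1.linear v = v from ha]
      inv_mem' := fun {a} ha => by
        change (a.1⁻¹).linear v = v
        conv_lhs => rw [← show a.1.linear v = v from ha]
        exact linear_inv_apply _ _ }
  let T : Subgroup Γ :=
    { carrier := {γ | ∀ x, γ.1.linear x = x}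
      one_mem' := linear_one
      mul_mem' := fun {a b} ha hb x => by
        change (a.1 * b.1).linear x = x
        rw [linear_mul, show b.1.linear x = x from hb x, show a.1.linear x = x from ha x]
      inv_mem' := fun {a} ha x => by
        change (a.1⁻¹).linear x = x
        conv_lhs => rw [← show a.1.linear x = x from ha x]
        exact linear_inv_apply _ _ }
  have h1 : derivedSeries Γ 1 ≤ K := by
    rw [derivedSeries_succ, derivedSeries_zero, Subgroup.commutator_le]
    intro a _ b _
    obtain ⟨c, hc⟩ := hcon a.1 a.2
    obtain ⟨d, hd⟩ := hcon b.1 b.2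
    change (a.1 * b.1 * a.1⁻¹ * b.1⁻¹).linear v = v
    have hab : (a.1 * b.1).linear v = (b.1 * a.1).linear v := by
      rw [linear_mul, linear_mul, hc, hd, map_smul, map_smul, hc, hd, smul_smul, smul_smul,
        mul_comm]
    obtain ⟨k, hk⟩ := hcon _ (Γ.inv_mem (Γ.mul_mem b.2 a.2))
    have hk2 : (a.1⁻¹ * b.1⁻¹).linear v = k • v := by rw [← mul_inv_rev]; exact hk
    rw [mul_assoc, linear_mul, hk2, map_smul, hab, ← map_smul, ← hk]
    exact linear_apply_inv _ _
  have h2 : derivedSeries Γ 2 ≤ T := by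
    rw [derivedSeries_succ, Subgroup.commutator_le]
    intro a ha b hb x
    have ha' : a.1.linear v = v := h1 ha
    have hb' : b.1.linear v = v := h1 hb
    change (a.1 * b.1 * a.1⁻¹ * b.1⁻¹).linear x = x
    rw [mul_assoc, ← mul_inv_rev, linear_mul]
    rw [linear_mul, (hlin _ a.2).commute_of_fix (hlin _ b.2) hv ha' hb', ← linear_mul]
    exact linear_apply_inv _ _
  have h3 : derivedSeries Γ 3 ≤ ⊥ := by
    rw [derivedSeries_succ, Subgroup.commutator_le]
    intro a ha b hb
    have := mul_comm_of_linear_eq_one (h2 ha) (h2 hb)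
    rw [Subgroup.mem_bot, commutatorElement_eq_one_iff_mul_comm]
    exact Subtype.ext this
  exact ⟨3, le_bot_iff.1 h3⟩

/-! ### Hyperbolic elements and the opposite sign lemma -/

/-- The expansion of `w` in `u`, `v`, `u × v`, cleared of denominators so that it needs no
independence hypothesis. -/
lemma cross_frame (u v w : LSpace) :
    lorentz (lorentzCross u v) (lorentzCross u v) • w =
      lorentz w (lorentzCross u v) • lorentzCross u v +
      (lorentz u v * lorentz w v - lorentz v v * lorentz w u) • u +
      (lorentz u v * lorentz w u - lorentz u u * lorentz w v) • v := by
  apply ext_coord <;> simp only [lorentz, Pi.add_apply, Pi.smul_apply, smul_eq_mul,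
    lorentzCross_zero, lorentzCross_one, lorentzCross_two] <;> ring

lemma lorentz_cross_self_left (u v : LSpace) : lorentz (lorentzCross u v) u = 0 := by
  rw [lorentz_cross_eq_vol]; simp only [vol]; ring

lemma lorentz_cross_self_right (u v : LSpace) : lorentz (lorentzCross u v) v = 0 := by
  rw [lorentz_cross_eq_vol]; simp only [vol]; ring

/-- `γ` is hyperbolic with expanding null eigenvector `xp` and contracting null eigenvector `xm`. -/
structure IsHyp (γ : LSpace ≃ᵃ[ℝ] LSpace) (l : ℝ) (xm xp : LSpace) : Prop where
  one_lt : 1 < l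
  null_m : FutureNull xm
  null_p : FutureNull xp
  map_p : γ.linear xp = l • xp
  map_m : γ.linear xm = l⁻¹ • xm

/-- Parallel eigenvectors would share an eigenvalue; otherwise invariance of the nonzero product
`⟨xm, xp⟩` forces the eigenvalues to be inverse. They are kept independent in the hypotheses because
those of `γ` and `γ⁻¹` are later found separately. -/
lemma hyp_eigen {A : LSpace ≃ₗ[ℝ] LSpace} (hA : IsSO21o A) {l l' : ℝ} {xm xp : LSpace}
    (hl : 1 < l) (hl' : 1 < l') (hm : FutureNull xm) (hp : FutureNull xp)
    (hAp : A xp = l • xp) (hAm : A xm = l'⁻¹ • xm) : lorentz xm xp < 0 ∧ l' = l := by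
  have h1 : lorentz xm xp ≠ 0 := by
    intro h
    obtain ⟨c, hc, rfl⟩ := hm.exists_smul hp h
    rw [map_smul, hAm, smul_smul, smul_smul] at hAp
    have := congrFun hAp 2
    have h2 := hm.2
    simp only [Pi.smul_apply, smul_eq_mul] at this
    have h3 : c * l'⁻¹ = l * c := mul_right_cancel₀ h2.ne' this
    have h4 : l'⁻¹ = l := by
      have : l'⁻¹ * c = l * c := by linarith
      exact mul_right_cancel₀ hc.ne' this
    have : l'⁻¹ < 1 := inv_lt_one_of_one_lt₀ hl'
    linarith
  refine ⟨hm.lorentz_neg hp h1, ?_⟩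
  have := hA.inner xm xp
  rw [hAp, hAm, lorentz_smul_left, lorentz_smul_right, ← mul_assoc] at this
  have h3 : l'⁻¹ * l = 1 := mul_right_cancel₀ h1 (by linarith)
  field_simp at h3
  exact h3.symm

namespace IsHyp
variable {γ : LSpace ≃ᵃ[ℝ] LSpace} {l : ℝ} {xm xp : LSpace}

lemma neg (h : IsHyp γ l xm xp) (hA : IsSO21o γ.linear) : lorentz xm xp < 0 :=
  (hyp_eigen hA h.one_lt h.one_lt h.null_m h.null_p h.map_p h.map_m).1

lemma map_cross (h : IsHyp γ l xm xp) (hA : IsSO21o γ.linear) :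
    γ.linear (lorentzCross xm xp) = lorentzCross xm xp := by
  have := h.one_lt
  rw [hA.cross, h.map_p, h.map_m, lorentzCross_smul_left, lorentzCross_smul_right, smul_smul,
    inv_mul_cancel₀ (by positivity), one_smul]

lemma smul_m (h : IsHyp γ l xm xp) {c : ℝ} (hc : 0 < c) : IsHyp γ l (c • xm) xp :=
  ⟨h.one_lt, h.null_m.smul hc, h.null_p, h.map_p, by rw [map_smul, h.map_m, smul_comm]⟩

lemma inv (h : IsHyp γ l xm xp) : IsHyp γ⁻¹ l xp xm := by
  have hl : l ≠ 0 := by have := h.one_lt; positivity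
  refine ⟨h.one_lt, h.null_p, h.null_m, ?_, ?_⟩
  · have := linear_inv_apply γ xm
    rw [h.map_m, map_smul] at this
    conv_rhs => rw [← this]
    rw [smul_smul, mul_inv_cancel₀ hl, one_smul]
  · have := linear_inv_apply γ xp
    rw [h.map_p, map_smul] at this
    conv_rhs => rw [← this]
    rw [smul_smul, inv_mul_cancel₀ hl, one_smul]

/-- Changing the base point alters `γ x - x` by an element of the image of `γ.linear - 1`, which is
orthogonal to the fixed vector `xm × xp`. -/
lemma vol_sub (h : IsHyp γ l xm xp) (hA : IsSO21o γ.linear) (x y : LSpace) :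
    vol xm xp (γ x - x) = vol xm xp (γ y - y) := by
  have e : γ x - x = (γ y - y) + (γ.linear (x - y) - (x - y)) := by
    rw [← affine_apply_sub]; abel
  have h0 : vol xm xp (γ.linear (x - y) - (x - y)) = 0 := by
    rw [← lorentz_cross_eq_vol, lorentz_sub_right]
    nth_rw 1 [← h.map_cross hA]
    rw [hA.inner, sub_self]
  rw [e, vol_add_right, h0, add_zero]

/-- The axis: a point translated by a multiple of the neutral vector. -/
lemma exists_axis (h : IsHyp γ l xm xp) (hn : lorentz xm xp = -1) :
    ∃ y, γ y = y + vol xm xp (γ 0 - 0) • lorentzCross xm xp := by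
  have hl := h.one_lt
  have hl1 : l - 1 ≠ 0 := by linarith
  have hl0 : l ≠ 0 := by linarith
  set b := γ 0 with hb
  have hdec := cross_frame xm xp b
  rw [lorentz_cross_cross, h.null_m.1, h.null_p.1, lorentz_comm xp xm, hn] at hdec
  simp only [zero_mul, sub_zero, zero_sub, neg_neg, mul_neg, mul_one, one_smul, neg_mul,
    one_mul] at hdec
  set n := lorentzCross xm xp with hnn
  set P := lorentz b xp
  set Q := lorentz b xm
  -- The translation part is cancelled along `xp` and `xm`, where `γ.linear - 1` acts by the nonzero
  -- scalars `l - 1` and `l⁻¹ - 1`.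
  refine ⟨(Q / (l - 1)) • xp + (-P * l / (l - 1)) • xm, ?_⟩
  have h1 := affine_apply_add γ 0 ((Q / (l - 1)) • xp + (-P * l / (l - 1)) • xm)
  rw [zero_add] at h1
  rw [h1, map_add, map_smul, map_smul, h.map_p, h.map_m, ← lorentz_cross_eq_vol, ← hnn, ← hb,
    sub_zero, lorentz_comm n b]
  nth_rw 1 [hdec]
  funext i
  simp only [Pi.add_apply, Pi.smul_apply, smul_eq_mul]
  field_simp
  ring

lemma pow_apply (h : IsHyp γ l xm xp) (hA : IsSO21o γ.linear) {y : LSpace} {α : ℝ}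
    (hy : γ y = y + α • lorentzCross xm xp) (s t c : ℝ) (k : ℕ) :
    (γ ^ k) (y + s • xp + t • xm + c • lorentzCross xm xp) =
      y + (l ^ k * s) • xp + ((l⁻¹) ^ k * t) • xm + (c + k * α) • lorentzCross xm xp := by
  induction k with
  | zero => simp
  | succ k ih =>
    rw [pow_succ', affine_mul_apply, ih, affine_apply_add, affine_apply_add, affine_apply_add, hy,
      map_smul, map_smul, map_smul, h.map_p, h.map_m, h.map_cross hA]
    funext i
    simp only [Pi.add_apply, Pi.smul_apply, smul_eq_mul]
    push_cast
    ring

lemma pow_linear (h : IsHyp γ l xm xp) (k : ℕ) :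
    (γ ^ k).linear xp = l ^ k • xp ∧ (γ ^ k).linear xm = (l⁻¹) ^ k • xm := by
  induction k with
  | zero => simp [linear_one]
  | succ k ih =>
    rw [pow_succ', linear_mul, linear_mul, ih.1, ih.2, map_smul, map_smul, h.map_p, h.map_m,
      smul_smul, smul_smul, pow_succ, pow_succ]
    exact ⟨rfl, rfl⟩

end IsHyp

/-- The group acts properly discontinuously. -/
def IsProper (Γ : Subgroup (LSpace ≃ᵃ[ℝ] LSpace)) : Prop :=
  ∀ K : Set LSpace, IsCompact K → {γ | γ ∈ Γ ∧ ((γ '' K) ∩ K).Nonempty}.Finite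

lemma exists_bound_linear_mul_pow (a b : ℝ) {q : ℝ} (hq0 : 0 ≤ q) (hq : q < 1) :
    ∃ C, ∀ n : ℕ, (a + b * n) * q ^ n ≤ C := by
  have h1 : Tendsto (fun n : ℕ => a * q ^ n + b * (n * q ^ n)) atTop (𝓝 (a * 0 + b * 0)) :=
    ((tendsto_pow_atTop_nhds_zero_of_lt_one hq0 hq).const_mul a).add
      ((tendsto_self_mul_const_pow_of_lt_one hq0 hq).const_mul b)
  obtain ⟨C, hC⟩ := h1.bddAbove_range
  refine ⟨C, fun n => ?_⟩
  have := hC ⟨n, rfl⟩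
  simp only at this
  linarith

/-- `δ ^ m` translates backwards along its axis and `γ ^ k` forwards along its own. When the two
amounts match, a point of a compact set is carried by `δ ^ m` far along `dp`, to a point that
differs from the axis of `γ` mostly along the contracting direction `gm`, and `γ ^ k` brings it
back. -/
lemma not_opposite_of_transverse {Γ : Subgroup (LSpace ≃ᵃ[ℝ] LSpace)} (hprop : IsProper Γ)
    (hlin : ∀ γ ∈ Γ, IsSO21o γ.linear) {γ δ : LSpace ≃ᵃ[ℝ] LSpace} (hγ : γ ∈ Γ) (hδ : δ ∈ Γ)
    {l r : ℝ} {gm gp dm dp : LSpace} (hg : IsHyp γ l gm gp) (hd : IsHyp δ r dm dp)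
    (hgn : lorentz gm gp = -1) (hdn : lorentz dm dp = -1) (htr : lorentz gm dp ≠ 0)
    (hpos : 0 < vol gm gp (γ 0 - 0)) (hneg : vol dm dp (δ 0 - 0) < 0) : False := by
  obtain ⟨z, hz⟩ := hg.exists_axis hgn
  obtain ⟨y, hy⟩ := hd.exists_axis hdn
  set β := vol gm gp (γ 0 - 0)
  set α := vol dm dp (δ 0 - 0)
  set g0 := lorentzCross gm gp with hg0
  set d0 := lorentzCross dm dp with hd0
  set n := lorentzCross gm dp with hn
  have hl := hg.one_lt
  have hr := hd.one_lt
  set μ := lorentz gm dp with hμ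
  have hμneg : μ < 0 := hg.null_m.lorentz_neg hd.null_p htr
  have hg0n : lorentz g0 n = -μ := by
    rw [hg0, hn, lorentz_cross_cross, hg.null_m.1, lorentz_comm gp gm, hgn, ← hμ]; ring
  have hd0n : lorentz d0 n = -μ := by
    rw [hd0, hn, lorentz_cross_cross, hd.null_p.1, lorentz_comm dp gm, hdn, ← hμ]; ring
  have hg0gm : lorentz g0 gm = 0 := lorentz_cross_self_left _ _
  have hd0dp : lorentz d0 dp = 0 := lorentz_cross_self_right _ _
  set e := y - z with he
  -- The floor makes the total translation `m * α + k m * β` bounded, which bounds `c`.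
  let k : ℕ → ℕ := fun m => ⌊m * (-α) / β⌋₊
  have hk0 : ∀ m : ℕ, 0 ≤ m * (-α) / β := fun m => by
    have : 0 ≤ -α := by linarith
    positivity
  have hk1 : ∀ m : ℕ, (k m : ℝ) * β ≤ m * (-α) := fun m => by
    rw [← le_div_iff₀ hpos]; exact Nat.floor_le (hk0 m)
  have hk2 : ∀ m : ℕ, m * (-α) - β < (k m : ℝ) * β := fun m => by
    have := Nat.lt_floor_add_one (m * (-α) / β)
    rw [div_lt_iff₀ hpos] at this
    simp only [k]; linarith
  have hkmono : Monotone k := fun a b hab => Nat.floor_mono (by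
    have : 0 ≤ -α := by linarith
    gcongr)
  -- Chosen so that the gap vector `v m` is orthogonal to `n = gm × dp`, hence a combination of `dp`
  -- and `gm` alone.
  let c : ℕ → ℝ := fun m => -(m * α + k m * β + lorentz e n / (-μ))
  let v : ℕ → LSpace := fun m => e + (c m + m * α) • d0 + (k m * β) • g0
  let P : ℕ → ℝ := fun m => lorentz (v m) gm / μ
  let Q : ℕ → ℝ := fun m => lorentz (v m) dp / μ
  have hv : ∀ m, v m = P m • dp + Q m • gm := by
    intro m
    have h1 := cross_frame gm dp (v m)
    have h2 : lorentz (v m) (lorentzCross gm dp) = 0 := by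
      rw [← hn]
      simp only [v, c, lorentz_add_left, lorentz_smul_left, hg0n, hd0n]
      field_simp
      ring
    rw [h2, lorentz_cross_cross, hg.null_m.1, hd.null_p.1, lorentz_comm dp gm, ← hμ] at h1
    have hμ0 : μ ^ 2 ≠ 0 := pow_ne_zero _ htr
    have h3 : v m = (μ ^ 2)⁻¹ • ((μ ^ 2) • v m) := by
      rw [smul_smul, inv_mul_cancel₀ hμ0, one_smul]
    rw [h3, show μ ^ 2 • v m = -(0 * 0 - μ * μ) • v m by congr 1; ring, h1]
    funext i
    simp only [P, Q, Pi.add_apply, Pi.smul_apply, smul_eq_mul]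
    field_simp
    ring
  -- Coefficients of the initial and final points. `P` and `Q` grow at most linearly while the
  -- contraction factors decay exponentially, so both stay bounded.
  let s : ℕ → ℝ := fun m => -P m * (r⁻¹) ^ m
  let t : ℕ → ℝ := fun m => Q m * (l⁻¹) ^ k m
  have hmap : ∀ m, (γ ^ k m * δ ^ m) (y + s m • dp + c m • d0) = z + t m • gm := by
    intro m
    have h1 := hd.pow_apply (hlin _ hδ) hy (s m) 0 (c m) m
    have h2 := hg.pow_apply (hlin _ hγ) hz 0 (l ^ k m * Q m) (-(k m * β)) (k m)
    rw [zero_smul, add_zero, mul_zero, zero_smul, add_zero] at h1 h2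
    have hr0 : r ^ m * r⁻¹ ^ m = 1 := by
      rw [← mul_pow, mul_inv_cancel₀ (by linarith), one_pow]
    have hl0 : l⁻¹ ^ k m * l ^ k m = 1 := by
      rw [← mul_pow, inv_mul_cancel₀ (by linarith), one_pow]
    rw [affine_mul_apply, h1]
    have h3 : y + (r ^ m * s m) • dp + (c m + m * α) • d0 =
        z + Q m • gm + (-(k m * β)) • g0 := by
      have e1 := hv m
      simp only [v] at e1
      have e2 : r ^ m * s m = -P m := by
        simp only [s]; rw [mul_comm, mul_assoc, mul_comm (r⁻¹ ^ m), hr0, mul_one]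
      rw [e2]
      funext i
      have := congrFun e1 i
      simp only [he, Pi.add_apply, Pi.smul_apply, Pi.sub_apply, smul_eq_mul] at this ⊢
      linarith
    rw [h3]
    have h4 := hg.pow_apply (hlin _ hγ) hz 0 (Q m) (-(k m * β)) (k m)
    rw [zero_smul, add_zero, mul_zero, zero_smul, add_zero, neg_add_cancel, zero_smul,
      add_zero] at h4
    rw [h4, mul_comm]
  obtain ⟨C, hC⟩ : ∃ C, ∀ m, |c m| ≤ C := by
    refine ⟨β + |lorentz e n / (-μ)|, fun m => ?_⟩
    have e1 := hk1 m
    have e2 := hk2 m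
    simp only [c]
    rw [abs_neg]
    refine (abs_add_le _ _).trans (add_le_add_left ?_ _)
    rw [abs_le]; constructor <;> linarith
  obtain ⟨S, hS⟩ : ∃ S, ∀ m, |s m| ≤ S := by
    obtain ⟨S, hS⟩ := exists_bound_linear_mul_pow
      ((|lorentz e gm| + |lorentz e n / (-μ)| * |lorentz d0 gm|) / |μ|)
      ((-α) * |lorentz d0 gm| / |μ|) (q := r⁻¹) (by positivity) (inv_lt_one_of_one_lt₀ hr)
    refine ⟨S, fun m => le_trans ?_ (hS m)⟩
    simp only [s]
    rw [abs_mul, abs_neg, abs_of_nonneg (by positivity : (0:ℝ) ≤ r⁻¹ ^ m)]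
    refine mul_le_mul_of_nonneg_right ?_ (by positivity)
    simp only [P]
    rw [abs_div, ← mul_div_right_comm, ← add_div]
    refine div_le_div_of_nonneg_right ?_ (abs_nonneg _)
    simp only [v, c, lorentz_add_left, lorentz_smul_left, hg0gm]
    rw [show lorentz e gm + (-(↑m * α + ↑(k m) * β + lorentz e n / -μ) + ↑m * α) * lorentz d0 gm +
      ↑(k m) * β * 0 = lorentz e gm + (-(lorentz e n / -μ) * lorentz d0 gm +
        (- (k m * β)) * lorentz d0 gm) by ring]
    refine (abs_add_le _ _).trans ?_
    rw [add_assoc]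
    refine add_le_add_right ((abs_add_le _ _).trans ?_) _
    rw [abs_mul, abs_neg, abs_mul, abs_neg, abs_of_nonneg (by positivity : 0 ≤ (k m : ℝ) * β)]
    have := mul_le_mul_of_nonneg_right (hk1 m) (abs_nonneg (lorentz d0 gm))
    linarith
  obtain ⟨T, hT⟩ : ∃ T, ∀ m, |t m| ≤ T := by
    obtain ⟨T, hT⟩ := exists_bound_linear_mul_pow
      (|lorentz e dp| / |μ|) (β * |lorentz g0 dp| / |μ|) (q := l⁻¹) (by positivity)
      (inv_lt_one_of_one_lt₀ hl)
    refine ⟨T, fun m => le_trans ?_ (hT (k m))⟩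
    simp only [t]
    rw [abs_mul, abs_of_nonneg (by positivity : (0:ℝ) ≤ l⁻¹ ^ k m)]
    refine mul_le_mul_of_nonneg_right ?_ (by positivity)
    simp only [Q]
    rw [abs_div, ← mul_div_right_comm, ← add_div]
    refine div_le_div_of_nonneg_right ?_ (abs_nonneg _)
    simp only [v, lorentz_add_left, lorentz_smul_left, hd0dp, mul_zero, add_zero]
    refine (abs_add_le _ _).trans ?_
    rw [abs_mul, abs_of_nonneg (by positivity : 0 ≤ (k m : ℝ) * β)]
    exact le_of_eq (by ring)
  set R := (‖y‖ + S * ‖dp‖ + C * ‖d0‖) ⊔ (‖z‖ + T * ‖gm‖) with hR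
  have hfin := hprop (Metric.closedBall 0 R) (isCompact_closedBall _ _)
  have hmem : ∀ m, γ ^ k m * δ ^ m ∈ {γ | γ ∈ Γ ∧
      ((γ '' Metric.closedBall 0 R) ∩ Metric.closedBall 0 R).Nonempty} := by
    intro m
    refine ⟨Γ.mul_mem (Γ.pow_mem hγ _) (Γ.pow_mem hδ _), z + t m • gm,
      ⟨y + s m • dp + c m • d0, ?_, hmap m⟩, ?_⟩
    · rw [mem_closedBall_zero_iff]
      refine le_trans ?_ le_sup_left
      refine (norm_add_le _ _).trans (add_le_add ((norm_add_le _ _).trans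
        (add_le_add_right ?_ _)) ?_)
      · rw [norm_smul]; exact mul_le_mul_of_nonneg_right (hS m) (norm_nonneg _)
      · rw [norm_smul]; exact mul_le_mul_of_nonneg_right (hC m) (norm_nonneg _)
    · rw [mem_closedBall_zero_iff]
      refine le_trans ?_ le_sup_right
      refine (norm_add_le _ _).trans (add_le_add_right ?_ _)
      rw [norm_smul]; exact mul_le_mul_of_nonneg_right (hT m) (norm_nonneg _)
  -- This pairing grows strictly in absolute value with `m`, so the elements are pairwise distinct.
  have hstep : ∀ m, lorentz ((γ ^ k m * δ ^ m).linear dp) gm = r ^ m * l ^ k m * lorentz dp gm := by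
    intro m
    have hl0 : l ^ k m * l⁻¹ ^ k m = 1 := by
      rw [← mul_pow, mul_inv_cancel₀ (by linarith), one_pow]
    rw [linear_mul, (hd.pow_linear m).1, map_smul, lorentz_smul_left]
    have := (hlin _ (Γ.pow_mem hγ (k m))).inner dp gm
    rw [(hg.pow_linear (k m)).2, lorentz_smul_right] at this
    rw [← this]
    linear_combination (-(r ^ m * lorentz ((γ ^ k m).linear dp) gm)) * hl0
  have hinj : Function.Injective fun m => γ ^ k m * δ ^ m := by
    refine Function.Injective.of_lt_imp_ne fun m m' hmm heq => ?_
    have h1 := hstep m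
    rw [heq, hstep m'] at h1
    have h2 := mul_right_cancel₀ (by rw [lorentz_comm]; exact htr) h1
    have h3 : r ^ m < r ^ m' := pow_lt_pow_right₀ hr hmm
    have h4 : l ^ k m ≤ l ^ k m' := pow_le_pow_right₀ hl.le (hkmono hmm.le)
    have : r ^ m * l ^ k m < r ^ m' * l ^ k m' := by
      have : 0 < l ^ k m := by positivity
      have : 0 ≤ r ^ m' := by positivity
      nlinarith
    linarith
  exact Set.infinite_of_injective_forall_mem hinj hmem hfin

lemma vol_swap (u v w : LSpace) : vol v u w = -vol u v w := by simp only [vol]; ring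

lemma vol_neg_right (u v w : LSpace) : vol u v (-w) = -vol u v w := by
  simp only [vol, Pi.neg_apply]; ring

/-- Margulis's opposite sign lemma. -/
lemma not_opposite {Γ : Subgroup (LSpace ≃ᵃ[ℝ] LSpace)} (hprop : IsProper Γ)
    (hlin : ∀ γ ∈ Γ, IsSO21o γ.linear) {γ δ : LSpace ≃ᵃ[ℝ] LSpace} (hγ : γ ∈ Γ) (hδ : δ ∈ Γ)
    {l r : ℝ} {gm gp dm dp : LSpace} (hg : IsHyp γ l gm gp) (hd : IsHyp δ r dm dp)
    (hpos : 0 < vol gm gp (γ 0 - 0)) (hneg : vol dm dp (δ 0 - 0) < 0) : False := by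
  have norm : ∀ {γ : LSpace ≃ᵃ[ℝ] LSpace} {l : ℝ} {gm gp : LSpace}, γ ∈ Γ → IsHyp γ l gm gp →
      0 < -(lorentz gm gp)⁻¹ ∧ IsHyp γ l ((-(lorentz gm gp)⁻¹) • gm) gp ∧
      lorentz ((-(lorentz gm gp)⁻¹) • gm) gp = -1 := by
    intro γ l gm gp hγ hg
    have h := hg.neg (hlin _ hγ)
    have hc : 0 < -(lorentz gm gp)⁻¹ := by
      have := inv_neg''.2 h
      linarith
    refine ⟨hc, hg.smul_m hc, ?_⟩
    rw [lorentz_smul_left, neg_mul, inv_mul_cancel₀ h.ne]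
  obtain ⟨cg, hg', hgn⟩ := norm hγ hg
  by_cases htr : lorentz gm dp = 0
  -- When `gm` and `dp` are parallel, `δ` is replaced by its inverse: this exchanges `dp` and `dm`,
  -- keeps the sign of the invariant, and `dm` is not parallel to `dp`.
  · have hd2 := hd.inv
    obtain ⟨cd, hd', hdn⟩ := norm (Γ.inv_mem hδ) hd2
    refine not_opposite_of_transverse hprop hlin hγ (Γ.inv_mem hδ) hg' hd' hgn hdn ?_ ?_ ?_
    · rw [lorentz_smul_left]
      refine mul_ne_zero cg.ne' fun h0 => ?_
      obtain ⟨c, hc, rfl⟩ := hg.null_m.exists_smul hd.null_p htr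
      have := hd.neg (hlin _ hδ)
      rw [lorentz_smul_right, lorentz_comm, h0] at this
      simp at this
    · rw [vol_smul_left]; exact mul_pos cg hpos
    · rw [vol_smul_left]
      refine mul_neg_of_pos_of_neg cd ?_
      rw [hd2.vol_sub (hlin _ (Γ.inv_mem hδ)) 0 (δ 0), affine_inv_apply, vol_swap,
        ← neg_sub, vol_neg_right, neg_neg]
      exact hneg
  · obtain ⟨cd, hd', hdn⟩ := norm hδ hd
    refine not_opposite_of_transverse hprop hlin hγ hδ hg' hd' hgn hdn ?_ ?_ ?_
    · rw [lorentz_smul_left]; exact mul_ne_zero cg.ne' htr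
    · rw [vol_smul_left]; exact mul_pos cg hpos
    · rw [vol_smul_left]; exact mul_neg_of_pos_of_neg cd hneg

/-- All Margulis invariants are nonnegative for the orientation `ε`. -/
def NonnegInvariants (ε : ℝ) (Γ : Subgroup (LSpace ≃ᵃ[ℝ] LSpace)) : Prop :=
  ∀ γ ∈ Γ, ∀ (l : ℝ) (xm xp : LSpace), IsHyp γ l xm xp → ∀ x, 0 ≤ ε * vol xm xp (γ x - x)

lemma HasMargulisInvariant.exists_hyp {ε α : ℝ} {γ : LSpace ≃ᵃ[ℝ] LSpace}
    (h : HasMargulisInvariant ε γ α) (hα : 0 < α) :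
    ∃ l xm xp, IsHyp γ l xm xp ∧ ∀ x, 0 < ε * vol xm xp (γ x - x) := by
  obtain ⟨l, xm, xp, hl, hm, hp, hAp, hAm, hx⟩ := h
  refine ⟨l, xm, xp, ⟨hl, hm, hp, hAp, hAm⟩, fun x => ?_⟩
  have h1 := hx x
  rw [neutralVector, lorentz_smul_right] at h1
  set N := √(lorentz (lorentzCross xm xp) (lorentzCross xm xp))
  have hN : 0 ≤ N := Real.sqrt_nonneg _
  have : ε * vol xm xp (γ x - x) / N = α := by rw [← h1, lorentz_comm _ (lorentzCross xm xp), lorentz_cross_eq_vol]; ring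
  -- A zero norm would make the quotient, and so `α`, equal to `0` by the convention for division.
  rcases hN.eq_or_lt with h0 | h0
  · rw [← h0, div_zero] at this; linarith
  · rw [div_eq_iff h0.ne'] at this
    rw [this]; positivity

lemma nonnegInvariants {ε : ℝ} (hε : ε = 1 ∨ ε = -1) {Γ : Subgroup (LSpace ≃ᵃ[ℝ] LSpace)}
    (hprop : IsProper Γ) (hlin : ∀ γ ∈ Γ, IsSO21o γ.linear)
    (hpos : ∃ γ ∈ Γ, ∃ α : ℝ, HasMargulisInvariant ε γ α ∧ 0 < α) : NonnegInvariants ε Γ := by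
  obtain ⟨γ, hγ, α, hα, hα0⟩ := hpos
  obtain ⟨l, gm, gp, hg, hgpos⟩ := hα.exists_hyp hα0
  intro δ hδ r dm dp hd x
  by_contra hneg
  push Not at hneg
  rw [hd.vol_sub (hlin _ hδ) x 0] at hneg
  have hgp := hgpos 0
  rcases hε with rfl | rfl
  · rw [one_mul] at hneg hgp
    exact not_opposite hprop hlin hγ hδ hg hd hgp hneg
  · refine not_opposite hprop hlin hδ hγ hd hg ?_ ?_ <;> linarith

/-! ### Eigenvectors of elements of large trace -/

/-- The trace of a map in the standard coordinates. -/
def tr (R : LSpace → LSpace) : ℝ := R ![1, 0, 0] 0 + R ![0, 1, 0] 1 + R ![0, 0, 1] 2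

lemma coord_decomp (v : LSpace) :
    v = v 0 • (![1, 0, 0] : LSpace) + v 1 • (![0, 1, 0] : LSpace) + v 2 • (![0, 0, 1] : LSpace) := by
  apply ext_coord <;> simp

lemma exists_comb_eq_zero {a b c : LSpace} (h : vol a b c = 0) :
    ∃ v : LSpace, v ≠ 0 ∧ v 0 • a + v 1 • b + v 2 • c = 0 := by
  rw [← lorentz_cross_eq_vol, lorentz_lorentzCross] at h
  obtain ⟨v, hv, hv0⟩ := Matrix.exists_vecMul_eq_zero_iff.2 h
  refine ⟨v, hv, ?_⟩
  rw [← hv0]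
  funext i
  simp [Matrix.vecMul, dotProduct, Fin.sum_univ_three]

/-- The characteristic polynomial. Equivariance of the cross product identifies the principal 2×2
minors with diagonal entries, so the middle coefficients are both given by the trace. -/
lemma IsSO21o.det_sub {A : LSpace ≃ₗ[ℝ] LSpace} (hA : IsSO21o A) (l : ℝ) :
    vol (A ![1, 0, 0] - l • ![1, 0, 0]) (A ![0, 1, 0] - l • ![0, 1, 0])
      (A ![0, 0, 1] - l • ![0, 0, 1]) = -((l - 1) * (l ^ 2 - (tr A - 1) * l + 1)) := by
  have h0 := hA.cross ![0, 1, 0] ![0, 0, 1]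
  have h1 := hA.cross ![0, 0, 1] ![1, 0, 0]
  have h2 := hA.cross ![1, 0, 0] ![0, 1, 0]
  have h3 := hA.vol_map ![1, 0, 0] ![0, 1, 0] ![0, 0, 1]
  rw [show lorentzCross ![0, 1, 0] ![0, 0, 1] = ![1, 0, 0] by
    apply ext_coord <;> simp [lorentzCross]] at h0
  rw [show lorentzCross ![0, 0, 1] ![1, 0, 0] = ![0, 1, 0] by
    apply ext_coord <;> simp [lorentzCross]] at h1
  rw [show lorentzCross ![1, 0, 0] ![0, 1, 0] = -![0, 0, 1] by
    apply ext_coord <;> simp [lorentzCross], map_neg] at h2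
  have e0 := congrFun h0 0
  have e1 := congrFun h1 1
  have e2 := congrFun h2 2
  rw [show vol ![1, 0, 0] ![0, 1, 0] ![0, 0, 1] = 1 by simp [vol]] at h3
  simp only [tr, vol, lorentzCross_zero, lorentzCross_one, lorentzCross_two, Pi.neg_apply]
    at e0 e1 e2 h3 ⊢
  simp only [Pi.sub_apply, Pi.smul_apply, smul_eq_mul, Matrix.cons_val_zero, Matrix.cons_val_one,
    Matrix.cons_val, mul_zero, mul_one, sub_zero]
  linear_combination h3 + l * e0 + l * e1 - l * e2

lemma exists_root {T : ℝ} (hT : 3 < T) : ∃ l : ℝ, 1 < l ∧ l ^ 2 - (T - 1) * l + 1 = 0 := by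
  have hd : 0 ≤ (T - 1) ^ 2 - 4 := by nlinarith
  have hs := Real.sq_sqrt hd
  refine ⟨((T - 1) + √((T - 1) ^ 2 - 4)) / 2, ?_, by linarith⟩
  have := Real.sqrt_nonneg ((T - 1) ^ 2 - 4)
  linarith

lemma IsSO21o.exists_eigen {A : LSpace ≃ₗ[ℝ] LSpace} (hA : IsSO21o A) (hT : 3 < tr A) :
    ∃ (l : ℝ) (v : LSpace), 1 < l ∧ l ^ 2 - (tr A - 1) * l + 1 = 0 ∧ FutureNull v ∧ v 2 = 1 ∧
      A v = l • v := by
  obtain ⟨l, hl, hroot⟩ := exists_root hT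
  have hdet := hA.det_sub l
  rw [hroot, mul_zero, neg_zero] at hdet
  obtain ⟨v, hv, hv0⟩ := exists_comb_eq_zero hdet
  have hAv : A v = l • v := by
    conv_lhs => rw [coord_decomp v]
    conv_rhs => rw [coord_decomp v]
    simp only [map_add, map_smul, smul_add]
    rw [← sub_eq_zero, ← hv0]
    simp only [smul_sub, smul_comm l]
    abel
  have hnull : lorentz v v = 0 := by
    have := hA.inner v v
    rw [hAv, lorentz_smul_left, lorentz_smul_right] at this
    have h2 : (l ^ 2 - 1) * lorentz v v = 0 := by linarith
    rcases mul_eq_zero.1 h2 with h | h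
    · nlinarith
    · exact h
  have hv2 : v 2 ≠ 0 := by
    intro h
    have := planar_le hnull.le
    rw [h] at this
    refine hv (ext_coord ?_ ?_ h) <;> simp only [Pi.zero_apply] <;>
      nlinarith [sq_nonneg (v 0), sq_nonneg (v 1)]
  refine ⟨l, (v 2)⁻¹ • v, hl, hroot, ⟨?_, ?_⟩, ?_, ?_⟩
  · rw [lorentz_smul_left, lorentz_smul_right, hnull]; simp
  · simp [hv2]
  · simp [hv2]
  · rw [map_smul, hAv, smul_comm]

lemma norm_le_of_causal {v : LSpace} (h : lorentz v v ≤ 0) : ‖v‖ ≤ |v 2| := by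
  have := planar_le h
  rw [pi_norm_le_iff_of_nonneg (abs_nonneg _)]
  intro i
  rw [Real.norm_eq_abs, ← sq_le_sq]
  fin_cases i <;> simp only [Fin.zero_eta, Fin.mk_one, Fin.reduceFinMk] <;>
    nlinarith [sq_nonneg (v 0), sq_nonneg (v 1)]

lemma continuous_lorentz : Continuous fun p : LSpace × LSpace => lorentz p.1 p.2 := by
  unfold lorentz; fun_prop

lemma tendsto_lorentz {ι : Type*} {F : Filter ι} {u v : ι → LSpace} {a b : LSpace}
    (hu : Tendsto u F (𝓝 a)) (hv : Tendsto v F (𝓝 b)) :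
    Tendsto (fun i => lorentz (u i) (v i)) F (𝓝 (lorentz a b)) :=
  (continuous_lorentz.tendsto (a, b)).comp (hu.prodMk_nhds hv)

lemma tendsto_vol {ι : Type*} {F : Filter ι} {u v w : ι → LSpace} {a b c : LSpace}
    (hu : Tendsto u F (𝓝 a)) (hv : Tendsto v F (𝓝 b)) (hw : Tendsto w F (𝓝 c)) :
    Tendsto (fun i => vol (u i) (v i) (w i)) F (𝓝 (vol a b c)) := by
  have : Continuous fun p : LSpace × LSpace × LSpace => vol p.1 p.2.1 p.2.2 := by
    unfold vol; fun_prop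
  exact (this.tendsto (a, b, c)).comp (hu.prodMk_nhds (hv.prodMk_nhds hw))

lemma tendsto_coord {ι : Type*} {F : Filter ι} {u : ι → LSpace} {a : LSpace}
    (hu : Tendsto u F (𝓝 a)) (i : Fin 3) : Tendsto (fun j => u j i) F (𝓝 (a i)) :=
  (tendsto_pi_nhds.1 hu) i

/-- Pointwise convergence of linear maps is joint in the vector. -/
lemma tendsto_apply_of_pointwise {M : ℕ → LSpace ≃ₗ[ℝ] LSpace} {c : ℕ → ℝ} {R : LSpace → LSpace}
    (hR : ∀ x, Tendsto (fun n => c n • M n x) atTop (𝓝 (R x))) {v : ℕ → LSpace} {a : LSpace}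
    (hv : Tendsto v atTop (𝓝 a)) : Tendsto (fun n => c n • M n (v n)) atTop (𝓝 (R a)) := by
  have hlin : R a = a 0 • R ![1, 0, 0] + a 1 • R ![0, 1, 0] + a 2 • R ![0, 0, 1] := by
    refine tendsto_nhds_unique (hR a) ?_
    have := (((hR ![1, 0, 0]).const_smul (a 0)).add ((hR ![0, 1, 0]).const_smul (a 1))).add
      ((hR ![0, 0, 1]).const_smul (a 2))
    refine this.congr fun n => ?_
    conv_rhs => rw [coord_decomp a]
    simp only [map_add, map_smul, smul_add, smul_comm (c n)]
  rw [hlin]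
  have := (((tendsto_coord hv 0).smul (hR ![1, 0, 0])).add
    ((tendsto_coord hv 1).smul (hR ![0, 1, 0]))).add ((tendsto_coord hv 2).smul (hR ![0, 0, 1]))
  refine this.congr fun n => ?_
  conv_rhs => rw [coord_decomp (v n)]
  simp only [map_add, map_smul, smul_add, smul_comm (c n)]

/-- Rescaled elements of `SO(2,1)ᵒ` converging to a map of large trace have, along a subsequence,
expanding eigenvectors converging to an eigenvector of the limit. -/
lemma exists_subseq_eigen {M : ℕ → LSpace ≃ₗ[ℝ] LSpace} (hM : ∀ n, IsSO21o (M n))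
    {c : ℕ → ℝ} {c' : ℝ} (hc : ∀ n, 0 < c n) (hc' : Tendsto c atTop (𝓝 c')) {R : LSpace → LSpace}
    (hR : ∀ x, Tendsto (fun n => c n • M n x) atTop (𝓝 (R x))) (htr : 3 * c' < tr R) :
    ∃ φ : ℕ → ℕ, StrictMono φ ∧ ∃ (l : ℕ → ℝ) (v : ℕ → LSpace) (κ : ℝ) (a : LSpace),
      (∀ n, 1 < l n ∧ FutureNull (v n) ∧ M (φ n) (v n) = l n • v n) ∧
      Tendsto v atTop (𝓝 a) ∧ FutureNull a ∧ R a = κ • a ∧ (tr R - c') / 2 ≤ κ := by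
  have hT : Tendsto (fun n => c n * tr (M n)) atTop (𝓝 (tr R)) := by
    have := ((tendsto_coord (hR ![1, 0, 0]) 0).add (tendsto_coord (hR ![0, 1, 0]) 1)).add
      (tendsto_coord (hR ![0, 0, 1]) 2)
    refine this.congr fun n => ?_
    simp only [tr, Pi.smul_apply, smul_eq_mul]; ring
  have hbig : ∀ᶠ n in atTop, 3 < tr (M n) := by
    filter_upwards [(hc'.const_mul 3).eventually_lt hT htr] with n hn
    have := hc n
    rw [mul_comm] at hn
    exact lt_of_mul_lt_mul_left hn this.le
  obtain ⟨N, hN⟩ := eventually_atTop.1 hbig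
  have hex : ∀ n, ∃ (l : ℝ) (v : LSpace), 1 < l ∧ l ^ 2 - (tr (M (n + N)) - 1) * l + 1 = 0 ∧
      FutureNull v ∧ v 2 = 1 ∧ M (n + N) v = l • v := fun n =>
    (hM _).exists_eigen (hN _ (by omega))
  choose l v hl hroot hv hv2 hMv using hex
  -- Since `l + l⁻¹ = tr - 1`, the eigenvalue lies between `(tr - 1) / 2` and `tr`; rescaled
  -- eigenvalues are therefore bounded, and the lower bound survives in the limit.
  have hl1 : ∀ n, c (n + N) * l n ≤ c (n + N) * tr (M (n + N)) := fun n => by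
    refine mul_le_mul_of_nonneg_left ?_ (hc _).le
    nlinarith [hl n, hroot n]
  have hl2 : ∀ n, (c (n + N) * tr (M (n + N)) - c (n + N)) / 2 ≤ c (n + N) * l n := fun n => by
    have h1 := hl n
    have h2 := hroot n
    have : (tr (M (n + N)) - 1) / 2 ≤ l n := by nlinarith
    have := mul_le_mul_of_nonneg_left this (hc (n + N)).le
    linarith
  have hTN := hT.comp (tendsto_add_atTop_nat N)
  obtain ⟨C, hC⟩ := hTN.bddAbove_range
  have hCn : ∀ n, c (n + N) * tr (M (n + N)) ≤ C := fun n => hC ⟨n, rfl⟩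
  have hcomp : IsCompact (Icc (0 : ℝ) C ×ˢ Metric.closedBall (0 : LSpace) 1) :=
    isCompact_Icc.prod (isCompact_closedBall _ _)
  obtain ⟨⟨κ, a⟩, -, ψ, hψ, hlim⟩ := hcomp.tendsto_subseq
    (x := fun n => (c (n + N) * l n, v n)) (fun n => by
      refine ⟨⟨mul_nonneg (hc _).le (by linarith [hl n]), (hl1 n).trans (hCn n)⟩, ?_⟩
      rw [mem_closedBall_zero_iff]
      refine (norm_le_of_causal (hv n).1.le).trans ?_
      simp [hv2 n])
  have hκ : Tendsto (fun n => c (ψ n + N) * l (ψ n)) atTop (𝓝 κ) :=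
    (continuous_fst.tendsto _).comp hlim
  have ha : Tendsto (fun n => v (ψ n)) atTop (𝓝 a) := (continuous_snd.tendsto _).comp hlim
  have hφ : StrictMono fun n => ψ n + N := fun i j hij => Nat.add_lt_add_right (hψ hij) N
  refine ⟨fun n => ψ n + N, hφ, fun n => l (ψ n), fun n => v (ψ n), κ, a,
    fun n => ⟨hl _, hv _, hMv _⟩, ha, ⟨?_, ?_⟩, ?_, ?_⟩
  · refine tendsto_nhds_unique (tendsto_lorentz ha ha) ?_
    simp only [(hv _).1]
    exact tendsto_const_nhds
  · have : a 2 = 1 := by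
      refine tendsto_nhds_unique (tendsto_coord ha 2) ?_
      simp only [hv2]
      exact tendsto_const_nhds
    rw [this]; exact one_pos
  · have h1 := tendsto_apply_of_pointwise (M := fun n => M (ψ n + N)) (c := fun n => c (ψ n + N))
      (R := R) (fun x => (hR x).comp hφ.tendsto_atTop) ha
    refine tendsto_nhds_unique h1 ?_
    refine (hκ.smul ha).congr fun n => ?_
    rw [hMv, smul_smul]
  · have h3 := (hT.comp hφ.tendsto_atTop).sub (hc'.comp hφ.tendsto_atTop)
    exact le_of_tendsto_of_tendsto (h3.div_const 2) hκ (Eventually.of_forall fun n => hl2 _)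

/-! ### Discreteness of the linear holonomy -/

lemma lorentzCross_cross (w u v : LSpace) :
    lorentzCross w (lorentzCross u v) = lorentz w u • v - lorentz w v • u := by
  apply ext_coord <;> simp only [lorentz, Pi.sub_apply, Pi.smul_apply, smul_eq_mul,
    lorentzCross_zero, lorentzCross_one, lorentzCross_two] <;> ring

lemma exists_smul_of_cross_eq_zero {u v : LSpace} (hu : u ≠ 0) (h : lorentzCross u v = 0) :
    ∃ c : ℝ, v = c • u := by
  have h0 := congrFun h 0
  have h1 := congrFun h 1
  have h2 := congrFun h 2
  simp only [lorentzCross_zero, lorentzCross_one, lorentzCross_two, Pi.zero_apply] at h0 h1 h2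
  by_cases c0 : u 0 = 0
  · by_cases c1 : u 1 = 0
    · have c2 : u 2 ≠ 0 := fun c2 => hu (ext_coord c0 c1 c2)
      refine ⟨v 2 / u 2, ext_coord ?_ ?_ ?_⟩ <;> simp only [Pi.smul_apply, smul_eq_mul] <;>
        field_simp <;> linarith
    · refine ⟨v 1 / u 1, ext_coord ?_ ?_ ?_⟩ <;> simp only [Pi.smul_apply, smul_eq_mul] <;>
        field_simp <;> linarith
  · refine ⟨v 0 / u 0, ext_coord ?_ ?_ ?_⟩ <;> simp only [Pi.smul_apply, smul_eq_mul] <;>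
      field_simp <;> linarith

/-- If the orbit of `u` is orthogonal to `q`, it is orthogonal to the orbit of `q` as well. That
orbit then lies on the line orthogonal to the independent vectors `u` and `f u`, so the line of `q`
would be invariant. -/
lemma Irred.exists_lorentz_ne {Γ : Subgroup (LSpace ≃ᵃ[ℝ] LSpace)} (hirr : Irred Γ)
    (hlin : ∀ γ ∈ Γ, IsSO21o γ.linear) {u q : LSpace} (hu : u ≠ 0) (hq : q ≠ 0) :
    ∃ γ ∈ Γ, lorentz (γ.linear u) q ≠ 0 := by
  by_contra hcon
  push Not at hcon
  obtain ⟨f, hf, hfu⟩ := hirr u hu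
  set n := lorentzCross u (f.linear u) with hn
  have hn0 : n ≠ 0 := fun h => by
    obtain ⟨c, hc⟩ := exists_smul_of_cross_eq_zero hu h
    exact hfu c hc
  have hpar : ∀ w, lorentz u w = 0 → lorentz (f.linear u) w = 0 → ∃ c : ℝ, w = c • n := by
    intro w h1 h2
    refine exists_smul_of_cross_eq_zero hn0 ?_
    rw [lorentzCross_swap, hn, lorentzCross_cross, lorentz_comm w, lorentz_comm w, h1, h2]
    simp
  have horth : ∀ γ ∈ Γ, ∃ c : ℝ, γ.linear q = c • n := by
    intro γ hγ
    have key : ∀ δ ∈ Γ, lorentz (δ.linear u) (γ.linear q) = 0 := by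
      intro δ hδ
      have := hcon _ (Γ.mul_mem (Γ.inv_mem hγ) hδ)
      rw [linear_mul, linear_inv, (hlin _ hγ).inner_symm_left] at this
      exact this
    exact hpar _ (key 1 Γ.one_mem) (key f hf)
  obtain ⟨c0, hc0⟩ := horth 1 Γ.one_mem
  rw [linear_one] at hc0
  have hc0' : c0 ≠ 0 := by rintro rfl; exact hq (by rw [hc0, zero_smul])
  obtain ⟨γ, hγ, hγq⟩ := hirr q hq
  obtain ⟨c, hc⟩ := horth γ hγ
  refine hγq (c / c0) ?_
  conv_rhs => rw [hc0]
  rw [hc, smul_smul, div_mul_cancel₀ _ hc0']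

namespace IsHyp
variable {γ : LSpace ≃ᵃ[ℝ] LSpace} {l : ℝ} {xm xp : LSpace}

lemma tr_eq (h : IsHyp γ l xm xp) (hA : IsSO21o γ.linear) : tr γ.linear - 1 = l + l⁻¹ := by
  have hl := h.one_lt
  have hdet := hA.det_sub l
  have hcomb : xp 0 • (γ.linear ![1, 0, 0] - l • ![1, 0, 0]) +
      xp 1 • (γ.linear ![0, 1, 0] - l • ![0, 1, 0]) +
      xp 2 • (γ.linear ![0, 0, 1] - l • ![0, 0, 1]) = 0 := by
    have h1 : γ.linear xp - l • xp = 0 := sub_eq_zero.2 h.map_p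
    conv_lhs at h1 => rw [coord_decomp xp]
    rw [← h1]
    simp only [map_add, map_smul, smul_sub, smul_add, smul_comm l]
    abel
  set a := γ.linear ![1, 0, 0] - l • ![1, 0, 0]
  set b := γ.linear ![0, 1, 0] - l • ![0, 1, 0]
  set c := γ.linear ![0, 0, 1] - l • ![0, 0, 1]
  have h2 : xp 2 * vol a b c = 0 := by
    rw [← vol_smul_right, ← add_zero (vol a b _)]
    have e : xp 2 • c = -(xp 0 • a + xp 1 • b) := by
      rw [eq_neg_iff_add_eq_zero, add_comm]; exact hcomb
    rw [e]
    simp only [vol, Pi.neg_apply, Pi.add_apply, Pi.smul_apply, smul_eq_mul]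
    ring
  have h3 : vol a b c = 0 := (mul_eq_zero.1 h2).resolve_left h.null_p.2.ne'
  rw [h3] at hdet
  have h4 : (l - 1) * (l ^ 2 - (tr γ.linear - 1) * l + 1) = 0 := by linarith
  have h5 := (mul_eq_zero.1 h4).resolve_left (by linarith)
  field_simp
  linarith

lemma three_lt_tr (h : IsHyp γ l xm xp) (hA : IsSO21o γ.linear) : 3 < tr γ.linear := by
  have h1 := h.tr_eq hA
  have hl := h.one_lt
  have : 2 < l + l⁻¹ := by
    have h2 : l * l⁻¹ = 1 := mul_inv_cancel₀ (by linarith)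
    have h3 : l⁻¹ < 1 := inv_lt_one_of_one_lt₀ hl
    nlinarith
  linarith

lemma eigen_unique (h : IsHyp γ l xm xp) (hA : IsSO21o γ.linear) {κ : ℝ} {a : LSpace}
    (hκ : 1 < κ) (ha : FutureNull a) (hAa : γ.linear a = κ • a) : ∃ c : ℝ, 0 < c ∧ a = c • xp := by
  refine h.null_p.exists_smul ha ?_
  have h1 := hA.inner xp a
  rw [h.map_p, hAa, lorentz_smul_left, lorentz_smul_right] at h1
  have hl := h.one_lt
  have h2 : (l * κ - 1) * lorentz xp a = 0 := by linarith
  refine (mul_eq_zero.1 h2).resolve_left ?_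
  nlinarith

lemma conj (h : IsHyp γ l xm xp) (f : LSpace ≃ᵃ[ℝ] LSpace) (hf : IsSO21o f.linear) :
    IsHyp (f * γ * f⁻¹) l (f.linear xm) (f.linear xp) := by
  refine ⟨h.one_lt, hf.null h.null_m, hf.null h.null_p, ?_, ?_⟩
  · rw [linear_mul, linear_inv_apply, linear_mul, h.map_p, map_smul]
  · rw [linear_mul, linear_inv_apply, linear_mul, h.map_m, map_smul]

end IsHyp

/-- Elements whose rescaled linear parts and inverses converge to maps of large trace are, along a
subsequence, hyperbolic with converging eigenvectors. -/
lemma exists_subseq_hyp {γ : ℕ → LSpace ≃ᵃ[ℝ] LSpace} (hγ : ∀ n, IsSO21o (γ n).linear)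
    (hγi : ∀ n, IsSO21o ((γ n)⁻¹).linear)
    {c : ℕ → ℝ} {c' : ℝ} (hc : ∀ n, 0 < c n) (hc' : Tendsto c atTop (𝓝 c'))
    {R R' : LSpace → LSpace}
    (hR : ∀ x, Tendsto (fun n => c n • (γ n).linear x) atTop (𝓝 (R x)))
    (hR' : ∀ x, Tendsto (fun n => c n • ((γ n)⁻¹).linear x) atTop (𝓝 (R' x)))
    (htr : 3 * c' < tr R) (htr' : 3 * c' < tr R') :
    ∃ φ : ℕ → ℕ, StrictMono φ ∧ ∃ (l : ℕ → ℝ) (xm xp : ℕ → LSpace) (κ κ' : ℝ) (a b : LSpace),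
      (∀ n, IsHyp (γ (φ n)) (l n) (xm n) (xp n)) ∧
      Tendsto xp atTop (𝓝 a) ∧ FutureNull a ∧ R a = κ • a ∧ (tr R - c') / 2 ≤ κ ∧
      Tendsto xm atTop (𝓝 b) ∧ FutureNull b ∧ R' b = κ' • b ∧ (tr R' - c') / 2 ≤ κ' := by
  obtain ⟨φ, hφ, l, v, κ, a, h1, hva, ha, hRa, hκ⟩ := exists_subseq_eigen hγ hc hc' hR htr
  obtain ⟨ψ, hψ, l', v', κ', b, h1', hvb, hb, hRb, hκ'⟩ :=
    exists_subseq_eigen (M := fun n => ((γ (φ n))⁻¹).linear) (fun n => hγi _)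
      (fun n => hc (φ n)) (hc'.comp hφ.tendsto_atTop)
      (fun x => (hR' x).comp hφ.tendsto_atTop) htr'
  refine ⟨φ ∘ ψ, hφ.comp hψ, l ∘ ψ, v', v ∘ ψ, κ, κ', a, b, fun n => ?_,
    hva.comp hψ.tendsto_atTop, ha, hRa, hκ, hvb, hb, hRb, hκ'⟩
  obtain ⟨hl, hv, hMv⟩ := h1 (ψ n)
  obtain ⟨hl', hv', hMv'⟩ := h1' n
  have hm : (γ (φ (ψ n))).linear (v' n) = (l' n)⁻¹ • v' n := by
    have := linear_apply_inv (γ (φ (ψ n))) (v' n)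
    rw [hMv', map_smul] at this
    conv_rhs => rw [← this]
    rw [smul_smul, inv_mul_cancel₀ (by linarith), one_smul]
  have hll := (hyp_eigen (hγ _) hl hl' hv' hv hMv hm).2
  exact ⟨hl, hv', hv, hMv, hm.trans (by rw [hll]; rfl)⟩

lemma tendsto_of_lorentz {ι : Type*} {F : Filter ι} {u : ι → LSpace} {a : LSpace}
    (h : ∀ y, Tendsto (fun i => lorentz (u i) y) F (𝓝 (lorentz a y))) : Tendsto u F (𝓝 a) := by
  rw [tendsto_pi_nhds]
  intro j
  have h0 := h ![1, 0, 0]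
  have h1 := h ![0, 1, 0]
  have h2 := (h ![0, 0, 1]).neg
  simp [lorentz] at h0 h1 h2
  fin_cases j
  · exact h0
  · exact h1
  · exact h2

lemma tendsto_linear_inv {η : ℕ → LSpace ≃ᵃ[ℝ] LSpace} (hη : ∀ n, IsSO21o (η n).linear)
    (h : ∀ x, Tendsto (fun n => (η n).linear x) atTop (𝓝 x)) (x : LSpace) :
    Tendsto (fun n => ((η n)⁻¹).linear x) atTop (𝓝 x) := by
  refine tendsto_of_lorentz fun y => ?_
  refine (tendsto_lorentz tendsto_const_nhds (h y)).congr fun n => ?_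
  rw [linear_inv, (hη n).inner_symm_left]

section
variable {Γ : Subgroup (LSpace ≃ᵃ[ℝ] LSpace)} {ε : ℝ}

/-- The perturbations `η n * h` remain hyperbolic with eigenvectors close to those of `h`, while
their translation parts are dominated by those of `η n`. Their invariants, rescaled, converge to the
expression in the conclusion. -/
lemma nonneg_of_linear_tendsto_id (hlin : ∀ γ ∈ Γ, IsSO21o γ.linear) (hnn : NonnegInvariants ε Γ)
    {η : ℕ → LSpace ≃ᵃ[ℝ] LSpace} (hη : ∀ n, η n ∈ Γ)
    (hid : ∀ x, Tendsto (fun n => (η n).linear x) atTop (𝓝 x)) {s : ℕ → ℝ} (hs : ∀ n, 0 < s n)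
    (hs0 : Tendsto s atTop (𝓝 0)) {q : LSpace}
    (hq : Tendsto (fun n => s n • (η n) 0) atTop (𝓝 q))
    {h : LSpace ≃ᵃ[ℝ] LSpace} (hh : h ∈ Γ) {l : ℝ} {xm xp : LSpace} (hyp : IsHyp h l xm xp) :
    0 ≤ ε * vol xm xp q := by
  have hg : ∀ n, η n * h ∈ Γ := fun n => Γ.mul_mem (hη n) hh
  have hR : ∀ x, Tendsto (fun n => (1 : ℝ) • (η n * h).linear x) atTop (𝓝 (h.linear x)) := by
    intro x
    simp only [one_smul]
    exact hid _
  have hR' : ∀ x, Tendsto (fun n => (1 : ℝ) • ((η n * h)⁻¹).linear x) atTop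
      (𝓝 ((h⁻¹).linear x)) := by
    intro x
    simp only [one_smul, mul_inv_rev]
    refine tendsto_of_lorentz fun y => ?_
    have h1 := tendsto_lorentz (tendsto_linear_inv (fun n => hlin _ (hη n)) hid x)
      (tendsto_const_nhds (x := h.linear y))
    rw [← (hlin _ hh).inner_symm_left, ← linear_inv] at h1
    refine h1.congr fun n => ?_
    rw [linear_mul, linear_inv h, (hlin _ hh).inner_symm_left]
  have htr := hyp.three_lt_tr (hlin _ hh)
  have htr' := hyp.inv.three_lt_tr (hlin _ (Γ.inv_mem hh))
  obtain ⟨φ, hφ, l', ym, yp, κ, κ', a, b, hy, hya, ha, hRa, hκ, hyb, hb, hRb, hκ'⟩ :=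
    exists_subseq_hyp (γ := fun n => η n * h) (c := fun _ => 1) (c' := 1)
      (fun n => hlin _ (hg n)) (fun n => hlin _ (Γ.inv_mem (hg n))) (fun _ => one_pos)
      tendsto_const_nhds hR hR' (by linarith) (by linarith)
  obtain ⟨p, hp, rfl⟩ := hyp.eigen_unique (hlin _ hh) (by linarith) ha hRa
  obtain ⟨r, hr, rfl⟩ := hyp.inv.eigen_unique (hlin _ (Γ.inv_mem hh)) (by linarith) hb hRb
  have hlim : 0 ≤ ε * vol (r • xm) (p • xp) q := by
    have h1 : Tendsto (fun n => s (φ n) • ((η (φ n)) 0 - h⁻¹ 0)) atTop (𝓝 (q - (0 : ℝ) • h⁻¹ 0)) := by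
      have := (hq.comp hφ.tendsto_atTop).sub
        ((hs0.comp hφ.tendsto_atTop).smul (tendsto_const_nhds (x := (h⁻¹ 0 : LSpace))))
      refine this.congr fun n => ?_
      simp only [Function.comp_apply, smul_sub]
    rw [zero_smul, sub_zero] at h1
    refine ge_of_tendsto' ((tendsto_vol hyb hya h1).const_mul ε) fun n => ?_
    -- At the base point `h⁻¹ 0` the displacement of `η n * h` is `η n 0 - h⁻¹ 0`, so only the
    -- direction `q` remains after rescaling.
    have h2 := hnn _ (hg (φ n)) _ _ _ (hy n) (h⁻¹ 0)
    rw [affine_mul_apply, affine_apply_inv] at h2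
    rw [vol_smul_right, mul_left_comm]
    exact mul_nonneg (hs _).le h2
  rw [vol_smul_left, vol_smul_mid] at hlim
  have h3 : 0 < r * p := mul_pos hr hp
  have h4 : 0 ≤ (r * p) * (ε * vol xm xp q) := by linarith
  exact nonneg_of_mul_nonneg_right h4 h3

/-- The inverses diverge in the opposite direction `-q`, so the previous inequality holds for both
signs: `q` is orthogonal to the neutral direction of every conjugate of `h`, against irreducibility.
-/
lemma not_linear_tendsto_id (hlin : ∀ γ ∈ Γ, IsSO21o γ.linear) (hε : ε ≠ 0)
    (hnn : NonnegInvariants ε Γ) (hirr : Irred Γ)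
    {h : LSpace ≃ᵃ[ℝ] LSpace} (hh : h ∈ Γ) {l : ℝ} {xm xp : LSpace} (hyp : IsHyp h l xm xp)
    {η : ℕ → LSpace ≃ᵃ[ℝ] LSpace} (hη : ∀ n, η n ∈ Γ)
    (hid : ∀ x, Tendsto (fun n => (η n).linear x) atTop (𝓝 x))
    (hinf : Tendsto (fun n => ‖(η n) 0‖) atTop atTop) : False := by
  obtain ⟨N, hN⟩ := eventually_atTop.1 (hinf.eventually_gt_atTop 0)
  obtain ⟨q, hqm, φ, hφ, hq⟩ := (isCompact_sphere (0 : LSpace) 1).tendsto_subseq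
    (x := fun n => ‖(η (n + N)) 0‖⁻¹ • (η (n + N)) 0) (fun n => by
      have := hN (n + N) (by omega)
      rw [mem_sphere_zero_iff_norm, norm_smul, norm_inv, norm_norm, inv_mul_cancel₀ this.ne'])
  have hq0 : q ≠ 0 := by
    rintro rfl
    simp at hqm
  have hψ : Tendsto (fun n => φ n + N) atTop atTop :=
    (tendsto_add_atTop_nat N).comp hφ.tendsto_atTop
  set η' : ℕ → LSpace ≃ᵃ[ℝ] LSpace := fun n => η (φ n + N)
  set s : ℕ → ℝ := fun n => ‖η' n 0‖⁻¹
  have hs : ∀ n, 0 < s n := fun n => inv_pos.2 (hN _ (by omega))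
  have hs0 : Tendsto s atTop (𝓝 0) := tendsto_inv_atTop_zero.comp (hinf.comp hψ)
  have hid' : ∀ x, Tendsto (fun n => (η' n).linear x) atTop (𝓝 x) := fun x => (hid x).comp hψ
  have hη' : ∀ n, η' n ∈ Γ := fun n => hη _
  have hq' : Tendsto (fun n => s n • (η' n) 0) atTop (𝓝 q) := hq
  have hidi := tendsto_linear_inv (fun n => hlin _ (hη' n)) hid'
  have hqi : Tendsto (fun n => s n • ((η' n)⁻¹) 0) atTop (𝓝 (-q)) := by
    have h1 := tendsto_apply_of_pointwise (M := fun n => ((η' n)⁻¹).linear) (c := fun _ => 1)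
      (R := fun x => x) (fun x => by simpa only [one_smul] using hidi x) hq'.neg
    refine h1.congr fun n => ?_
    have h2 := affine_apply_sub (η' n)⁻¹ 0 ((η' n) 0)
    rw [affine_inv_apply, sub_zero, zero_sub] at h2
    rw [h2, one_smul, ← smul_neg, map_smul]
  have hzero : ∀ γ ∈ Γ, lorentz (γ.linear (lorentzCross xm xp)) q = 0 := by
    intro γ hγ
    have hc := hyp.conj γ (hlin _ hγ)
    have hcΓ : γ * h * γ⁻¹ ∈ Γ := Γ.mul_mem (Γ.mul_mem hγ hh) (Γ.inv_mem hγ)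
    have h1 := nonneg_of_linear_tendsto_id hlin hnn hη' hid' hs hs0 hq' hcΓ hc
    have h2 := nonneg_of_linear_tendsto_id hlin hnn (fun n => Γ.inv_mem (hη' n)) hidi hs hs0 hqi
      hcΓ hc
    rw [vol_neg_right] at h2
    rw [(hlin _ hγ).cross, lorentz_cross_eq_vol]
    have h3 : ε * vol (γ.linear xm) (γ.linear xp) q = 0 := by linarith
    exact (mul_eq_zero.1 h3).resolve_left hε
  have hx0 : lorentzCross xm xp ≠ 0 := by
    intro h0
    have h1 := lorentz_cross_cross xm xp xm xp
    rw [h0, lorentz_zero_left, hyp.null_m.1, lorentz_comm xp xm] at h1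
    have := hyp.neg (hlin _ hh)
    nlinarith
  obtain ⟨γ, hγ, hne⟩ := hirr.exists_lorentz_ne hlin hx0 hq0
  exact hne (hzero γ hγ)

lemma frequently_eq_of_finite {ι α : Type*} {F : Filter ι} {S : Set α} (hS : S.Finite) {f : ι → α}
    (h : ∃ᶠ i in F, f i ∈ S) : ∃ a ∈ S, ∃ᶠ i in F, f i = a := by
  by_contra hcon
  push Not at hcon
  have h1 : ∀ a ∈ S, ∀ᶠ i in F, f i ≠ a := fun a ha => by
    simpa [Filter.not_frequently] using hcon a ha
  have h2 : ∀ᶠ i in F, ∀ a ∈ S, f i ≠ a := (eventually_all_finite hS).2 h1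
  exact h (h2.mono fun i hi hiS => hi _ hiS rfl)

/-- Discreteness and faithfulness of the linear holonomy. -/
structure IsDiscrete (Γ : Subgroup (LSpace ≃ᵃ[ℝ] LSpace)) : Prop where
  finite : ∀ R : ℝ, {γ | γ ∈ Γ ∧ γ.linear origin 2 ≤ R}.Finite
  eq_one : ∀ γ ∈ Γ, (∀ v, γ.linear v = v) → γ = 1

/-- Nontrivial elements with trivial linear part are excluded by applying `not_linear_tendsto_id` to
their powers. Infinitely many linear parts in a compact set would produce `η n ≠ 1` with linear
parts tending to the identity; either these diverge affinely, or properness makes one value recur,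
and that value has trivial linear part. -/
lemma isDiscrete (hprop : IsProper Γ) (hlin : ∀ γ ∈ Γ, IsSO21o γ.linear) (hε : ε ≠ 0)
    (hnn : NonnegInvariants ε Γ) (hirr : Irred Γ)
    {h : LSpace ≃ᵃ[ℝ] LSpace} (hh : h ∈ Γ) {l : ℝ} {xm xp : LSpace} (hyp : IsHyp h l xm xp) :
    IsDiscrete Γ := by
  have hker : ∀ γ ∈ Γ, (∀ v, γ.linear v = v) → γ = 1 := by
    intro γ hγ hid
    by_contra hne
    have hb : γ 0 ≠ 0 := by
      intro hb
      refine hne ?_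
      ext1 x
      rw [apply_eq_add_of_linear_eq hid, hb, add_zero]
      rfl
    have hpow : ∀ n : ℕ, (γ ^ n) 0 = (n : ℝ) • γ 0 := by
      intro n
      induction n with
      | zero => simp
      | succ n ih =>
        rw [pow_succ', affine_mul_apply, ih, apply_eq_add_of_linear_eq hid]
        push_cast
        rw [add_smul, one_smul]
    have hpl : ∀ (n : ℕ) v, (γ ^ n).linear v = v := by
      intro n v
      induction n with
      | zero => rfl
      | succ n ih => rw [pow_succ', linear_mul, ih, hid]
    refine not_linear_tendsto_id hlin hε hnn hirr hh hyp (η := fun n => γ ^ n)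
      (fun n => Γ.pow_mem hγ n) (fun x => ?_) ?_
    · simp only [hpl]; exact tendsto_const_nhds
    · simp only [hpow, norm_smul]
      refine Tendsto.atTop_mul_const (norm_pos_iff.2 hb) ?_
      simpa using tendsto_natCast_atTop_atTop (R := ℝ)
  refine ⟨fun R => ?_, hker⟩
  by_contra hinf
  let γ : ℕ → LSpace ≃ᵃ[ℝ] LSpace := fun n => (Set.Infinite.natEmbedding _ hinf n).1
  have hγinj : Function.Injective γ :=
    Subtype.val_injective.comp (Set.Infinite.natEmbedding _ hinf).injective
  have hγ : ∀ n, γ n ∈ Γ := fun n => (Set.Infinite.natEmbedding _ hinf n).2.1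
  have hγR : ∀ n, (γ n).linear origin 2 ≤ R := fun n => (Set.Infinite.natEmbedding _ hinf n).2.2
  have hR1 : ∀ n, |(γ n).linear origin 2| ≤ R := fun n => by
    rw [abs_of_pos ((hlin _ (hγ n)).2.2 _ origin_future).2]; exact hγR n
  have hR0 : 0 ≤ R := (abs_nonneg _).trans (hR1 0)
  have hinvo : ∀ n, ‖((γ n)⁻¹).linear origin‖ ≤ R := by
    intro n
    have hSi := hlin _ (Γ.inv_mem (hγ n))
    refine (norm_le_of_causal (hSi.2.2 _ origin_future).1.le).trans ?_
    have : ((γ n)⁻¹).linear origin 2 = (γ n).linear origin 2 := by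
      have := (hlin _ (hγ n)).inner_symm_left origin origin
      rw [← linear_inv, lorentz_origin, origin_lorentz] at this
      linarith
    rw [this]
    exact hR1 n
  -- The last coordinate of `γ n x` is a pairing of `x` with the bounded vector `(γ n)⁻¹ origin`;
  -- the other two are then bounded by preservation of the form.
  have hbd : ∀ (n : ℕ) (x : LSpace), lorentz x x ≤ 1 → ‖x‖ ≤ 1 → ‖(γ n).linear x‖ ≤ 1 + 3 * R := by
    intro n x hx hx1
    set y := (γ n).linear x with hy
    have h2 : |y 2| ≤ 3 * R := by
      have e : y 2 = -lorentz x (((γ n)⁻¹).linear origin) := by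
        rw [linear_inv, (hlin _ (hγ n)).inner_symm_right, lorentz_origin, neg_neg]
      set w := ((γ n)⁻¹).linear origin
      have hw : ∀ i, |w i| ≤ R := fun i => (norm_le_pi_norm w i).trans (hinvo n)
      have hxi : ∀ i, |x i| ≤ 1 := fun i => (norm_le_pi_norm x i).trans hx1
      have hp : ∀ i, |x i * w i| ≤ R := fun i => by
        rw [abs_mul]
        nlinarith [hw i, hxi i, abs_nonneg (x i), abs_nonneg (w i)]
      rw [e, abs_neg, lorentz]
      refine (abs_sub _ _).trans ?_
      linarith [abs_add_le (x 0 * w 0) (x 1 * w 1), hp 0, hp 1, hp 2]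
    have hyy : lorentz y y ≤ 1 := by rw [hy, (hlin _ (hγ n)).inner]; exact hx
    have hy2 : y 2 ^ 2 ≤ (3 * R) ^ 2 := by rw [← sq_abs]; gcongr
    rw [pi_norm_le_iff_of_nonneg (by linarith)]
    intro i
    rw [Real.norm_eq_abs]
    refine abs_le_of_sq_le_sq ?_ (by linarith)
    simp only [lorentz] at hyy
    fin_cases i <;> simp only [Fin.zero_eta, Fin.mk_one, Fin.reduceFinMk] <;>
      nlinarith [sq_nonneg (y 0), sq_nonneg (y 1), sq_nonneg (y 2)]
  have hcomp : IsCompact (Metric.closedBall (0 : LSpace) (1 + 3 * R) ×ˢ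
      (Metric.closedBall (0 : LSpace) (1 + 3 * R) ×ˢ Metric.closedBall (0 : LSpace) (1 + 3 * R))) :=
    (isCompact_closedBall _ _).prod ((isCompact_closedBall _ _).prod (isCompact_closedBall _ _))
  obtain ⟨⟨a0, a1, a2⟩, -, φ, hφ, hlim⟩ := hcomp.tendsto_subseq
    (x := fun n => ((γ n).linear ![1, 0, 0], (γ n).linear ![0, 1, 0], (γ n).linear ![0, 0, 1]))
    (fun n => by
      refine ⟨?_, ?_, ?_⟩ <;> rw [mem_closedBall_zero_iff] <;> refine hbd n _ ?_ ?_
      all_goals solve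
        | simp [lorentz]
        | (rw [pi_norm_le_iff_of_nonneg zero_le_one]; intro i; fin_cases i <;> simp))
  have l0 : Tendsto (fun n => (γ (φ n)).linear ![1, 0, 0]) atTop (𝓝 a0) :=
    (continuous_fst.tendsto _).comp hlim
  have l1 : Tendsto (fun n => (γ (φ n)).linear ![0, 1, 0]) atTop (𝓝 a1) :=
    (continuous_fst.tendsto _).comp ((continuous_snd.tendsto _).comp hlim)
  have l2 : Tendsto (fun n => (γ (φ n)).linear ![0, 0, 1]) atTop (𝓝 a2) :=
    (continuous_snd.tendsto _).comp ((continuous_snd.tendsto _).comp hlim)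
  let A : LSpace → LSpace := fun x => x 0 • a0 + x 1 • a1 + x 2 • a2
  have hA : ∀ x, Tendsto (fun n => (γ (φ n)).linear x) atTop (𝓝 (A x)) := by
    intro x
    refine (((l0.const_smul (x 0)).add (l1.const_smul (x 1))).add (l2.const_smul (x 2))).congr
      fun n => ?_
    conv_rhs => rw [coord_decomp x]
    simp only [map_add, map_smul]
  have hAB : ∀ x y, lorentz (A x) (A y) = lorentz x y := by
    intro x y
    refine tendsto_nhds_unique (tendsto_lorentz (hA x) (hA y)) ?_
    simp only [(hlin _ (hγ _)).inner]
    exact tendsto_const_nhds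
  -- Quotients of consecutive terms tend to the identity without knowing that the limit `A` is
  -- invertible: preservation of the form by `A` is enough.
  let η : ℕ → LSpace ≃ᵃ[ℝ] LSpace := fun n => (γ (φ n))⁻¹ * γ (φ (n + 1))
  have hη : ∀ n, η n ∈ Γ := fun n => Γ.mul_mem (Γ.inv_mem (hγ _)) (hγ _)
  have hη1 : ∀ n, η n ≠ 1 := by
    intro n h1
    have := inv_mul_eq_one.1 h1
    have := hφ.injective (hγinj this)
    omega
  have hid : ∀ x, Tendsto (fun n => (η n).linear x) atTop (𝓝 x) := by
    intro x
    refine tendsto_of_lorentz fun y => ?_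
    have h1 := tendsto_lorentz ((hA x).comp (tendsto_add_atTop_nat 1)) (hA y)
    rw [hAB] at h1
    refine h1.congr fun n => ?_
    simp only [η, Function.comp_apply, linear_mul, linear_inv]
    rw [(hlin _ (hγ _)).inner_symm_left]
  by_cases htop : Tendsto (fun n => ‖(η n) 0‖) atTop atTop
  · exact not_linear_tendsto_id hlin hε hnn hirr hh hyp hη hid htop
  · rw [tendsto_atTop] at htop
    push Not at htop
    obtain ⟨b, hb⟩ := htop
    have hfin := hprop (Metric.closedBall 0 |b|) (isCompact_closedBall _ _)
    obtain ⟨η0, -, hfreq⟩ := frequently_eq_of_finite hfin (f := η) (hb.mono fun n hn => by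
      refine ⟨hη n, η n 0, ⟨0, ?_, rfl⟩, ?_⟩
      · simp
      · rw [mem_closedBall_zero_iff]; exact hn.le.trans (le_abs_self _))
    have hη0 : ∀ v, η0.linear v = v := by
      intro v
      have := (isClosed_singleton (x := η0.linear v)).mem_of_frequently_of_tendsto
        (hfreq.mono fun n hn => by rw [← hn]; rfl) (hid v)
      exact (Set.mem_singleton_iff.1 this).symm
    obtain ⟨n, hn⟩ := hfreq.exists
    exact hη1 n (hn ▸ hker _ (hn ▸ hη n) hη0)

end

/-! ### Rank one limits of sequences in the group -/

/-- The linear parts of `γ n`, rescaled by `c n → 0`, converge to the rank one map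
`x ↦ -⟨x, r⟩ a` with null vectors `a`, `r`; likewise for the inverses. -/
structure RankOne (γ : ℕ → LSpace ≃ᵃ[ℝ] LSpace) (c : ℕ → ℝ) (a r : LSpace) : Prop where
  pos : ∀ n, 0 < c n
  zero : Tendsto c atTop (𝓝 0)
  null_a : FutureNull a
  null_r : FutureNull r
  fwd : ∀ x, Tendsto (fun n => c n • (γ n).linear x) atTop (𝓝 (-lorentz x r • a))
  bwd : ∀ x, Tendsto (fun n => c n • ((γ n)⁻¹).linear x) atTop (𝓝 (-lorentz x a • r))

lemma tendsto_zero_of_sq_le {ι : Type*} {F : Filter ι} {u v : ι → ℝ}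
    (h : ∀ i, u i ^ 2 ≤ v i) (hv : Tendsto v F (𝓝 0)) : Tendsto u F (𝓝 0) := by
  have h1 : Tendsto (fun i => u i ^ 2) F (𝓝 0) :=
    squeeze_zero (fun i => sq_nonneg _) h hv
  have h2 := h1.sqrt
  simp only [Real.sqrt_sq_eq_abs, Real.sqrt_zero] at h2
  exact (tendsto_zero_iff_abs_tendsto_zero _).2 h2

/-- Subtracting from `y n` the multiple of `w n` with the same last coordinate leaves a vector with
last coordinate `0`, on which the form is Euclidean, and its form value tends to `0`. Hence `y n` is
asymptotic to that multiple, whose coefficient tends to `-⟨x, r⟩`. -/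
lemma tendsto_rank_one {γ : ℕ → LSpace ≃ᵃ[ℝ] LSpace} (hγ : ∀ n, IsSO21o (γ n).linear)
    {c : ℕ → ℝ} (hc : Tendsto c atTop (𝓝 0)) {a r : LSpace}
    (h1 : ∀ n, c n * (γ n).linear origin 2 = 1)
    (ha : Tendsto (fun n => c n • (γ n).linear origin) atTop (𝓝 a))
    (hr : Tendsto (fun n => c n • ((γ n)⁻¹).linear origin) atTop (𝓝 r)) (x : LSpace) :
    Tendsto (fun n => c n • (γ n).linear x) atTop (𝓝 (-lorentz x r • a)) := by
  set y : ℕ → LSpace := fun n => c n • (γ n).linear x with hy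
  set w : ℕ → LSpace := fun n => c n • (γ n).linear origin with hw
  have hy2 : Tendsto (fun n => y n 2) atTop (𝓝 (-lorentz x r)) := by
    refine (tendsto_lorentz tendsto_const_nhds hr).neg.congr fun n => ?_
    rw [lorentz_smul_right, linear_inv, (hγ n).inner_symm_right, lorentz_origin]
    simp [hy]
  have hc2 : Tendsto (fun n => c n ^ 2) atTop (𝓝 0) := by
    simpa using hc.pow 2
  have hzz : Tendsto (fun n => lorentz (y n - y n 2 • w n) (y n - y n 2 • w n)) atTop (𝓝 0) := by
    have : Tendsto (fun n => c n ^ 2 * lorentz x x - 2 * y n 2 * (c n ^ 2 * lorentz x origin) +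
        y n 2 ^ 2 * (c n ^ 2 * lorentz origin origin)) atTop
        (𝓝 (0 * lorentz x x - 2 * (-lorentz x r) * (0 * lorentz x origin) +
          (-lorentz x r) ^ 2 * (0 * lorentz origin origin))) :=
      ((hc2.mul_const _).sub ((hy2.const_mul 2).mul (hc2.mul_const _))).add
        ((hy2.pow 2).mul (hc2.mul_const _))
    simp only [zero_mul, mul_zero, sub_zero, add_zero] at this
    refine this.congr fun n => ?_
    simp only [lorentz_sub_left, lorentz_sub_right, lorentz_smul_left, lorentz_smul_right, hy, hw,
      (hγ n).inner, lorentz_comm origin x]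
    ring
  have hz2 : ∀ n, (y n - y n 2 • w n) 2 = 0 := fun n => by
    have : w n 2 = 1 := h1 n
    simp [this]
  have hz : Tendsto (fun n => y n - y n 2 • w n) atTop (𝓝 0) := by
    have e : ∀ n, lorentz (y n - y n 2 • w n) (y n - y n 2 • w n) =
        (y n - y n 2 • w n) 0 ^ 2 + (y n - y n 2 • w n) 1 ^ 2 := fun n => by
      rw [lorentz, hz2]; ring
    rw [tendsto_pi_nhds]
    intro i
    refine tendsto_zero_of_sq_le (fun n => ?_) hzz
    rw [e]
    have k0 := sq_nonneg ((y n - y n 2 • w n) 0)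
    have k1 := sq_nonneg ((y n - y n 2 • w n) 1)
    fin_cases i
    · exact le_add_of_nonneg_right k1
    · exact le_add_of_nonneg_left k0
    · change (y n - y n 2 • w n) 2 ^ 2 ≤ _
      rw [hz2, zero_pow two_ne_zero]; exact add_nonneg k0 k1
  have := hz.add (hy2.smul ha)
  rw [zero_add] at this
  refine this.congr fun n => ?_
  simp only [hw, sub_add_cancel]

section
variable {Γ : Subgroup (LSpace ≃ᵃ[ℝ] LSpace)} {ε : ℝ}

/-- The scale is the inverse of the last coordinate of `γ n origin`, which is also that of `(γ n)⁻¹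
origin`. The limits are null because the form value `-1` is multiplied by `c n ^ 2 → 0`. -/
lemma exists_rankOne (hlin : ∀ γ ∈ Γ, IsSO21o γ.linear) {γ : ℕ → LSpace ≃ᵃ[ℝ] LSpace}
    (hγ : ∀ n, γ n ∈ Γ) (hinf : Tendsto (fun n => (γ n).linear origin 2) atTop atTop) :
    ∃ φ : ℕ → ℕ, StrictMono φ ∧ ∃ (c : ℕ → ℝ) (a r : LSpace), RankOne (γ ∘ φ) c a r ∧
      (∀ n, c n * (γ (φ n)).linear origin 2 = 1) := by
  have hw := fun n => (hlin _ (hγ n)).2.2 _ origin_future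
  have hwi := fun n => (hlin _ (Γ.inv_mem (hγ n))).2.2 _ origin_future
  have heq : ∀ n, ((γ n)⁻¹).linear origin 2 = (γ n).linear origin 2 := fun n => by
    have := (hlin _ (hγ n)).inner_symm_left origin origin
    rw [← linear_inv, lorentz_origin, origin_lorentz] at this
    linarith
  let c : ℕ → ℝ := fun n => ((γ n).linear origin 2)⁻¹
  have hc : ∀ n, 0 < c n := fun n => inv_pos.2 (hw n).2
  have hc1 : ∀ n, c n * (γ n).linear origin 2 = 1 := fun n => inv_mul_cancel₀ (hw n).2.ne'
  have hc2 : ∀ n, c n * ((γ n)⁻¹).linear origin 2 = 1 := fun n => by rw [heq]; exact hc1 n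
  have hc0 : Tendsto c atTop (𝓝 0) := tendsto_inv_atTop_zero.comp hinf
  have bd : ∀ (n : ℕ) (w : LSpace), FutureTimelike w → c n * w 2 = 1 →
      c n • w ∈ Metric.closedBall (0 : LSpace) 1 := by
    intro n w hw h1
    rw [mem_closedBall_zero_iff]
    refine (norm_le_of_causal ?_).trans ?_
    · rw [lorentz_smul_left, lorentz_smul_right]
      have := hw.1
      have := hc n
      nlinarith [mul_pos (hc n) (hc n)]
    · simp [h1]
  obtain ⟨⟨a, r⟩, -, φ, hφ, hlim⟩ := ((isCompact_closedBall (0 : LSpace) 1).prod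
    (isCompact_closedBall (0 : LSpace) 1)).tendsto_subseq
    (x := fun n => (c n • (γ n).linear origin, c n • ((γ n)⁻¹).linear origin))
    (fun n => ⟨bd n _ (hw n) (hc1 n), bd n _ (hwi n) (hc2 n)⟩)
  have ha : Tendsto (fun n => c (φ n) • (γ (φ n)).linear origin) atTop (𝓝 a) :=
    (continuous_fst.tendsto _).comp hlim
  have hr : Tendsto (fun n => c (φ n) • ((γ (φ n))⁻¹).linear origin) atTop (𝓝 r) :=
    (continuous_snd.tendsto _).comp hlim
  have hc0' := hc0.comp hφ.tendsto_atTop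
  have null : ∀ (δ : ℕ → LSpace ≃ᵃ[ℝ] LSpace) (b : LSpace), (∀ n, IsSO21o (δ n).linear) →
      (∀ n, c (φ n) * (δ n).linear origin 2 = 1) →
      Tendsto (fun n => c (φ n) • (δ n).linear origin) atTop (𝓝 b) → FutureNull b := by
    intro δ b hδ h1 hb
    refine ⟨tendsto_nhds_unique (tendsto_lorentz hb hb) ?_, ?_⟩
    · have : Tendsto (fun n => c (φ n) * (c (φ n) * lorentz origin origin)) atTop
          (𝓝 (0 * (0 * lorentz origin origin))) := hc0'.mul (hc0'.mul_const _)
      rw [zero_mul] at this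
      refine this.congr fun n => ?_
      rw [lorentz_smul_left, lorentz_smul_right, (hδ n).inner]
    · have : b 2 = 1 := by
        refine tendsto_nhds_unique (tendsto_coord hb 2) ?_
        simp only [Pi.smul_apply, smul_eq_mul, h1]
        exact tendsto_const_nhds
      rw [this]; exact one_pos
  refine ⟨φ, hφ, c ∘ φ, a, r, ⟨fun n => hc _, hc0', ?_, ?_, ?_, ?_⟩, fun n => hc1 _⟩
  · exact null (fun n => γ (φ n)) a (fun n => hlin _ (hγ _)) (fun n => hc1 _) ha
  · exact null (fun n => (γ (φ n))⁻¹) r (fun n => hlin _ (Γ.inv_mem (hγ _))) (fun n => hc2 _) hr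
  · exact tendsto_rank_one (γ := fun n => γ (φ n)) (fun n => hlin _ (hγ _)) hc0' (fun n => hc1 _)
      ha hr
  · exact tendsto_rank_one (γ := fun n => (γ (φ n))⁻¹) (fun n => hlin _ (Γ.inv_mem (hγ _))) hc0'
      (fun n => hc2 _) hr (by simp only [inv_inv]; exact ha)

namespace RankOne
variable {γ : ℕ → LSpace ≃ᵃ[ℝ] LSpace} {c : ℕ → ℝ} {a r : LSpace}

lemma inv (h : RankOne γ c a r) : RankOne (fun n => (γ n)⁻¹) c r a :=
  ⟨h.pos, h.zero, h.null_r, h.null_a, h.bwd, by simpa only [inv_inv] using h.fwd⟩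

lemma mul_left (h : RankOne γ c a r) {f : LSpace ≃ᵃ[ℝ] LSpace} (hf : IsSO21o f.linear) :
    RankOne (fun n => f * γ n) c (f.linear a) r := by
  refine ⟨h.pos, h.zero, hf.null h.null_a, h.null_r, fun x => ?_, fun x => ?_⟩
  · have hc : Continuous f.linear := f.linear.toLinearMap.continuous_of_finiteDimensional
    have := (hc.tendsto _).comp (h.fwd x)
    rw [map_smul] at this
    refine this.congr fun n => ?_
    rw [Function.comp_apply, map_smul, linear_mul]
  · have := h.bwd ((f⁻¹).linear x)
    rw [linear_inv, hf.inner_symm_left] at this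
    refine this.congr fun n => ?_
    rw [mul_inv_rev, linear_mul]
    rfl

lemma mul_right (h : RankOne γ c a r) {f : LSpace ≃ᵃ[ℝ] LSpace} (hf : IsSO21o f.linear) :
    RankOne (fun n => γ n * f⁻¹) c a (f.linear r) := by
  have := (h.inv.mul_left hf).inv
  simpa only [mul_inv_rev, inv_inv] using this

lemma tr_rank_one (a r : LSpace) : tr (fun x => -lorentz x r • a) = -lorentz a r := by
  simp [tr, lorentz]; ring

lemma eigen {a r v : LSpace} (ha : FutureNull a) (hv : FutureNull v) {κ : ℝ}
    (hκ : 0 < κ) (h : -lorentz v r • a = κ • v) : ∃ p : ℝ, 0 < p ∧ v = p • a := by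
  have hp : v = (-lorentz v r / κ) • a := by
    rw [div_eq_inv_mul, mul_smul, h, smul_smul, inv_mul_cancel₀ hκ.ne', one_smul]
  refine ⟨_, ?_, hp⟩
  have h2 := congrFun hp 2
  simp only [Pi.smul_apply, smul_eq_mul] at h2
  have := hv.2
  rw [h2] at this
  exact pos_of_mul_pos_left this ha.2.le

/-- Nonnegativity of all Margulis invariants constrains the directions of divergence. -/
lemma star (hlin : ∀ γ ∈ Γ, IsSO21o γ.linear) (hnn : NonnegInvariants ε Γ)
    (h : RankOne γ c a r) (hγ : ∀ n, γ n ∈ Γ) {s : ℕ → ℝ} (hs : ∀ n, 0 < s n)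
    (hs0 : Tendsto s atTop (𝓝 0)) {x q : LSpace}
    (hq : Tendsto (fun n => s n • (γ n) x) atTop (𝓝 q)) {f : LSpace ≃ᵃ[ℝ] LSpace} (hf : f ∈ Γ) :
    0 ≤ ε * vol (f.linear r) a q := by
  have hfr := (hlin _ hf).null h.null_r
  by_cases h0 : lorentz (f.linear r) a = 0
  · obtain ⟨p, -, rfl⟩ := hfr.exists_smul h.null_a h0
    rw [show vol (f.linear r) (p • f.linear r) q = 0 by
      simp only [vol, Pi.smul_apply, smul_eq_mul]; ring, mul_zero]
  have hneg := hfr.lorentz_neg h.null_a h0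
  have hR := h.mul_right (hlin _ hf)
  have hg : ∀ n, γ n * f⁻¹ ∈ Γ := fun n => Γ.mul_mem (hγ n) (Γ.inv_mem hf)
  obtain ⟨φ, hφ, l, xm, xp, κ, κ', v, w, hy, hv, hvn, hRv, hκ, hw, hwn, hRw, hκ'⟩ :=
    exists_subseq_hyp (fun n => hlin _ (hg n)) (fun n => hlin _ (Γ.inv_mem (hg n))) hR.pos hR.zero
      hR.fwd hR.bwd (by rw [tr_rank_one, lorentz_comm]; linarith) (by rw [tr_rank_one]; linarith)
  rw [tr_rank_one, lorentz_comm] at hκ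
  rw [tr_rank_one] at hκ'
  obtain ⟨p, hp, rfl⟩ := eigen h.null_a hvn (by linarith) hRv
  obtain ⟨p', hp', rfl⟩ := eigen hfr hwn (by linarith) hRw
  have hlim : 0 ≤ ε * vol (p' • f.linear r) (p • a) q := by
    have h1 : Tendsto (fun n => s (φ n) • ((γ (φ n)) x - f x)) atTop (𝓝 (q - (0 : ℝ) • f x)) := by
      refine ((hq.comp hφ.tendsto_atTop).sub ((hs0.comp hφ.tendsto_atTop).smul
        (tendsto_const_nhds (x := f x)))).congr fun n => ?_
      simp only [Function.comp_apply, smul_sub]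
    rw [zero_smul, sub_zero] at h1
    refine ge_of_tendsto' ((tendsto_vol hw hv h1).const_mul ε) fun n => ?_
    -- The base point `f x` turns the displacement of `γ n * f⁻¹` into `γ n x - f x`, whose rescaled
    -- limit is `q`.
    have h2 := hnn _ (hg (φ n)) _ _ _ (hy n) (f x)
    rw [affine_mul_apply, affine_inv_apply] at h2
    rw [vol_smul_right, mul_left_comm]
    exact mul_nonneg (hs _).le h2
  rw [vol_smul_left, vol_smul_mid] at hlim
  have h4 : 0 ≤ (p' * p) * (ε * vol (f.linear r) a q) := by linarith
  exact nonneg_of_mul_nonneg_right h4 (mul_pos hp' hp)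

end RankOne

lemma lorentz_smul_smul (p q : ℝ) (u v : LSpace) :
    lorentz (p • u) (q • v) = p * q * lorentz u v := by
  rw [lorentz_smul_left, lorentz_smul_right, mul_assoc]

/-- Any orbit of null directions contains two distinct ones that differ from a given one. -/
lemma Irred.exists_two (hirr : Irred Γ) (hlin : ∀ γ ∈ Γ, IsSO21o γ.linear) {r r0 : LSpace}
    (hr : FutureNull r) (hr0 : FutureNull r0) :
    ∃ f₁ ∈ Γ, ∃ f₂ ∈ Γ, lorentz (f₁.linear r) r0 ≠ 0 ∧ lorentz (f₂.linear r) r0 ≠ 0 ∧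
      lorentz (f₁.linear r) (f₂.linear r) ≠ 0 := by
  have hnull : ∀ f ∈ Γ, FutureNull (f.linear r) := fun f hf => (hlin _ hf).null hr
  have not_all : ∀ s : LSpace, FutureNull s → ∃ f ∈ Γ, lorentz (f.linear r) s ≠ 0 := by
    intro s hs
    by_contra hcon
    push Not at hcon
    have h1 := hcon 1 Γ.one_mem
    rw [linear_one] at h1
    obtain ⟨p, hp, rfl⟩ := hr.exists_smul hs h1
    obtain ⟨f, hf, hne⟩ := hirr r hr.ne_zero
    have h2 := hcon f hf
    rw [lorentz_smul_right] at h2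
    have h3 := (mul_eq_zero.1 h2).resolve_left hp.ne'
    rw [lorentz_comm] at h3
    obtain ⟨t, -, ht⟩ := hr.exists_smul (hnull f hf) h3
    exact hne t ht
  obtain ⟨f₁, hf₁, h1⟩ := not_all r0 hr0
  by_contra hcon
  push Not at hcon
  set s := f₁.linear r with hs
  have hsn := hnull f₁ hf₁
  -- If the claim fails, the orbit consists of the two directions `r0` and `s` only, both attained,
  -- so the line of `r0 × s` is invariant.
  have dich : ∀ f ∈ Γ, lorentz r0 (f.linear r) = 0 ∨ lorentz s (f.linear r) = 0 := by
    intro f hf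
    by_cases h : lorentz (f.linear r) r0 = 0
    · left; rw [lorentz_comm]; exact h
    · right; exact hcon f₁ hf₁ f hf h1 h
  obtain ⟨f₀, hf₀, h0⟩ := not_all s hsn
  have h0' : lorentz r0 (f₀.linear r) = 0 :=
    (dich f₀ hf₀).resolve_right (by rw [lorentz_comm]; exact h0)
  obtain ⟨p0, hp0, hf0⟩ := (hnull f₀ hf₀).exists_smul hr0 (by rw [lorentz_comm]; exact h0')
  have dich2 : ∀ g ∈ Γ, ∀ f ∈ Γ, ∃ t : ℝ, g.linear (f.linear r) = t • r0 ∨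
      g.linear (f.linear r) = t • s := by
    intro g hg f hf
    have hgf := Γ.mul_mem hg hf
    rcases dich _ hgf with h | h
    · obtain ⟨t, -, ht⟩ := hr0.exists_smul (hnull _ hgf) h
      exact ⟨t, Or.inl ht⟩
    · obtain ⟨t, -, ht⟩ := hsn.exists_smul (hnull _ hgf) h
      exact ⟨t, Or.inr ht⟩
  have hn0 : lorentzCross r0 s ≠ 0 := by
    intro h
    obtain ⟨t, ht⟩ := exists_smul_of_cross_eq_zero hr0.ne_zero h
    rw [ht, lorentz_smul_left, hr0.1, mul_zero] at h1
    exact h1 rfl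
  obtain ⟨g, hg, hne⟩ := hirr _ hn0
  have hgs : lorentz (g.linear r0) (g.linear s) ≠ 0 := by
    rw [(hlin _ hg).inner, lorentz_comm]; exact h1
  have hcross := (hlin _ hg).cross r0 s
  obtain ⟨t, ht⟩ := dich2 g hg f₀ hf₀
  obtain ⟨t', ht'⟩ := dich2 g hg f₁ hf₁
  rw [← hs] at ht'
  have hgr0 : g.linear r0 = p0 • g.linear (f₀.linear r) := by rw [← map_smul, ← hf0]
  rcases ht with ht | ht <;> rcases ht' with ht' | ht'
  · rw [hgr0, ht, ht', smul_smul, lorentz_smul_smul, hr0.1] at hgs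
    exact hgs (mul_zero _)
  · rw [hgr0, ht, ht', smul_smul, lorentzCross_smul_left, lorentzCross_smul_right,
      smul_smul] at hcross
    exact hne _ hcross
  · rw [hgr0, ht, ht', smul_smul, lorentzCross_smul_left, lorentzCross_smul_right,
      smul_smul, lorentzCross_swap s, smul_neg, ← neg_smul] at hcross
    exact hne _ hcross
  · rw [hgr0, ht, ht', smul_smul, lorentz_smul_smul, hsn.1] at hgs
    exact hgs (mul_zero _)

/-- Attracting directions lie in the closure of every orbit of null directions. -/
lemma RankOne.closure_orbit {γ : ℕ → LSpace ≃ᵃ[ℝ] LSpace} {c : ℕ → ℝ} {b r0 : LSpace}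
    (h : RankOne γ c b r0) (hγ : ∀ n, γ n ∈ Γ) (hirr : Irred Γ)
    (hlin : ∀ γ ∈ Γ, IsSO21o γ.linear) {r u : LSpace} (hr : FutureNull r)
    (hu : ∀ f ∈ Γ, 0 ≤ lorentz (f.linear r) u) : 0 ≤ lorentz b u := by
  obtain ⟨f, hf, -, -, hne, -⟩ := hirr.exists_two hlin hr h.null_r
  have hneg := ((hlin _ hf).null hr).lorentz_neg h.null_r hne
  have h1 := tendsto_lorentz (h.fwd (f.linear r)) (tendsto_const_nhds (x := u))
  have h2 : 0 ≤ lorentz (-lorentz (f.linear r) r0 • b) u := by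
    refine ge_of_tendsto' h1 fun n => ?_
    rw [lorentz_smul_left]
    exact mul_nonneg (h.pos n).le (hu _ (Γ.mul_mem (hγ n) hf))
  rw [lorentz_smul_left] at h2
  exact nonneg_of_mul_nonneg_right h2 (by linarith)

end

/-! ### Frames at a null vector -/

/-- A basis of two null vectors and a unit spacelike vector. -/
structure IsFrame (a e n : LSpace) : Prop where
  null_a : FutureNull a
  null_e : FutureNull e
  ae : lorentz a e = -1
  nn : lorentz n n = 1
  an : lorentz a n = 0
  en : lorentz e n = 0

lemma exists_frame {a n : LSpace} (ha : FutureNull a) (hnn : lorentz n n = 1)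
    (han : lorentz a n = 0) : ∃ e, IsFrame a e n := by
  have ha2 := ha.2.ne'
  -- The projection of the base point orthogonal to `n`, scaled to pair to `-1` with `a`; adding a
  -- multiple of `a` then makes it null without changing either pairing.
  set u : LSpace := (a 2)⁻¹ • (origin - lorentz origin n • n) with hu
  have hua : lorentz a u = -1 := by
    rw [hu, lorentz_smul_right, lorentz_sub_right, lorentz_smul_right, han, lorentz_origin]
    field_simp; ring
  have hun : lorentz u n = 0 := by
    rw [hu, lorentz_smul_left, lorentz_sub_left, lorentz_smul_left, hnn]; ring
  clear_value u
  set e := u + (lorentz u u / 2) • a with he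
  have hee : lorentz e e = 0 := by
    rw [he, lorentz_add_left, lorentz_add_right, lorentz_add_right, lorentz_smul_left,
      lorentz_smul_right, lorentz_smul_left, lorentz_smul_right, lorentz_comm u a, hua, ha.1]
    ring
  have hae : lorentz a e = -1 := by
    rw [he, lorentz_add_right, lorentz_smul_right, hua, ha.1]; ring
  refine ⟨e, ha, ⟨hee, ?_⟩, hae, hnn, han, ?_⟩
  · by_contra hneg
    push Not at hneg
    have := Margulis.lorentz_nonpos (u := a) (v := -e) ha.1.le ha.2.le
      (by rw [lorentz_neg_left, lorentz_neg_right, hee]; simp) (by simpa using hneg)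
    rw [lorentz_neg_right, hae] at this
    linarith
  · rw [he, lorentz_add_left, lorentz_smul_left, hun, han]; ring

namespace IsFrame
variable {a e n : LSpace}

lemma decomp (h : IsFrame a e n) (w : LSpace) :
    w = (-lorentz w e) • a + (-lorentz w a) • e + lorentz w n • n := by
  have key : ∀ w, w = lorentz w (lorentzCross a e) • lorentzCross a e + (-lorentz w e) • a +
      (-lorentz w a) • e := by
    intro w
    have := cross_frame a e w
    rw [lorentz_cross_cross, h.null_a.1, h.null_e.1, lorentz_comm e a, h.ae] at this
    simp only [mul_zero, zero_mul, sub_zero, zero_sub, mul_neg, neg_mul, mul_one, one_mul,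
      neg_neg, one_smul] at this
    exact this
  have hn := key n
  rw [lorentz_comm n e, lorentz_comm n a, h.en, h.an, neg_zero, zero_smul, zero_smul, add_zero,
    add_zero] at hn
  set k := lorentz n (lorentzCross a e)
  have hk : k * k = 1 := by
    have := h.nn
    rw [hn, lorentz_smul_left, lorentz_smul_right, lorentz_cross_cross, h.null_a.1, h.null_e.1,
      lorentz_comm e a, h.ae] at this
    linarith
  conv_lhs => rw [key w]
  have : lorentz w n • n = lorentz w (lorentzCross a e) • lorentzCross a e := by
    rw [hn, lorentz_smul_right, smul_smul]
    congr 1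
    linear_combination lorentz w (lorentzCross a e) * hk
  rw [this]
  abel

lemma inner_eq (h : IsFrame a e n) (w z : LSpace) :
    lorentz w z = lorentz w n * lorentz z n - lorentz w e * lorentz z a -
      lorentz w a * lorentz z e := by
  conv_lhs => rw [h.decomp w]
  rw [lorentz_add_left, lorentz_add_left, lorentz_smul_left, lorentz_smul_left, lorentz_smul_left,
    lorentz_comm a z, lorentz_comm e z, lorentz_comm n z]
  ring

lemma ext_of_frame (h : IsFrame a e n) {w z : LSpace} (h1 : lorentz w a = lorentz z a)
    (h2 : lorentz w e = lorentz z e) (h3 : lorentz w n = lorentz z n) : w = z := by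
  rw [h.decomp w, h.decomp z, h1, h2, h3]

end IsFrame

section
variable {Γ : Subgroup (LSpace ≃ᵃ[ℝ] LSpace)}

/-- If an orbit of null directions lies on one side of `n` then it accumulates at `a` from that
side. -/
lemma RankOne.exists_large {γ : ℕ → LSpace ≃ᵃ[ℝ] LSpace} {c : ℕ → ℝ} {a r0 : LSpace}
    (h : RankOne γ c a r0) (hγ : ∀ n, γ n ∈ Γ) (hirr : Irred Γ)
    (hlin : ∀ γ ∈ Γ, IsSO21o γ.linear) {r e n : LSpace} (hr : FutureNull r) (hF : IsFrame a e n)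
    (hn : ∀ f ∈ Γ, 0 ≤ lorentz (f.linear r) n) (x : ℝ) :
    ∃ f ∈ Γ, x * -lorentz (f.linear r) a < lorentz (f.linear r) n := by
  obtain ⟨f₁, hf₁, f₂, hf₂, h1, h2, h12⟩ := hirr.exists_two hlin hr h.null_r
  -- With `X = -⟨w, e⟩`, `Y = -⟨w, a⟩`, `Z = ⟨w, n⟩`, a null `w` has `Z ^ 2 = 2 * X * Y`. Near the
  -- direction of `a`, `Y` is negligible against `X`, so `Z ^ 2 > (x * Y) ^ 2`, and one-sidedness
  -- fixes the sign of `Z`.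
  have ev : ∀ f ∈ Γ, lorentz (f.linear r) r0 ≠ 0 → ∀ᶠ i in atTop,
      x ^ 2 * -lorentz ((γ i * f).linear r) a < 2 * -lorentz ((γ i * f).linear r) e := by
    intro f hf hne
    have hneg := ((hlin _ hf).null hr).lorentz_neg h.null_r hne
    have t := h.fwd (f.linear r)
    have ta := (tendsto_lorentz t (tendsto_const_nhds (x := a))).neg.const_mul (x ^ 2)
    have te := (tendsto_lorentz t (tendsto_const_nhds (x := e))).neg.const_mul 2
    rw [lorentz_smul_left, h.null_a.1] at ta
    rw [lorentz_smul_left, hF.ae] at te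
    filter_upwards [ta.eventually_lt te (by linarith)] with i hi
    rw [lorentz_smul_left, lorentz_smul_left] at hi
    have hc := h.pos i
    rw [linear_mul]
    refine lt_of_mul_lt_mul_left ?_ hc.le
    linarith
  obtain ⟨i, hi1, hi2⟩ := ((ev f₁ hf₁ h1).and (ev f₂ hf₂ h2)).exists
  have fin : ∀ f ∈ Γ, x ^ 2 * -lorentz ((γ i * f).linear r) a <
      2 * -lorentz ((γ i * f).linear r) e → lorentz ((γ i * f).linear r) a ≠ 0 →
      ∃ f ∈ Γ, x * -lorentz (f.linear r) a < lorentz (f.linear r) n := by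
    intro f hf hlt hne
    have hg := Γ.mul_mem (hγ i) hf
    have hnull := (hlin _ hg).null hr
    have hneg := hnull.lorentz_neg h.null_a hne
    refine ⟨_, hg, ?_⟩
    have h0 := hnull.1
    rw [hF.inner_eq] at h0
    have hnn := hn _ hg
    refine lt_of_pow_lt_pow_left₀ 2 hnn ?_
    nlinarith
  -- The argument needs a point that is not `a` itself; of two distinct directions, at most one is
  -- mapped onto that of `a`.
  by_cases ha1 : lorentz ((γ i * f₁).linear r) a = 0
  · refine fin f₂ hf₂ hi2 fun ha2 => h12 ?_
    have hg1 := (hlin _ (Γ.mul_mem (hγ i) hf₁)).null hr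
    have hg2 := (hlin _ (Γ.mul_mem (hγ i) hf₂)).null hr
    obtain ⟨p, hp, hp'⟩ := h.null_a.exists_smul hg1 (by rw [lorentz_comm]; exact ha1)
    obtain ⟨p', hp2, hp2'⟩ := h.null_a.exists_smul hg2 (by rw [lorentz_comm]; exact ha2)
    rw [← (hlin _ (hγ i)).inner, ← linear_mul, ← linear_mul, hp', hp2', lorentz_smul_smul,
      h.null_a.1, mul_zero]
  · exact fin f₁ hf₁ hi1 ha1

end

/-! ### Connectedness of the orbit at a bounded scale -/

/-- The orbit of the base point is connected by steps whose hyperbolic cosine of the length is at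
most `L`. -/
def StepBound (Γ : Subgroup (LSpace ≃ᵃ[ℝ] LSpace)) (L : ℝ) : Prop :=
  ∀ P : (LSpace ≃ᵃ[ℝ] LSpace) → Prop, P 1 →
    (∀ g ∈ Γ, ∀ g' ∈ Γ, P g → -lorentz (g.linear origin) (g'.linear origin) ≤ L → P g') →
    ∀ g ∈ Γ, P g

section
variable {Γ : Subgroup (LSpace ≃ᵃ[ℝ] LSpace)}

/-- This is where finite generation is used: appending a letter to a word moves the orbit point by
the displacement of a generator or its inverse, and `L` bounds all of these. -/
lemma exists_stepBound {d : ℕ} (hfree : Nonempty (FreeGroup (Fin d) ≃* Γ))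
    (hlin : ∀ γ ∈ Γ, IsSO21o γ.linear) : ∃ L : ℝ, 1 ≤ L ∧ StepBound Γ L := by
  obtain ⟨e⟩ := hfree
  have hpos : ∀ γ ∈ Γ, 0 < γ.linear origin 2 := fun γ hγ => ((hlin _ hγ).2.2 _ origin_future).2
  let s : Fin d → Bool → Γ := fun i b => e (FreeGroup.mk [(i, b)])
  let L : ℝ := 1 + ∑ i, ∑ b, (s i b).1.linear origin 2
  have hs : ∀ i b, (s i b).1.linear origin 2 ≤ L := fun i b => by
    have h1 : (s i b).1.linear origin 2 ≤ ∑ b, (s i b).1.linear origin 2 :=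
      Finset.single_le_sum (f := fun b => (s i b).1.linear origin 2)
        (fun b _ => (hpos _ (s i b).2).le) (Finset.mem_univ b)
    have h2 : ∑ b, (s i b).1.linear origin 2 ≤ ∑ i, ∑ b, (s i b).1.linear origin 2 :=
      Finset.single_le_sum (f := fun i => ∑ b, (s i b).1.linear origin 2)
        (fun i _ => Finset.sum_nonneg fun b _ => (hpos _ (s i b).2).le) (Finset.mem_univ i)
    linarith
  refine ⟨L, ?_, fun P h1 hstep g hg => ?_⟩
  · have : 0 ≤ ∑ i, ∑ b, (s i b).1.linear origin 2 :=
      Finset.sum_nonneg fun i _ => Finset.sum_nonneg fun b _ => (hpos _ (s i b).2).le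
    simp only [L]; linarith
  have key : ∀ w : List (Fin d × Bool), P (e (FreeGroup.mk w)).1 := by
    intro w
    induction w using List.reverseRecOn with
    | nil =>
      rw [← FreeGroup.one_eq_mk, map_one]; exact h1
    | append_singleton w x ih =>
      refine hstep _ (e (FreeGroup.mk w)).2 _ (e (FreeGroup.mk (w ++ [x]))).2 ih ?_
      rw [← FreeGroup.mul_mk, map_mul, Subgroup.coe_mul, linear_mul,
        (hlin _ (e (FreeGroup.mk w)).2).inner, origin_lorentz, neg_neg]
      exact hs x.1 x.2
  obtain ⟨x, hx⟩ := e.surjective ⟨g, hg⟩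
  have := key x.toWord
  rw [FreeGroup.mk_toWord, hx] at this
  exact this

end

/-! ### Hyperbolic geometry in a frame -/

/-- For points of the hyperbolic plane this is `cosh (a + b) ≤ 2 cosh a cosh b` combined with the
triangle inequality through `u`. -/
lemma two_le_of_step {u v : LSpace} (hu : lorentz u u = -1)
    (hv : lorentz v v = -1) (hv2 : 0 < v 2) : v 2 ≤ 2 * u 2 * -lorentz u v := by
  have hb : 1 ≤ u 2 ^ 2 := by simp only [lorentz] at hu; nlinarith [sq_nonneg (u 0), sq_nonneg (u 1)]
  have h1 : (u 0 * v 0 + u 1 * v 1) ^ 2 ≤ (u 0 ^ 2 + u 1 ^ 2) * (v 0 ^ 2 + v 1 ^ 2) := by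
    nlinarith [sq_nonneg (u 0 * v 1 - u 1 * v 0)]
  simp only [lorentz] at hu hv ⊢
  rw [show u 0 ^ 2 + u 1 ^ 2 = u 2 ^ 2 - 1 by linarith,
    show v 0 ^ 2 + v 1 ^ 2 = v 2 ^ 2 - 1 by linarith] at h1
  set p := u 0 * v 0 + u 1 * v 1
  have h2 : v 2 * v 2 ≤ v 2 * (2 * u 2 * -(p - u 2 * v 2)) := by
    nlinarith [sq_nonneg (p - u 2 * v 2)]
  exact le_of_mul_le_mul_left h2 hv2

namespace IsFrame
variable {a e n : LSpace}

/-- The distance formula of the upper half-plane with `a` at infinity: `1 / -⟨u, a⟩` is the height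
and `⟨u, n⟩ / -⟨u, a⟩` the horizontal coordinate. -/
lemma inner_identity (h : IsFrame a e n) {u v : LSpace} (hu : lorentz u u = -1)
    (hv : lorentz v v = -1) :
    2 * -lorentz u a * -lorentz v a * -lorentz u v = lorentz u a ^ 2 + lorentz v a ^ 2 +
      (lorentz u n * -lorentz v a - lorentz v n * -lorentz u a) ^ 2 := by
  rw [h.inner_eq] at hu hv
  rw [h.inner_eq u v]
  linear_combination (-lorentz v a ^ 2) * hu - lorentz u a ^ 2 * hv

end IsFrame

/-- `h` is visible from the null direction `a`: only orbit points close to that of `h` are close to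
the geodesic ray from the orbit point of `h` to `a`. -/
def IsVisible (Γ : Subgroup (LSpace ≃ᵃ[ℝ] LSpace)) (L : ℝ) (a : LSpace)
    (h : LSpace ≃ᵃ[ℝ] LSpace) : Prop :=
  ∀ k ∈ Γ, ∀ t : ℝ, 0 ≤ t →
    (-lorentz (k.linear origin) (h.linear origin) + t * -lorentz (k.linear origin) a) ^ 2 ≤
      L ^ 2 * (1 + 2 * t * -lorentz (h.linear origin) a) →
    -lorentz (k.linear origin) (h.linear origin) ≤ 4 * L ^ 2

section
variable {Γ : Subgroup (LSpace ≃ᵃ[ℝ] LSpace)} {a e n : LSpace} {L : ℝ}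

lemma orbit_self (hlin : ∀ γ ∈ Γ, IsSO21o γ.linear) {g : LSpace ≃ᵃ[ℝ] LSpace} (hg : g ∈ Γ) :
    lorentz (g.linear origin) (g.linear origin) = -1 := by
  rw [(hlin _ hg).inner, lorentz_origin_origin]

lemma orbit_pos (hlin : ∀ γ ∈ Γ, IsSO21o γ.linear) {g : LSpace ≃ᵃ[ℝ] LSpace} (hg : g ∈ Γ) :
    0 < g.linear origin 2 := ((hlin _ hg).2.2 _ origin_future).2

lemma orbit_null (hlin : ∀ γ ∈ Γ, IsSO21o γ.linear) {g : LSpace ≃ᵃ[ℝ] LSpace} (hg : g ∈ Γ)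
    (ha : FutureNull a) : 0 < -lorentz (g.linear origin) a := by
  have := ((hlin _ hg).2.2 _ origin_future).lorentz_null_neg ha
  linarith

/-- Among the orbit points in a neighbourhood of the vertical geodesic over `x`, take a highest one.
Orbit points near the ray going up from it that were much higher would contradict the choice. -/
lemma exists_visible (hlin : ∀ γ ∈ Γ, IsSO21o γ.linear) (hF : IsFrame a e n) (hL : 1 ≤ L)
    (hfin : ∀ C : ℝ, {k | k ∈ Γ ∧ |lorentz (k.linear origin) n| ≤ C}.Finite) {x : ℝ}
    {k₀ : LSpace ≃ᵃ[ℝ] LSpace} (hk₀ : k₀ ∈ Γ)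
    (hx : |lorentz (k₀.linear origin) n - x * -lorentz (k₀.linear origin) a| ≤ 4 * L) :
    ∃ h ∈ Γ, |lorentz (h.linear origin) n - x * -lorentz (h.linear origin) a| ≤ 4 * L ∧
      IsVisible Γ L a h := by
  set Y : (LSpace ≃ᵃ[ℝ] LSpace) → ℝ := fun k => -lorentz (k.linear origin) a with hY
  set Z : (LSpace ≃ᵃ[ℝ] LSpace) → ℝ := fun k => lorentz (k.linear origin) n with hZ
  have hYpos : ∀ k ∈ Γ, 0 < Y k := fun k hk => orbit_null hlin hk hF.null_a
  let E : Set (LSpace ≃ᵃ[ℝ] LSpace) := {k | k ∈ Γ ∧ |Z k - x * Y k| ≤ 4 * L ∧ Y k ≤ Y k₀}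
  -- At bounded `Y`, the neighbourhood of the vertical geodesic over `x` is within bounded distance
  -- of the one over `0`, where `hfin` applies.
  have hE : E.Finite := by
    refine (hfin (4 * L + |x| * Y k₀)).subset ?_
    rintro k ⟨hk, h1, h2⟩
    refine ⟨hk, ?_⟩
    have h3 : |Z k| ≤ |Z k - x * Y k| + |x * Y k| := by
      have := abs_add_le (Z k - x * Y k) (x * Y k)
      rwa [sub_add_cancel] at this
    rw [abs_mul, abs_of_pos (hYpos k hk)] at h3
    have := mul_le_mul_of_nonneg_left h2 (abs_nonneg x)
    exact h3.trans (by linarith)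
  obtain ⟨h, ⟨hh, hhx, hh0⟩, hmin⟩ := Set.exists_min_image E Y hE ⟨k₀, hk₀, hx, le_rfl⟩
  have hmin' : ∀ k ∈ Γ, |Z k - x * Y k| ≤ 4 * L → Y h ≤ Y k := by
    intro k hk hkx
    by_cases hle : Y k ≤ Y k₀
    · exact hmin k ⟨hk, hkx, hle⟩
    · exact hh0.trans (not_le.1 hle).le
  refine ⟨h, hh, hhx, fun k hk t ht hclose => ?_⟩
  have hYh := hYpos h hh
  have hYk := hYpos k hk
  set s := √(1 + 2 * t * Y h) with hs
  have harg : 0 < 1 + 2 * t * Y h := by positivity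
  have hs2 : s ^ 2 = 1 + 2 * t * Y h := Real.sq_sqrt harg.le
  have hspos : 0 < s := Real.sqrt_pos.2 harg
  set β := -lorentz (k.linear origin) (h.linear origin) with hβ
  have hβ0 : 0 ≤ β := by
    have := Margulis.lorentz_nonpos (u := k.linear origin) (v := h.linear origin)
      (by rw [orbit_self hlin hk]; simp) (orbit_pos hlin hk).le
      (by rw [orbit_self hlin hh]; simp) (orbit_pos hlin hh).le
    linarith
  change (β + t * Y k) ^ 2 ≤ L ^ 2 * (1 + 2 * t * Y h) at hclose
  have hL0 : 0 ≤ L := by linarith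
  have hβs : β + t * Y k ≤ L * s := by
    refine (le_abs_self _).trans (abs_le_of_sq_le_sq ?_ (by positivity))
    rw [mul_pow, hs2]; exact hclose
  -- the point of the ray, normalized
  set p : LSpace := s⁻¹ • (h.linear origin + t • a) with hp
  have hpp : lorentz p p = -1 := by
    rw [hp, lorentz_smul_smul, lorentz_add_left, lorentz_add_right, lorentz_add_right,
      lorentz_smul_smul, lorentz_smul_left, lorentz_smul_right, hF.null_a.1, orbit_self hlin hh,
      lorentz_comm a]
    have : lorentz (h.linear origin) a = -Y h := by simp [hY]
    rw [this]
    field_simp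
    rw [hs2]; ring
  have hpa : -lorentz p a = Y h / s := by
    rw [hp, lorentz_smul_left, lorentz_add_left, lorentz_smul_left, hF.null_a.1]
    simp only [hY]; field_simp; ring
  have hpn : lorentz p n = Z h / s := by
    rw [hp, lorentz_smul_left, lorentz_add_left, lorentz_smul_left, hF.an]
    simp only [hZ]; field_simp; ring
  have hkp : -lorentz (k.linear origin) p = (β + t * Y k) / s := by
    rw [hp, lorentz_smul_right, lorentz_add_right, lorentz_smul_right]
    simp only [hY, hβ]; field_simp; ring
  have hid := hF.inner_identity (orbit_self hlin hk) hpp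
  rw [hkp, hpa, hpn, show lorentz p a = -(Y h / s) by linarith,
    show lorentz (k.linear origin) a = -Y k by simp [hY],
    show lorentz (k.linear origin) n = Z k from rfl, neg_neg] at hid
  set Yp := Y h / s with hYp
  have hYp0 : 0 < Yp := by positivity
  have hb : (β + t * Y k) / s ≤ L := by rw [div_le_iff₀ hspos]; exact hβs
  have hmain : Y k ^ 2 + Yp ^ 2 + (Z k * Yp - Z h / s * Y k) ^ 2 ≤ 2 * Y k * Yp * L := by
    have := mul_le_mul_of_nonneg_left hb (by positivity : 0 ≤ 2 * Y k * Yp)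
    linarith
  have hk1 : Y k ≤ 2 * L * Yp := by
    have : Y k * Y k ≤ Y k * (2 * L * Yp) := by
      nlinarith [sq_nonneg (Z k * Yp - Z h / s * Y k), sq_nonneg Yp]
    exact le_of_mul_le_mul_left this hYk
  have hdiff : |Z k - Z h / Y h * Y k| ≤ 2 * L := by
    have h1 : (Z k * Yp - Z h / s * Y k) ^ 2 ≤ (2 * L * Yp) ^ 2 := by
      have : Y k * (Yp * L) ≤ 2 * L * Yp * (Yp * L) :=
        mul_le_mul_of_nonneg_right hk1 (by positivity)
      nlinarith [sq_nonneg (Y k), sq_nonneg Yp]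
    have h2 : Z k * Yp - Z h / s * Y k = (Z k - Z h / Y h * Y k) * Yp := by
      rw [hYp]; field_simp
    rw [h2, mul_pow, mul_pow _ Yp] at h1
    have h3 := le_of_mul_le_mul_right h1 (by positivity)
    exact abs_le_of_sq_le_sq h3 (by positivity)
  -- The width `4 * L` reproduces itself: a point at most half as large in `Y` has deviation at most
  -- `2 * L + (4 * L) / 2`, hence lies in the neighbourhood and contradicts minimality.
  have hk2 : Y h / 2 < Y k := by
    by_contra hcon
    push Not at hcon
    have h1 : |Z k - x * Y k| ≤ 4 * L := by
      have e1 : Z k - x * Y k = (Z k - Z h / Y h * Y k) + (Z h - x * Y h) * (Y k / Y h) := by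
        field_simp; ring
      rw [e1]
      refine (abs_add_le _ _).trans ?_
      rw [abs_mul, abs_of_pos (by positivity : 0 < Y k / Y h)]
      have h2 : Y k / Y h ≤ 1 / 2 := by rw [div_le_iff₀ hYh]; linarith
      have h3 : |Z h - x * Y h| * (Y k / Y h) ≤ 4 * L * (1 / 2) :=
        mul_le_mul hhx h2 (by positivity) (by positivity)
      linarith
    have := hmin' k hk h1
    linarith
  have hs4 : s ≤ 4 * L := by
    have h1 : Y h / 2 ≤ 2 * L * (Y h / s) := hk2.le.trans hk1
    have h2 : Y h * s ≤ Y h * (4 * L) := by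
      have := mul_le_mul_of_nonneg_right h1 (by positivity : 0 ≤ 2 * s)
      have e2 : 2 * L * (Y h / s) * (2 * s) = Y h * (4 * L) := by field_simp; ring
      linarith
    exact le_of_mul_le_mul_left h2 hYh
  calc β ≤ β + t * Y k := by nlinarith
    _ ≤ L * s := hβs
    _ ≤ L * (4 * L) := mul_le_mul_of_nonneg_left hs4 hL0
    _ = 4 * L ^ 2 := by ring

/-- A discrete intermediate value argument: a path of bounded steps from one side of the geodesic to
the other has a vertex near it. -/
lemma exists_near_line (hlin : ∀ γ ∈ Γ, IsSO21o γ.linear) (hF : IsFrame a e n) (hL : 1 ≤ L)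
    (hstep : StepBound Γ L) {x : ℝ} (h1 : lorentz origin n ≤ x * -lorentz origin a)
    {k : LSpace ≃ᵃ[ℝ] LSpace} (hk : k ∈ Γ)
    (hkx : x * -lorentz (k.linear origin) a < lorentz (k.linear origin) n) :
    ∃ k₀ ∈ Γ, |lorentz (k₀.linear origin) n - x * -lorentz (k₀.linear origin) a| ≤ 4 * L := by
  by_contra hcon
  push Not at hcon
  have := hstep (fun g => lorentz (g.linear origin) n ≤ x * -lorentz (g.linear origin) a) h1
    (fun g hg g' hg' hP hclose => ?_) k hk
  · exact absurd this (not_le.2 hkx)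
  · by_contra hP'
    push Not at hP'
    have hY := orbit_null hlin hg hF.null_a
    have hY' := orbit_null hlin hg' hF.null_a
    have hid := hF.inner_identity (orbit_self hlin hg) (orbit_self hlin hg')
    refine absurd (hcon g hg) (not_lt.2 ?_)
    set Y := -lorentz (g.linear origin) a with hYd
    set Y' := -lorentz (g'.linear origin) a with hYd'
    set Z := lorentz (g.linear origin) n
    set Z' := lorentz (g'.linear origin) n
    set β := -lorentz (g.linear origin) (g'.linear origin)
    rw [show lorentz (g.linear origin) a = -Y by linarith,
      show lorentz (g'.linear origin) a = -Y' by linarith] at hid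
    have hmain : Y ^ 2 + Y' ^ 2 + (Z * Y' - Z' * Y) ^ 2 ≤ 2 * Y * Y' * L := by
      have := mul_le_mul_of_nonneg_left hclose (by positivity : 0 ≤ 2 * Y * Y')
      linarith
    have hk1 : Y ≤ 2 * L * Y' := by
      have : Y * Y ≤ Y * (2 * L * Y') := by
        nlinarith [sq_nonneg (Z * Y' - Z' * Y), sq_nonneg Y']
      exact le_of_mul_le_mul_left this hY
    have hL0 : 0 < L := by linarith
    have h2 : (Z * Y' - Z' * Y) ^ 2 ≤ (2 * L * Y') ^ 2 := by
      have : Y * (Y' * L) ≤ 2 * L * Y' * (Y' * L) :=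
        mul_le_mul_of_nonneg_right hk1 (by positivity)
      nlinarith [sq_nonneg Y, sq_nonneg Y']
    have h3 := abs_le_of_sq_le_sq h2 (by positivity)
    have h4 := neg_le_abs (Z * Y' - Z' * Y)
    have h5 : Y' * (x * Y - Z) ≤ Y' * (2 * L) := by nlinarith
    have h6 := le_of_mul_le_mul_left h5 hY'
    rw [abs_sub_comm, abs_of_nonneg (by linarith)]
    linarith

/-- Visible points exist near the vertical geodesics over arbitrarily large `x`, whereas finitely
many of them have bounded horizontal coordinates, even after adding the allowance `4 * L`. -/
lemma infinite_visible (hlin : ∀ γ ∈ Γ, IsSO21o γ.linear) (hF : IsFrame a e n) (hL : 1 ≤ L)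
    (hstep : StepBound Γ L)
    (hfin : ∀ C : ℝ, {k | k ∈ Γ ∧ |lorentz (k.linear origin) n| ≤ C}.Finite)
    (hlarge : ∀ x : ℝ, ∃ k ∈ Γ, x * -lorentz (k.linear origin) a < lorentz (k.linear origin) n) :
    {h | h ∈ Γ ∧ IsVisible Γ L a h}.Infinite := by
  intro hV
  obtain ⟨M, hM⟩ := (hV.image fun h => (lorentz (h.linear origin) n + 4 * L) /
    -lorentz (h.linear origin) a).bddAbove
  set x := max (M + 1) (lorentz origin n / -lorentz origin a) with hx
  have ho : 0 < -lorentz origin a := by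
    have := origin_future.lorentz_null_neg hF.null_a
    linarith
  obtain ⟨k, hk, hkx⟩ := hlarge x
  obtain ⟨k₀, hk₀, hk₀x⟩ := exists_near_line hlin hF hL hstep (x := x)
    (by rw [← div_le_iff₀ ho]; exact le_max_right _ _) hk hkx
  obtain ⟨h, hh, hhx, hvis⟩ := exists_visible hlin hF hL hfin hk₀ hk₀x
  have h1 := hM ⟨h, ⟨hh, hvis⟩, rfl⟩
  have hY := orbit_null hlin hh hF.null_a
  simp only at h1
  rw [div_le_iff₀ hY] at h1
  have h2 := (abs_le.1 hhx).1
  have h3 : (M + 1) * -lorentz (h.linear origin) a ≤ x * -lorentz (h.linear origin) a :=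
    mul_le_mul_of_nonneg_right (le_max_left _ _) hY.le
  linarith

end

/-! ### Paths of far orbit points and clear rays -/

section
variable {Γ : Subgroup (LSpace ≃ᵃ[ℝ] LSpace)} {a e n : LSpace} {L : ℝ}

/-- A step of bounded length between orbit points that are far from the base point. -/
def FarStep (Γ : Subgroup (LSpace ≃ᵃ[ℝ] LSpace)) (L : ℝ) (g g' : LSpace ≃ᵃ[ℝ] LSpace) : Prop :=
  g ∈ Γ ∧ g' ∈ Γ ∧ 4 * L ^ 2 < g.linear origin 2 ∧ 4 * L ^ 2 < g'.linear origin 2 ∧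
    -lorentz (g.linear origin) (g'.linear origin) ≤ L

lemma FarStep.symm {g g' : LSpace ≃ᵃ[ℝ] LSpace} (h : FarStep Γ L g g') : FarStep Γ L g' g :=
  ⟨h.2.1, h.1, h.2.2.2.1, h.2.2.1, by rw [lorentz_comm]; exact h.2.2.2.2⟩

/-- Along a path from the base point, the first vertex after the last visit to the ball of level `4
* L ^ 2` has level at most `2 * (4 * L ^ 2) * L`. Only finitely many such gates exist when the
holonomy is discrete. -/
lemma exists_gate (hlin : ∀ γ ∈ Γ, IsSO21o γ.linear) (hL : 1 ≤ L) (hstep : StepBound Γ L)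
    {g : LSpace ≃ᵃ[ℝ] LSpace} (hg : g ∈ Γ) (hfar : 4 * L ^ 2 < g.linear origin 2) :
    ∃ k ∈ {k | k ∈ Γ ∧ k.linear origin 2 ≤ 8 * L ^ 3}, Relation.ReflTransGen (FarStep Γ L) g k := by
  have key := hstep (fun g => g.linear origin 2 ≤ 4 * L ^ 2 ∨
    ∃ k ∈ {k | k ∈ Γ ∧ k.linear origin 2 ≤ 8 * L ^ 3}, Relation.ReflTransGen (FarStep Γ L) g k)
    (Or.inl (by rw [linear_one, origin_two]; nlinarith)) ?_ g hg
  · exact key.resolve_left (not_le.2 hfar)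
  · intro g hg g' hg' hP hclose
    by_cases h' : g'.linear origin 2 ≤ 4 * L ^ 2
    · exact Or.inl h'
    · right
      push Not at h'
      by_cases h : g.linear origin 2 ≤ 4 * L ^ 2
      · refine ⟨g', ⟨hg', ?_⟩, Relation.ReflTransGen.refl⟩
        refine (two_le_of_step (orbit_self hlin hg) (orbit_self hlin hg')
          (orbit_pos hlin hg')).trans ?_
        have h1 : 2 * g.linear origin 2 * -lorentz (g.linear origin) (g'.linear origin) ≤
            2 * g.linear origin 2 * L :=
          mul_le_mul_of_nonneg_left hclose (by have := orbit_pos hlin hg; positivity)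
        nlinarith
      · obtain ⟨k, hk, hgk⟩ := hP.resolve_left h
        push Not at h
        exact ⟨k, hk, Relation.ReflTransGen.head
          ⟨hg', hg, h', h, by rw [lorentz_comm]; exact hclose⟩ hgk⟩

/-- The ray from the base point to `A` stays away from the far orbit points. -/
def IsClearRay (Γ : Subgroup (LSpace ≃ᵃ[ℝ] LSpace)) (L : ℝ) (A : LSpace) : Prop :=
  ∀ k ∈ Γ, ∀ t : ℝ, 0 ≤ t →
    (-lorentz (k.linear origin) (origin + t • A)) ^ 2 ≤
      L ^ 2 * -lorentz (origin + t • A) (origin + t • A) → k.linear origin 2 ≤ 4 * L ^ 2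

/-- Translation by `h⁻¹` moves the ray starting at the orbit point of `h` to one starting at the
base point. -/
lemma IsVisible.isClearRay (hlin : ∀ γ ∈ Γ, IsSO21o γ.linear) (ha : FutureNull a)
    {h : LSpace ≃ᵃ[ℝ] LSpace} (hh : h ∈ Γ) (hv : IsVisible Γ L a h) :
    IsClearRay Γ L ((h⁻¹).linear a) := by
  intro k hk t ht hclose
  have h1 := hv (h * k) (Γ.mul_mem hh hk) t ht
  rw [linear_mul, (hlin _ hh).inner, lorentz_origin, neg_neg] at h1
  refine h1 ?_
  have e1 : lorentz (k.linear origin) ((h⁻¹).linear a) = lorentz (h.linear (k.linear origin)) a := by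
    rw [linear_inv, (hlin _ hh).inner_symm_right]
  have e2 : lorentz origin ((h⁻¹).linear a) = lorentz (h.linear origin) a := by
    rw [linear_inv, (hlin _ hh).inner_symm_right]
  have e3 : lorentz ((h⁻¹).linear a) ((h⁻¹).linear a) = 0 := by
    rw [(hlin _ (Γ.inv_mem hh)).inner, ha.1]
  simp only [lorentz_add_left, lorentz_add_right, lorentz_smul_left, lorentz_smul_right, e3,
    lorentz_comm ((h⁻¹).linear a) origin, e1, e2, lorentz_origin_origin] at hclose
  rw [lorentz_origin] at hclose
  refine le_trans (le_of_eq ?_) (hclose.trans (le_of_eq ?_)) <;> ring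

/-- In the Klein model the step is a straight segment. A crossing point is at distance from `z` at
most the length of the step, so the orbit point `z` would be close to the clear ray and hence not
far. -/
lemma FarStep.not_cross {A : LSpace} (hlin : ∀ γ ∈ Γ, IsSO21o γ.linear) (hA : FutureNull A)
    (hray : IsClearRay Γ L A) {g g' : LSpace ≃ᵃ[ℝ] LSpace} (h : FarStep Γ L g g') {s : ℝ}
    (hs0 : 0 ≤ s) (hs1 : s ≤ 1) {t : ℝ} (ht : 0 ≤ t)
    (h0 : ((1 - s) • g.linear origin + s • g'.linear origin) 0 = t * A 0)
    (h1 : ((1 - s) • g.linear origin + s • g'.linear origin) 1 = t * A 1) : False := by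
  obtain ⟨hg, hg', hfar, -, hclose⟩ := h
  set z := g.linear origin
  set z' := g'.linear origin
  set p := (1 - s) • z + s • z' with hp
  have hzz : lorentz z z = -1 := orbit_self hlin hg
  have hzz' : lorentz z' z' = -1 := orbit_self hlin hg'
  set β := -lorentz z z' with hβ
  have hβ1 : 1 ≤ β := by
    have e1 := two_le_of_step hzz hzz' (orbit_pos hlin hg')
    have hz := orbit_pos hlin hg
    have hz' := orbit_pos hlin hg'
    have hzn : z 0 ^ 2 + z 1 ^ 2 + 1 = z 2 ^ 2 := by simp only [lorentz] at hzz; linarith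
    have hzn' : z' 0 ^ 2 + z' 1 ^ 2 + 1 = z' 2 ^ 2 := by simp only [lorentz] at hzz'; linarith
    have hcs : (z 0 * z' 0 + z 1 * z' 1 + 1) ^ 2 ≤ (z 2 * z' 2) ^ 2 := by
      rw [mul_pow, ← hzn, ← hzn']
      nlinarith [sq_nonneg (z 0 * z' 1 - z 1 * z' 0), sq_nonneg (z 0 - z' 0),
        sq_nonneg (z 1 - z' 1)]
    have := (le_abs_self _).trans (abs_le_of_sq_le_sq hcs (by positivity))
    simp only [hβ, lorentz]
    linarith
  have hzp : -lorentz z p = (1 - s) + s * β := by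
    rw [hp, lorentz_add_right, lorentz_smul_right, lorentz_smul_right, hzz]; simp only [hβ]; ring
  have hpp : -lorentz p p = (1 - s) ^ 2 + s ^ 2 + 2 * (1 - s) * s * β := by
    rw [hp, lorentz_add_left, lorentz_add_right, lorentz_add_right, lorentz_smul_smul,
      lorentz_smul_smul, lorentz_smul_smul, lorentz_smul_smul, hzz, hzz', lorentz_comm z' z]
    simp only [hβ]; ring
  have hs1' : 0 ≤ 1 - s := by linarith
  have hppos : 0 < -lorentz p p := by
    rw [hpp]
    have : 2 * (1 - s) * s * 1 ≤ 2 * (1 - s) * s * β :=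
      mul_le_mul_of_nonneg_left hβ1 (by positivity)
    nlinarith
  have hp2 : 0 < p 2 := by
    have e1 := orbit_pos hlin hg
    have e2 := orbit_pos hlin hg'
    have : p 2 = (1 - s) * z 2 + s * z' 2 := by simp [hp]
    rw [this]
    rcases hs0.eq_or_lt with h | h
    · rw [← h]; simpa using e1
    · have : 0 ≤ (1 - s) * z 2 := by positivity
      have : 0 < s * z' 2 := by positivity
      linarith
  have hA2 := hA.2
  -- Since `p` is future timelike and has the planar coordinates of `t • A`, it is a combination of
  -- the base point and `A` with coefficients `α > 0` and `t`.
  set α := p 2 - t * A 2 with hα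
  have hαpos : 0 < α := by
    have hAn : A 0 ^ 2 + A 1 ^ 2 = A 2 ^ 2 := by
      have := hA.1; simp only [lorentz] at this; linarith
    have hlt : (t * A 2) ^ 2 < p 2 ^ 2 := by
      simp only [lorentz] at hppos
      rw [h0, h1] at hppos
      have e : t ^ 2 * (A 0 ^ 2 + A 1 ^ 2) = t ^ 2 * A 2 ^ 2 := by rw [hAn]
      linarith [show (t * A 2) ^ 2 = t * A 0 * (t * A 0) + t * A 1 * (t * A 1) by
        linear_combination -e]
    have := lt_of_pow_lt_pow_left₀ 2 hp2.le hlt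
    simp only [hα]; linarith
  have hpe : p = α • (origin + (t / α) • A) := by
    apply ext_coord
    · rw [h0]
      simp only [Pi.smul_apply, Pi.add_apply, smul_eq_mul, show origin 0 = 0 from rfl]
      field_simp
      ring
    · rw [h1]
      simp only [Pi.smul_apply, Pi.add_apply, smul_eq_mul, show origin 1 = 0 from rfl]
      field_simp
      ring
    · have e : α * (origin 2 + t / α * A 2) = p 2 := by
        rw [origin_two]
        field_simp
        simp only [hα]
        ring
      exact e.symm
  have := hray g hg (t / α) (by positivity) ?_
  · exact absurd hfar (not_lt.2 this)
  set y := origin + (t / α) • A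
  have hzy : -lorentz z p = α * -lorentz z y := by rw [hpe, lorentz_smul_right]; ring
  have hyy : -lorentz p p = α ^ 2 * -lorentz y y := by rw [hpe, lorentz_smul_smul]; ring
  have hmain : (-lorentz z p) ^ 2 ≤ L ^ 2 * -lorentz p p := by
    have h2 : β ^ 2 ≤ L ^ 2 := by
      have : 0 ≤ β := by linarith
      gcongr
    -- After normalization of `p`: a point of the segment is no farther from `z` than `z'` is.
    have h3 : (-lorentz z p) ^ 2 ≤ β ^ 2 * -lorentz p p := by
      rw [hzp, hpp]
      have k1 : 0 ≤ β ^ 2 - 1 := by nlinarith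
      have k2 : 0 ≤ (1 - s) * s * β * (β ^ 2 - 1) := by positivity
      nlinarith [mul_nonneg (sq_nonneg (1 - s)) k1]
    exact h3.trans (mul_le_mul_of_nonneg_right h2 hppos.le)
  rw [hzy, hyy] at hmain
  have hα2 : 0 < α ^ 2 := by positivity
  refine le_of_mul_le_mul_left ?_ hα2
  linarith

lemma vol_origin (u z : LSpace) : vol origin u z = u 0 * z 1 - u 1 * z 0 := by
  simp [vol, origin]

/-- If `p` is on the line of `A` in the plane, it is a multiple of `A`. -/
lemma planar_parallel {A p : LSpace} (hA : FutureNull A) (h : vol origin A p = 0) :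
    ∃ t : ℝ, p 0 = t * A 0 ∧ p 1 = t * A 1 := by
  rw [vol_origin] at h
  have hA2 := hA.2
  have hAn : A 0 ^ 2 + A 1 ^ 2 = A 2 ^ 2 := by
    have := hA.1; simp only [lorentz] at this; linarith
  refine ⟨(p 0 * A 0 + p 1 * A 1) / A 2 ^ 2, ?_, ?_⟩
  · field_simp; rw [← hAn]; linear_combination (-A 1) * h
  · field_simp; rw [← hAn]; linear_combination A 0 * h

lemma planar_antipodal {A A' : LSpace} (hA : FutureNull A) (hA' : FutureNull A')
    (h : vol origin A A' = 0) (hne : lorentz A A' ≠ 0) :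
    ∃ c : ℝ, c < 0 ∧ A' 0 = c * A 0 ∧ A' 1 = c * A 1 := by
  obtain ⟨c, h0, h1⟩ := planar_parallel hA h
  refine ⟨c, ?_, h0, h1⟩
  by_contra hc
  push Not at hc
  have hA2 := hA.2
  have hA2' := hA'.2
  have hAn := hA.1
  have hAn' := hA'.1
  simp only [lorentz] at hAn hAn' hne
  rw [h0, h1] at hAn'
  have h2 : A' 2 = c * A 2 := by
    have : (A' 2) ^ 2 = (c * A 2) ^ 2 := by linear_combination c ^ 2 * hAn - hAn'
    exact (pow_left_inj₀ hA2'.le (by positivity) two_ne_zero).1 this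
  refine hne ?_
  rw [h0, h1, h2]
  linear_combination c * hAn

/-- The sector between the rays `A` and `A'`, for the orientation `σ`. -/
def InSector (σ : ℝ) (A A' z : LSpace) : Prop :=
  0 < σ * vol origin A z ∧ 0 < σ * vol origin z A'

/-- Leaving the sector forces the segment to meet its boundary, which consists of the two clear
rays. The hypothesis `hw` says that the angle is at most `π`; for the angle `π` the rays are
opposite and fill a line, a case treated apart. -/
lemma FarStep.inSector {A A' : LSpace} {σ : ℝ} (hσ : σ ≠ 0) (hlin : ∀ γ ∈ Γ, IsSO21o γ.linear)
    (hA : FutureNull A) (hA' : FutureNull A') (hray : IsClearRay Γ L A) (hray' : IsClearRay Γ L A')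
    (hne : lorentz A A' ≠ 0) (hw : 0 ≤ σ * vol origin A A')
    {g g' : LSpace ≃ᵃ[ℝ] LSpace} (h : FarStep Γ L g g')
    (hz : InSector σ A A' (g.linear origin)) : InSector σ A A' (g'.linear origin) := by
  by_contra hcon
  set z := g.linear origin with hzd
  set z' := g'.linear origin with hzd'
  let p : ℝ → LSpace := fun s => (1 - s) • z + s • z'
  have hpc : Continuous p := by fun_prop
  let f : ℝ → ℝ := fun s => min (σ * vol origin A (p s)) (σ * vol origin (p s) A')
  have hfc : Continuous f := by
    refine Continuous.min ?_ ?_ <;> simp only [vol_origin] <;> fun_prop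
  have hf0 : 0 < f 0 := by
    have : p 0 = z := by simp [p]
    simp only [f, this]
    exact lt_min hz.1 hz.2
  have hf1 : f 1 ≤ 0 := by
    have : p 1 = z' := by simp [p]
    simp only [f, this]
    by_contra hc
    push Not at hc
    exact hcon ⟨hc.trans_le (min_le_left _ _), hc.trans_le (min_le_right _ _)⟩
  obtain ⟨s, ⟨hs0, hs1⟩, hs⟩ := intermediate_value_Icc' zero_le_one hfc.continuousOn ⟨hf1, hf0.le⟩
  have hge1 : 0 ≤ σ * vol origin A (p s) := hs.symm.le.trans (min_le_left _ _)
  have hge2 : 0 ≤ σ * vol origin (p s) A' := hs.symm.le.trans (min_le_right _ _)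
  have hit : ∀ t : ℝ, 0 ≤ t → p s 0 = t * A 0 → p s 1 = t * A 1 → False := fun t ht h0 h1 =>
    h.not_cross hlin hA hray hs0 hs1 ht h0 h1
  have hit' : ∀ t : ℝ, 0 ≤ t → p s 0 = t * A' 0 → p s 1 = t * A' 1 → False := fun t ht h0 h1 =>
    h.not_cross hlin hA' hray' hs0 hs1 ht h0 h1
  have hzero : vol origin A (p s) = 0 ∨ vol origin (p s) A' = 0 := by
    rcases min_choice (σ * vol origin A (p s)) (σ * vol origin (p s) A') with hm | hm
    · left
      have : σ * vol origin A (p s) = 0 := by rw [← hm]; exact hs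
      exact (mul_eq_zero.1 this).resolve_left hσ
    · right
      have : σ * vol origin (p s) A' = 0 := by rw [← hm]; exact hs
      exact (mul_eq_zero.1 this).resolve_left hσ
  rcases hw.eq_or_lt with hw0 | hwpos
  · obtain ⟨c, hc, hc0, hc1⟩ := planar_antipodal hA hA'
      ((mul_eq_zero.1 hw0.symm).resolve_left hσ) hne
    have hA0 : vol origin A (p s) = 0 := by
      rcases hzero with h0 | h0
      · exact h0
      · rw [vol_origin, hc0, hc1] at h0
        rw [vol_origin]
        have : c * (A 0 * p s 1 - A 1 * p s 0) = 0 := by linarith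
        exact (mul_eq_zero.1 this).resolve_left hc.ne
    obtain ⟨t, h0, h1⟩ := planar_parallel hA hA0
    by_cases ht : 0 ≤ t
    · exact hit t ht h0 h1
    · push Not at ht
      have hc' := hc.ne
      refine hit' (t / c) (div_nonneg_of_nonpos ht.le hc.le) ?_ ?_
      · rw [h0, hc0]; field_simp
      · rw [h1, hc1]; field_simp
  · rcases hzero with hA0 | hA0
    · obtain ⟨t, h0, h1⟩ := planar_parallel hA hA0
      refine hit t ?_ h0 h1
      have e : σ * vol origin (p s) A' = t * (σ * vol origin A A') := by
        rw [vol_origin, vol_origin, h0, h1]; ring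
      rw [e] at hge2
      exact nonneg_of_mul_nonneg_left hge2 hwpos
    · have hA0' : vol origin A' (p s) = 0 := by
        rw [vol_origin] at hA0 ⊢; linarith
      obtain ⟨t, h0, h1⟩ := planar_parallel hA' hA0'
      refine hit' t ?_ h0 h1
      have e : σ * vol origin A (p s) = t * (σ * vol origin A A') := by
        rw [vol_origin, vol_origin, h0, h1]; ring
      rw [e] at hge1
      exact nonneg_of_mul_nonneg_left hge1 hwpos

/-- The sign `τ` records the handedness of the frame. -/
lemma IsFrame.exists_orient (hF : IsFrame a e n) :
    ∃ τ : ℝ, τ ^ 2 = 1 ∧ lorentzCross a n = τ • a ∧ lorentzCross a e = τ • n := by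
  set τ := -lorentz (lorentzCross a n) e with hτ
  have h1 : lorentzCross a n = τ • a := by
    conv_lhs => rw [hF.decomp (lorentzCross a n), lorentz_cross_self_left, lorentz_cross_self_right]
    simp [hτ]
  have h2 : lorentzCross a e = τ • n := by
    conv_lhs => rw [hF.decomp (lorentzCross a e), lorentz_cross_self_left, lorentz_cross_self_right]
    have : lorentz (lorentzCross a e) n = τ := by
      rw [hτ, lorentz_cross_eq_vol, lorentz_cross_eq_vol]; simp only [vol]; ring
    simp [this]
  refine ⟨τ, ?_, h1, h2⟩
  have h3 := lorentz_cross_cross a e a e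
  rw [h2, lorentz_smul_smul, hF.nn, hF.null_a.1, lorentz_comm e a, hF.ae] at h3
  linarith

/-- For points of the hyperbolic plane, the determinant with `a` compares horizontal coordinates in
the upper half-plane with `a` at infinity. -/
lemma IsFrame.vol_eq (hF : IsFrame a e n) {τ : ℝ} (h1 : lorentzCross a n = τ • a)
    (h2 : lorentzCross a e = τ • n) (w v : LSpace) :
    -τ * vol w a v = τ ^ 2 * (lorentz v n * -lorentz w a - lorentz w n * -lorentz v a) := by
  have h3 : lorentzCross a v = (-lorentz v a) • (τ • n) + lorentz v n • (τ • a) := by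
    rw [← h1, ← h2]
    conv_lhs => rw [hF.decomp v]
    apply ext_coord <;> simp only [Pi.add_apply, Pi.smul_apply, smul_eq_mul,
      lorentzCross_zero, lorentzCross_one, lorentzCross_two] <;> ring
  have h4 : vol w a v = lorentz (lorentzCross a v) w := by
    rw [lorentz_cross_eq_vol]; simp only [vol]; ring
  rw [h4, h3, lorentz_add_left, smul_smul, smul_smul, lorentz_smul_left, lorentz_smul_left,
    lorentz_comm n w, lorentz_comm a w]
  ring

/-- Orbit points high above `a` on the positive side converge to `a` in direction. -/
lemma IsFrame.tendsto_direction (hF : IsFrame a e n) {w : ℕ → LSpace}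
    (hw : ∀ i, lorentz (w i) (w i) = -1) (hYpos : ∀ i, 0 < -lorentz (w i) a)
    (hlarge : ∀ i : ℕ, i * -lorentz (w i) a < lorentz (w i) n) :
    ∃ X : ℕ → ℝ, (∀ i, 0 < X i) ∧ Tendsto (fun i => (X i)⁻¹ • w i) atTop (𝓝 a) := by
  set X : ℕ → ℝ := fun i => -lorentz (w i) e
  set Y : ℕ → ℝ := fun i => -lorentz (w i) a with hY
  set Z : ℕ → ℝ := fun i => lorentz (w i) n
  have hid : ∀ i, 2 * X i * Y i = 1 + Z i ^ 2 := fun i => by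
    have := hw i
    rw [hF.inner_eq] at this
    simp only [X, Y, Z]
    linarith
  have hX : ∀ i, 0 < X i := fun i => by
    have h1 := hid i
    have h2 : 0 < X i * Y i := by nlinarith [sq_nonneg (Z i)]
    exact pos_of_mul_pos_left h2 (hYpos i).le
  have hYi : ∀ i : ℕ, 1 ≤ i → Z i / X i ≤ 2 * (i : ℝ)⁻¹ ∧ Y i / X i ≤ 2 * (i : ℝ)⁻¹ ∧ 0 ≤ Z i := by
    intro i hi
    have hi' : (1 : ℝ) ≤ i := by exact_mod_cast hi
    have h1 : i * Y i < Z i := hlarge i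
    have hYp := hYpos i
    have hZ : 0 < Z i := lt_of_le_of_lt (by positivity) h1
    have hXp := hX i
    have h2 := hid i
    have hip : (0 : ℝ) < i := by linarith
    have key : i * Z i ≤ 2 * X i := by
      have h5 : Y i * (i * Z i) ≤ Y i * (2 * X i) := by nlinarith
      exact le_of_mul_le_mul_left h5 hYp
    have hYZ : Y i ≤ Z i := by nlinarith
    refine ⟨?_, ?_, hZ.le⟩
    · rw [div_le_iff₀ hXp, ← div_eq_mul_inv, div_mul_eq_mul_div, le_div_iff₀ hip]; linarith
    · rw [div_le_iff₀ hXp, ← div_eq_mul_inv, div_mul_eq_mul_div, le_div_iff₀ hip]; nlinarith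
  have hinv : Tendsto (fun i : ℕ => 2 * (i : ℝ)⁻¹) atTop (𝓝 0) := by
    simpa using tendsto_inv_atTop_nhds_zero_nat (𝕜 := ℝ).const_mul 2
  have hZX : Tendsto (fun i => Z i / X i) atTop (𝓝 0) := by
    refine squeeze_zero' ?_ ?_ hinv
    · filter_upwards [eventually_ge_atTop 1] with i hi
      exact div_nonneg (hYi i hi).2.2 (hX i).le
    · filter_upwards [eventually_ge_atTop 1] with i hi using (hYi i hi).1
  have hYX : Tendsto (fun i => Y i / X i) atTop (𝓝 0) := by
    refine squeeze_zero' ?_ ?_ hinv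
    · exact Eventually.of_forall fun i => div_nonneg (hYpos i).le (hX i).le
    · filter_upwards [eventually_ge_atTop 1] with i hi using (hYi i hi).2.1
  refine ⟨X, hX, ?_⟩
  have hlim : Tendsto (fun i => a + (Y i / X i) • e + (Z i / X i) • n) atTop
      (𝓝 (a + (0 : ℝ) • e + (0 : ℝ) • n)) :=
    (tendsto_const_nhds.add (hYX.smul tendsto_const_nhds)).add (hZX.smul tendsto_const_nhds)
  rw [zero_smul, zero_smul, add_zero, add_zero] at hlim
  refine hlim.congr fun i => ?_
  conv_rhs => rw [hF.decomp (w i)]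
  have := (hX i).ne'
  rw [smul_add, smul_add, smul_smul, smul_smul, smul_smul, inv_mul_cancel₀ this, one_smul,
    div_eq_inv_mul, div_eq_inv_mul]

/-- Seen from each visible `h`, the points `k i` tend to `a` from one fixed side of the ray to `a`,
and far steps join them to one of finitely many gates. Two visible elements share a gate. If their
rays had different directions, far paths would connect the inside of the sector between the rays to
its outside without crossing either ray. -/
lemma coincidence_of_visible (hlin : ∀ γ ∈ Γ, IsSO21o γ.linear) (hdisc : IsDiscrete Γ)
    (hF : IsFrame a e n) (hL : 1 ≤ L) (hstep : StepBound Γ L)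
    (hlarge : ∀ x : ℝ, ∃ k ∈ Γ, x * -lorentz (k.linear origin) a < lorentz (k.linear origin) n)
    (hvis : {h | h ∈ Γ ∧ IsVisible Γ L a h}.Infinite) :
    ∃ h ∈ Γ, ∃ h' ∈ Γ, h ≠ h' ∧ lorentz ((h⁻¹).linear a) ((h'⁻¹).linear a) = 0 := by
  choose k hk hkl using fun i : ℕ => hlarge i
  obtain ⟨τ, hτ, hτn, hτe⟩ := hF.exists_orient
  have hτ0 : τ ≠ 0 := by rintro rfl; norm_num at hτ
  have hYpos : ∀ g ∈ Γ, 0 < -lorentz (g.linear origin) a := fun g hg => orbit_null hlin hg hF.null_a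
  -- Otherwise discreteness makes one value `h * f` of `k i` recur, although the horizontal
  -- coordinate of `k i` exceeds `i`.
  have hfar : ∀ h ∈ Γ, ∀ᶠ i in atTop, 4 * L ^ 2 < (h⁻¹ * k i).linear origin 2 := by
    intro h hh
    by_contra hcon
    rw [Filter.not_eventually] at hcon
    obtain ⟨f, -, hf⟩ := frequently_eq_of_finite (hdisc.finite (4 * L ^ 2)) (f := fun i => h⁻¹ * k i)
      (hcon.mono fun i hi => ⟨Γ.mul_mem (Γ.inv_mem hh) (hk i), not_lt.1 hi⟩)
    obtain ⟨N, hN⟩ := exists_nat_ge (lorentz ((h * f).linear origin) n /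
      -lorentz ((h * f).linear origin) a)
    obtain ⟨i, hi, hiN⟩ := (hf.and_eventually (eventually_ge_atTop N)).exists
    have hki : k i = h * f := by rw [← hi, mul_inv_cancel_left]
    have h1 := hkl i
    have h2 := hYpos _ (hk i)
    rw [hki] at h1 h2
    rw [← lt_div_iff₀ h2] at h1
    have : (N : ℝ) ≤ i := by exact_mod_cast hiN
    linarith
  have hgate : ∀ h ∈ Γ, ∃ κ ∈ {κ | κ ∈ Γ ∧ κ.linear origin 2 ≤ 8 * L ^ 3},
      ∃ᶠ i in atTop, Relation.ReflTransGen (FarStep Γ L) (h⁻¹ * k i) κ := by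
    intro h hh
    have h1 : ∀ i, ∃ κ, 4 * L ^ 2 < (h⁻¹ * k i).linear origin 2 →
        κ ∈ {κ | κ ∈ Γ ∧ κ.linear origin 2 ≤ 8 * L ^ 3} ∧
          Relation.ReflTransGen (FarStep Γ L) (h⁻¹ * k i) κ := by
      intro i
      by_cases hi : 4 * L ^ 2 < (h⁻¹ * k i).linear origin 2
      · obtain ⟨κ, h1, h2⟩ := exists_gate hlin hL hstep (Γ.mul_mem (Γ.inv_mem hh) (hk i)) hi
        exact ⟨κ, fun _ => ⟨h1, h2⟩⟩
      · exact ⟨1, fun h => absurd h hi⟩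
    choose κ hκ using h1
    have h2 : ∃ᶠ i in atTop, κ i ∈ {κ | κ ∈ Γ ∧ κ.linear origin 2 ≤ 8 * L ^ 3} :=
      ((hfar h hh).mono fun i hi => (hκ i hi).1).frequently
    obtain ⟨κ₀, hκ₀, hfr⟩ := frequently_eq_of_finite (hdisc.finite _) h2
    refine ⟨κ₀, hκ₀, (hfr.and_eventually (hfar h hh)).mono fun i hi => ?_⟩
    rw [← hi.1]
    exact (hκ i hi.2).2
  choose! κ hκ hκr using hgate
  obtain ⟨h, ⟨hh, hv⟩, h', ⟨hh', hv'⟩, hne, heq⟩ :=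
    hvis.exists_ne_map_eq_of_mapsTo (f := κ) (fun h hh => hκ h hh.1) (hdisc.finite (8 * L ^ 3))
  refine ⟨h, hh, h', hh', hne, ?_⟩
  by_contra hpar
  -- rays to `A` and `A'`, in either order
  have hA : ∀ g ∈ Γ, FutureNull ((g⁻¹).linear a) := fun g hg =>
    (hlin _ (Γ.inv_mem hg)).null hF.null_a
  -- After moving by `g`, this says that `k i` lies eventually to the right of the vertical ray
  -- through the orbit point of `g`.
  have side : ∀ g ∈ Γ, ∀ᶠ i in atTop,
      0 < -τ * vol origin ((g⁻¹).linear a) ((g⁻¹ * k i).linear origin) := by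
    intro g hg
    obtain ⟨N, hN⟩ := exists_nat_ge (lorentz (g.linear origin) n / -lorentz (g.linear origin) a)
    filter_upwards [eventually_ge_atTop N] with i hi
    have e1 := (hlin _ hg).vol_map origin ((g⁻¹).linear a) ((g⁻¹ * k i).linear origin)
    rw [linear_apply_inv, linear_mul, linear_apply_inv] at e1
    rw [linear_mul, ← e1, hF.vol_eq hτn hτe, hτ, one_mul]
    have h1 := hkl i
    have h2 := hYpos _ (hk i)
    have h3 := hYpos _ hg
    rw [div_le_iff₀ h3] at hN
    have h4 : (N : ℝ) ≤ i := by exact_mod_cast hi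
    have h5 : lorentz (g.linear origin) n ≤ i * -lorentz (g.linear origin) a :=
      hN.trans (mul_le_mul_of_nonneg_right h4 h3.le)
    nlinarith
  obtain ⟨X, hX, hXlim⟩ := hF.tendsto_direction (w := fun i => (k i).linear origin)
    (fun i => orbit_self hlin (hk i)) (fun i => hYpos _ (hk i)) hkl
  have main : ∀ g ∈ Γ, ∀ g' ∈ Γ, IsVisible Γ L a g → IsVisible Γ L a g' → κ g = κ g' →
      lorentz ((g⁻¹).linear a) ((g'⁻¹).linear a) ≠ 0 →
      0 ≤ -τ * vol origin ((g⁻¹).linear a) ((g'⁻¹).linear a) → False := by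
    intro g hg g' hg' hvg hvg' hκκ hpar hw
    set A := (g⁻¹).linear a with hAd
    set A' := (g'⁻¹).linear a with hAd'
    have hrayA := hvg.isClearRay hlin hF.null_a hg
    have hrayA' := hvg'.isClearRay hlin hF.null_a hg'
    have hσ : -τ ≠ 0 := neg_ne_zero.2 hτ0
    have hstepS : ∀ u v, FarStep Γ L u v → InSector (-τ) A A' (u.linear origin) →
        InSector (-τ) A A' (v.linear origin) := fun u v huv =>
      huv.inSector hσ hlin (hA g hg) (hA g' hg') hrayA hrayA' hpar hw
    have hchain : ∀ u v, Relation.ReflTransGen (FarStep Γ L) u v →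
        (InSector (-τ) A A' (u.linear origin) ↔ InSector (-τ) A A' (v.linear origin)) := by
      intro u v huv
      induction huv with
      | refl => rfl
      | tail _ hbc ih => exact ih.trans ⟨hstepS _ _ hbc, hstepS _ _ hbc.symm⟩
    -- The points approach the direction of `A` from the side facing the sector. By contrast, `side`
    -- at `g'` puts the other points just beyond `A'`, outside the sector.
    have evIn : ∀ᶠ i in atTop, InSector (-τ) A A' ((g⁻¹ * k i).linear origin) := by
      have hsec : ∀ᶠ i in atTop, 0 < -τ * vol origin ((g⁻¹ * k i).linear origin) A' := by
        rcases hw.eq_or_lt with hw0 | hwpos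
        · obtain ⟨c, hc, hc0, hc1⟩ := planar_antipodal (hA g hg) (hA g' hg')
            ((mul_eq_zero.1 hw0.symm).resolve_left hσ) hpar
          change A' 0 = c * A 0 at hc0
          change A' 1 = c * A 1 at hc1
          filter_upwards [side g hg] with i hi
          have : vol origin ((g⁻¹ * k i).linear origin) A' =
              -c * vol origin A ((g⁻¹ * k i).linear origin) := by
            rw [vol_origin, vol_origin, hc0, hc1]; ring
          rw [this, mul_left_comm]
          exact mul_pos (by linarith) hi
        · have e1 := (hlin _ hg).vol_map origin A A'
          have hlim := (tendsto_vol (tendsto_const_nhds (x := g.linear origin)) hXlim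
            (tendsto_const_nhds (x := g.linear A'))).const_mul (-τ)
          rw [show vol (g.linear origin) a (g.linear A') = vol origin A A' by
            rw [← e1, hAd, linear_apply_inv]] at hlim
          filter_upwards [hlim.eventually_const_lt hwpos] with i hi
          have e2 := (hlin _ hg).vol_map origin ((g⁻¹ * k i).linear origin) A'
          rw [linear_mul, linear_apply_inv] at e2
          rw [linear_mul, ← e2]
          rw [vol_smul_mid, mul_left_comm] at hi
          exact pos_of_mul_pos_right hi (inv_pos.2 (hX i)).le
      filter_upwards [side g hg, hsec] with i h1 h2 using ⟨h1, h2⟩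
    obtain ⟨i, hi, hiS⟩ := ((hκr g hg).and_eventually evIn).exists
    obtain ⟨j, hj, hjS⟩ := ((hκr g' hg').and_eventually (side g' hg')).exists
    rw [hκκ] at hi
    have h1 := (hchain _ _ hj).2 ((hchain _ _ hi).1 hiS)
    have h2 := h1.2
    rw [vol_origin] at h2 hjS
    linarith
  rcases le_total 0 (-τ * vol origin ((h⁻¹).linear a) ((h'⁻¹).linear a)) with hw | hw
  · exact main h hh h' hh' hv hv' heq hpar hw
  · refine main h' hh' h hh hv' hv heq.symm (by rw [lorentz_comm]; exact hpar) ?_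
    rw [vol_origin] at hw ⊢
    linarith

end

/-! ### Conical accumulation -/

section
variable {Γ : Subgroup (LSpace ≃ᵃ[ℝ] LSpace)} {a e n : LSpace}

/-- The pairing of a null vector with a unit normal of another one, in planar coordinates. -/
lemma planar_normal {α ν : LSpace} {τ : ℝ} (hα : lorentz α α = 0) (hα2 : α 2 = 1)
    (hν : lorentz α ν = 0) (hc : lorentzCross α ν = τ • α) (α' : LSpace) :
    lorentz α' ν = ν 2 * lorentz α' α + τ * (α' 0 * α 1 - α' 1 * α 0) := by
  have h2 := congrFun hc 2
  rw [lorentzCross_two, Pi.smul_apply, smul_eq_mul, hα2, mul_one] at h2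
  simp only [lorentz, hα2] at hα hν ⊢
  have e0 : ν 0 = ν 2 * α 0 + τ * α 1 := by
    linear_combination (-ν 0) * hα + α 0 * hν + α 1 * h2
  have e1 : ν 1 = ν 2 * α 1 - τ * α 0 := by
    linear_combination (-ν 1) * hα + α 1 * hν - α 0 * h2
  rw [e0, e1]
  ring

/-- Each direction `(k i)⁻¹ a` ends a geodesic passing within bounded distance of the base point,
with the whole orbit of `a` on one side. So it bounds a gap of definite size on a definite side,
distinct ones are uniformly separated, and compactness of the circle forces a coincidence. -/
lemma coincidence_of_conical (hlin : ∀ γ ∈ Γ, IsSO21o γ.linear) (hF : IsFrame a e n)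
    (hside : ∀ g ∈ Γ, 0 ≤ lorentz (g.linear a) n) {C : ℝ}
    (hinf : {k | k ∈ Γ ∧ |lorentz (k.linear origin) n| ≤ C}.Infinite) :
    ∃ h ∈ Γ, ∃ h' ∈ Γ, h ≠ h' ∧ lorentz ((h⁻¹).linear a) ((h'⁻¹).linear a) = 0 := by
  obtain ⟨τ, hτ, hτn, -⟩ := hF.exists_orient
  let k : ℕ → LSpace ≃ᵃ[ℝ] LSpace := fun i => (hinf.natEmbedding _ i).1
  have hk : ∀ i, k i ∈ Γ := fun i => (hinf.natEmbedding _ i).2.1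
  have hkC : ∀ i, |lorentz ((k i).linear origin) n| ≤ C := fun i => (hinf.natEmbedding _ i).2.2
  have hkinj : Function.Injective k := Subtype.val_injective.comp (hinf.natEmbedding _).injective
  let A : ℕ → LSpace := fun i => ((k i)⁻¹).linear a
  let ν : ℕ → LSpace := fun i => ((k i)⁻¹).linear n
  have hA : ∀ i, FutureNull (A i) := fun i => (hlin _ (Γ.inv_mem (hk i))).null hF.null_a
  let α : ℕ → LSpace := fun i => (A i 2)⁻¹ • A i
  have hα : ∀ i, FutureNull (α i) := fun i => (hA i).smul (inv_pos.2 (hA i).2)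
  have hα2 : ∀ i, α i 2 = 1 := fun i => inv_mul_cancel₀ (hA i).2.ne'
  have hνC : ∀ i, |ν i 2| ≤ C := fun i => by
    have : ν i 2 = -lorentz ((k i).linear origin) n := by
      simp only [ν]
      rw [← (hlin _ (hk i)).inner_symm_right, ← linear_inv, origin_lorentz, neg_neg]
    rw [this, abs_neg]
    exact hkC i
  have hcross : ∀ i, lorentzCross (α i) (ν i) = τ • α i := fun i => by
    simp only [α, A, ν]
    rw [lorentzCross_smul_left, ← (hlin _ (Γ.inv_mem (hk i))).cross, hτn, map_smul, smul_comm]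
  have horth : ∀ i, lorentz (α i) (ν i) = 0 := fun i => by
    simp only [α, A, ν]
    rw [lorentz_smul_left, (hlin _ (Γ.inv_mem (hk i))).inner, hF.an, mul_zero]
  have hpos : ∀ i j, 0 ≤ lorentz (α j) (ν i) := fun i j => by
    have h1 := hside _ (Γ.mul_mem (hk i) (Γ.inv_mem (hk j)))
    rw [linear_mul, ← (hlin _ (hk i)).inner_symm_right, ← linear_inv] at h1
    simp only [α, A, ν]
    rw [lorentz_smul_left]
    exact mul_nonneg (inv_pos.2 (hA j).2).le h1
  have key : ∀ i j, lorentz (α i) (α j) = 0 ∨ 2 ≤ (1 + C ^ 2) * -lorentz (α i) (α j) := by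
    intro i j
    by_cases h0 : lorentz (α i) (α j) = 0
    · exact Or.inl h0
    right
    have hD := (hα i).lorentz_neg (hα j) h0
    have h1 := hpos i j
    have h2 := hpos j i
    rw [planar_normal (hα i).1 (hα2 i) (horth i) (hcross i)] at h1
    rw [planar_normal (hα j).1 (hα2 j) (horth j) (hcross j)] at h2
    rw [lorentz_comm (α j)] at h1
    set D := lorentz (α i) (α j) with hDd
    set W := α i 0 * α j 1 - α i 1 * α j 0 with hW
    -- `W` is the sine and `1 + D` the cosine of the angle between the two directions. The two
    -- one-sidedness conditions give opposite signs to `W`, hence `|W| ≤ C * -D`, which fails for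
    -- small nonzero angles.
    have hWe : W ^ 2 = -D * (2 + D) := by
      have e1 := (hα i).1
      have e2 := (hα j).1
      simp only [lorentz, hα2] at e1 e2 hDd
      simp only [hDd, hW]
      linear_combination (α j 0 ^ 2 + α j 1 ^ 2) * e1 + e2
    have b1 := (abs_le.1 (hνC i))
    have b2 := (abs_le.1 (hνC j))
    have u1 : τ * W ≤ C * -D := by nlinarith
    have u2 : -(C * -D) ≤ τ * W := by nlinarith
    have u3 : W ^ 2 ≤ (C * -D) ^ 2 := by
      have := sq_le_sq' u2 u1
      rwa [mul_pow, hτ, one_mul] at this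
    rw [hWe] at u3
    have : -D * (2 + D) ≤ -D * (C ^ 2 * -D) := by linarith
    have := le_of_mul_le_mul_left this (by linarith)
    linarith
  have hb : ∀ i, α i ∈ Metric.closedBall (0 : LSpace) 1 := fun i => by
    rw [mem_closedBall_zero_iff]
    have := norm_le_of_causal (hα i).1.le
    rwa [hα2, abs_one] at this
  obtain ⟨a', -, φ, hφ, hlim⟩ := (isCompact_closedBall (0 : LSpace) 1).tendsto_subseq hb
  have hself : lorentz a' a' = 0 := by
    refine tendsto_nhds_unique (tendsto_lorentz hlim hlim) ?_
    refine tendsto_const_nhds.congr fun i => ?_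
    rw [Function.comp_apply, (hα _).1]
  have hlim' := tendsto_lorentz hlim (hlim.comp (tendsto_add_atTop_nat 1))
  rw [hself] at hlim'
  have hlim2 := hlim'.neg.const_mul (1 + C ^ 2)
  rw [neg_zero, mul_zero] at hlim2
  obtain ⟨i, hi⟩ := (hlim2.eventually_lt_const (show (0 : ℝ) < 2 by norm_num)).exists
  refine ⟨k (φ i), hk _, k (φ (i + 1)), hk _, fun h => ?_, ?_⟩
  · exact absurd (hφ.injective (hkinj h)) (by omega)
  · have h0 := (key (φ i) (φ (i + 1))).resolve_right (not_le.2 hi)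
    simp only [α] at h0
    rw [lorentz_smul_smul] at h0
    exact (mul_eq_zero.1 h0).resolve_left
      (mul_pos (inv_pos.2 (hA _).2) (inv_pos.2 (hA _).2)).ne'

/-! ### The stabilizer of a null direction -/

/-- An isometry that fixes the direction of `a` is unipotent on the quotient of the orthogonal of
`a` by `a`. -/
lemma IsFrame.map_normal (hF : IsFrame a e n) {A : LSpace ≃ₗ[ℝ] LSpace} (hA : IsSO21o A) {l : ℝ}
    (hl : 0 < l) (h : A a = l • a) : ∃ p : ℝ, A n = n + p • a := by
  obtain ⟨τ, hτ, hτn, -⟩ := hF.exists_orient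
  have hτ0 : τ ≠ 0 := by rintro rfl; norm_num at hτ
  have ha0 := hF.null_a.ne_zero
  have horth : lorentz (A n) a = 0 := by
    have := hA.inner n a
    rw [h, lorentz_smul_right, lorentz_comm n a, hF.an] at this
    exact (mul_eq_zero.1 this).resolve_left hl.ne'
  have hd := hF.decomp (A n)
  rw [horth, neg_zero, zero_smul, add_zero] at hd
  have hcr := hA.cross a n
  rw [hτn, map_smul, h, lorentzCross_smul_left, hd] at hcr
  have e1 : lorentzCross a (-lorentz (A n) e • a + lorentz (A n) n • n) =
      lorentz (A n) n • (τ • a) := by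
    rw [← hτn]
    apply ext_coord <;> simp only [lorentzCross_zero, lorentzCross_one, lorentzCross_two,
      Pi.add_apply, Pi.smul_apply, smul_eq_mul] <;> ring
  rw [e1, smul_smul, smul_smul, smul_smul] at hcr
  have h1 := smul_left_injective ℝ ha0 hcr
  have h2 : lorentz (A n) n = 1 := by
    have : τ * l * (lorentz (A n) n - 1) = 0 := by linarith
    have := (mul_eq_zero.1 this).resolve_left (mul_ne_zero hτ0 hl.ne')
    linarith
  refine ⟨-lorentz (A n) e, ?_⟩
  rw [h2, one_smul] at hd
  rw [add_comm]
  exact hd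

lemma IsFrame.map_e (hF : IsFrame a e n) {A : LSpace ≃ₗ[ℝ] LSpace} (hA : IsSO21o A) {l : ℝ}
    (hl : 0 < l) (h : A a = l • a) (hn : A n = n) : A e = l⁻¹ • e := by
  have h1 : lorentz (A e) a = -l⁻¹ := by
    have := hA.inner e a
    rw [h, lorentz_smul_right, lorentz_comm e a, hF.ae] at this
    field_simp
    linarith
  have h2 : lorentz (A e) n = 0 := by
    have := hA.inner e n
    rwa [hn, hF.en] at this
  have h3 : lorentz (A e) e = 0 := by
    have := hF.inner_eq (A e) (A e)
    rw [hA.inner, hF.null_e.1, h1, h2] at this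
    have h4 : l⁻¹ * lorentz (A e) e = 0 := by linarith
    exact (mul_eq_zero.1 h4).resolve_left (inv_pos.2 hl).ne'
  refine hF.ext_of_frame ?_ ?_ ?_
  · rw [h1, lorentz_smul_left, lorentz_comm, hF.ae]; ring
  · rw [h3, lorentz_smul_left, hF.null_e.1]; ring
  · rw [h2, lorentz_smul_left, hF.en]; ring

/-- For `l ≠ 1` the unipotent shift of `n` is removed by adding `p / (1 - l)` times `a`, which gives
a fixed unit normal. The second null vector of the corresponding frame is the expanding eigenvector.
-/
lemma IsFrame.exists_isHyp (hF : IsFrame a e n) {β : LSpace ≃ᵃ[ℝ] LSpace} (hβ : IsSO21o β.linear)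
    {l : ℝ} (hl : 0 < l) (hl1 : l < 1) (h : β.linear a = l • a) :
    ∃ e', lorentz a e' = -1 ∧ IsHyp β l⁻¹ a e' := by
  obtain ⟨p, hp⟩ := hF.map_normal hβ hl h
  have hl' : (1 - l) ≠ 0 := by linarith
  obtain ⟨e', hF'⟩ := exists_frame (n := n + (p / (1 - l)) • a) hF.null_a
    (by simp only [lorentz_add_left, lorentz_add_right, lorentz_smul_left, lorentz_smul_right,
          hF.null_a.1, hF.an, hF.nn, lorentz_comm n a]; ring)
    (by rw [lorentz_add_right, lorentz_smul_right, hF.an, hF.null_a.1]; ring)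
  refine ⟨e', hF'.ae, one_lt_inv_iff₀.2 ⟨hl, hl1⟩, hF.null_a, hF'.null_e, ?_, by rw [h, inv_inv]⟩
  refine hF'.map_e hβ hl h ?_
  rw [map_add, map_smul, hp, h, smul_smul, add_assoc, ← add_smul]
  congr 2
  field_simp
  ring

/-- A parabolic element fixing `a` is incompatible with one-sidedness. -/
lemma eq_one_of_one_sided (hlin : ∀ γ ∈ Γ, IsSO21o γ.linear) (hdisc : IsDiscrete Γ)
    (hF : IsFrame a e n) {f : LSpace ≃ᵃ[ℝ] LSpace} {v : LSpace} (hf : f ∈ Γ)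
    (hfv : lorentz (f.linear v) a < 0) (hn : ∀ f ∈ Γ, 0 ≤ lorentz (f.linear v) n)
    {β : LSpace ≃ᵃ[ℝ] LSpace} (hβ : β ∈ Γ) (h : β.linear a = a) : β = 1 := by
  -- A positive shift `p` would make the products of `β ^ (-k) f v` with `n` tend to `-∞`. Applied
  -- also to the inverse, this leaves only `p = 0`.
  have one : ∀ β ∈ Γ, β.linear a = a → ∀ p : ℝ, β.linear n = n + p • a → p ≤ 0 := by
    intro β hβ h p hp
    by_contra hcon
    push Not at hcon
    have hpow : ∀ k : ℕ, (β ^ k).linear n = n + (k * p) • a := by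
      intro k
      induction k with
      | zero => simp [linear_one]
      | succ k ih =>
        rw [pow_succ', linear_mul, ih, map_add, map_smul, h, hp, add_assoc, ← add_smul]
        push_cast
        congr 2
        ring
    obtain ⟨k, hk⟩ := exists_nat_gt (lorentz (f.linear v) n / (p * -lorentz (f.linear v) a))
    rw [div_lt_iff₀ (mul_pos hcon (by linarith))] at hk
    have h1 := hn _ (Γ.mul_mem (Γ.inv_mem (Γ.pow_mem hβ k)) hf)
    rw [linear_mul, linear_inv, (hlin _ (Γ.pow_mem hβ k)).inner_symm_left, hpow,
      lorentz_add_right, lorentz_smul_right] at h1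
    linarith
  have h' : β.linear a = (1 : ℝ) • a := by rw [h, one_smul]
  obtain ⟨p, hp⟩ := hF.map_normal (hlin _ hβ) one_pos h'
  have h1 := one β hβ h p hp
  have hi : (β⁻¹).linear a = a := by
    conv_lhs => rw [← h]
    rw [linear_inv_apply]
  have h2 := one β⁻¹ (Γ.inv_mem hβ) hi (-p) (by
    have := linear_inv_apply β n
    rw [hp, map_add, map_smul, hi] at this
    conv_rhs => rw [← this]
    rw [add_assoc, ← add_smul, add_neg_cancel, zero_smul, add_zero])
  have hp0 : p = 0 := by linarith
  rw [hp0, zero_smul, add_zero] at hp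
  have he := hF.map_e (hlin _ hβ) one_pos h' hp
  rw [inv_one, one_smul] at he
  refine hdisc.eq_one β hβ fun w => ?_
  refine hF.ext_of_frame ?_ ?_ ?_
  · conv_lhs => rw [← h, (hlin _ hβ).inner]
  · conv_lhs => rw [← he, (hlin _ hβ).inner]
  · conv_lhs => rw [← hp, (hlin _ hβ).inner]

end

/-! ### Renormalization by a hyperbolic element -/

section
variable {Γ : Subgroup (LSpace ≃ᵃ[ℝ] LSpace)} {a e : LSpace} {ε : ℝ}

lemma isFrame_cross (ha : FutureNull a) (he : FutureNull e) (hae : lorentz a e = -1) :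
    IsFrame a e (lorentzCross a e) := by
  refine ⟨ha, he, hae, ?_, ?_, ?_⟩
  · rw [lorentz_cross_cross, ha.1, he.1, lorentz_comm e a, hae]; ring
  · rw [lorentz_comm, lorentz_cross_self_left]
  · rw [lorentz_comm, lorentz_cross_self_right]

/-- Rescaled high powers of an affine hyperbolic map converge to the projection onto the expanding
direction. -/
lemma IsHyp.tendsto_pow_apply {β : LSpace ≃ᵃ[ℝ] LSpace} {l : ℝ} (hβ : IsHyp β l a e)
    (hβl : IsSO21o β.linear) (hae : lorentz a e = -1) {k : ℕ → ℕ}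
    (hk : Tendsto (fun i => l⁻¹ ^ k i) atTop (𝓝 0)) {s : ℕ → ℝ} (hs : Tendsto s atTop (𝓝 0))
    {y : ℕ → LSpace} {q : LSpace} (hq : Tendsto (fun i => s i • y i) atTop (𝓝 q)) :
    Tendsto (fun i => (s i * l⁻¹ ^ k i) • (β ^ k i) (y i)) atTop (𝓝 ((-lorentz q a) • e)) := by
  have hl := hβ.one_lt
  have hl0 : l ≠ 0 := by positivity
  have hF := isFrame_cross hβ.null_m hβ.null_p hae
  set m := lorentzCross a e with hm
  obtain ⟨z, hz⟩ := hβ.exists_axis hae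
  set δ := vol a e (β 0 - 0)
  obtain ⟨C, hC⟩ := exists_bound_linear_mul_pow 0 1 (q := l⁻¹) (by positivity)
    (inv_lt_one_of_one_lt₀ hl)
  have hsk : Tendsto (fun i => s i * (k i * l⁻¹ ^ k i)) atTop (𝓝 0) := by
    have h1 : Tendsto (fun i => |s i| * C) atTop (𝓝 0) := by
      simpa using hs.abs.mul_const C
    refine squeeze_zero_norm (fun i => ?_) h1
    rw [Real.norm_eq_abs, abs_mul]
    refine mul_le_mul_of_nonneg_left ?_ (abs_nonneg _)
    rw [abs_of_nonneg (by positivity)]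
    simpa using hC (k i)
  have hsz : Tendsto (fun i => s i • (y i - z)) atTop (𝓝 q) := by
    have := hq.sub (hs.smul_const z)
    rw [zero_smul, sub_zero] at this
    simpa only [smul_sub] using this
  have hX := (tendsto_lorentz hsz (tendsto_const_nhds (x := e))).neg
  have hY := (tendsto_lorentz hsz (tendsto_const_nhds (x := a))).neg
  have hZ := (tendsto_lorentz hsz (tendsto_const_nhds (x := m)))
  have hlim : Tendsto (fun i => (s i * l⁻¹ ^ k i) • z + (-lorentz (s i • (y i - z)) a) • e +
      ((l⁻¹ ^ k i) * (l⁻¹ ^ k i) * -lorentz (s i • (y i - z)) e) • a +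
      ((l⁻¹ ^ k i) * lorentz (s i • (y i - z)) m + s i * (k i * l⁻¹ ^ k i) * δ) • m) atTop
      (𝓝 (((0 : ℝ) * 0) • z + (-lorentz q a) • e + ((0 : ℝ) * 0 * -lorentz q e) • a +
        ((0 : ℝ) * lorentz q m + 0 * δ) • m)) :=
    ((((hs.mul hk).smul_const z).add (hY.smul_const e)).add
      (((hk.mul hk).mul hX).smul_const a)).add (((hk.mul hZ).add (hsk.mul_const δ)).smul_const m)
  simp only [zero_mul, add_zero, zero_smul, zero_add] at hlim
  refine hlim.congr fun i => ?_
  have hy : y i = z + (-lorentz (y i - z) a) • e + (-lorentz (y i - z) e) • a +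
      lorentz (y i - z) m • m := by
    have := hF.decomp (y i - z)
    rw [sub_eq_iff_eq_add] at this
    conv_lhs => rw [this]
    abel
  conv_rhs => rw [hy]
  rw [hβ.pow_apply hβl hz]
  have hll : l⁻¹ ^ k i * l ^ k i = 1 := by rw [← mul_pow, inv_mul_cancel₀ hl0, one_pow]
  simp only [lorentz_smul_left]
  apply ext_coord <;> simp only [Pi.add_apply, Pi.smul_apply, smul_eq_mul]
  · linear_combination (s i * lorentz (y i - z) a * e 0) * hll
  · linear_combination (s i * lorentz (y i - z) a * e 1) * hll
  · linear_combination (s i * lorentz (y i - z) a * e 2) * hll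

/-- Powers of `β` push the points tending to `a` back along the axis to a fundamental segment. The
new sequence has an attracting direction `a'` off the axis endpoints and, if `⟨q, a⟩ ≠ 0`, diverges
along the line of `e`. Both `a` and `β a'` are limits of null orbits, and the sign inequality fails
at one of them. -/
lemma RankOne.orthogonal_of_isHyp (hlin : ∀ γ ∈ Γ, IsSO21o γ.linear) (hdisc : IsDiscrete Γ)
    (hirr : Irred Γ) (hnn : NonnegInvariants ε Γ) (hε : ε ≠ 0)
    {γ : ℕ → LSpace ≃ᵃ[ℝ] LSpace} {c : ℕ → ℝ} {r : LSpace} (h : RankOne γ c a r)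
    (hγ : ∀ n, γ n ∈ Γ) {s : ℕ → ℝ} (hs : ∀ n, 0 < s n) (hs0 : Tendsto s atTop (𝓝 0))
    {x q : LSpace} (hq : Tendsto (fun n => s n • (γ n) x) atTop (𝓝 q))
    {β : LSpace ≃ᵃ[ℝ] LSpace} (hβΓ : β ∈ Γ) {l : ℝ} (hβ : IsHyp β l a e)
    (hae : lorentz a e = -1) : lorentz q a = 0 := by
  by_contra hqa
  have hl := hβ.one_lt
  have hl0 : 0 < l := by positivity
  have hβl := hlin _ hβΓ
  have hF := isFrame_cross hβ.null_m hβ.null_p hae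
  set m := lorentzCross a e with hm
  have hXpos : ∀ i, 0 < -lorentz ((γ i).linear origin) e := fun i =>
    orbit_null hlin (hγ i) hβ.null_p
  have hYpos : ∀ i, 0 < -lorentz ((γ i).linear origin) a := fun i =>
    orbit_null hlin (hγ i) hβ.null_m
  set ρ : ℕ → ℝ := fun i => -lorentz ((γ i).linear origin) a / -lorentz ((γ i).linear origin) e
    with hρ
  have hρpos : ∀ i, 0 < ρ i := fun i => div_pos (hYpos i) (hXpos i)
  have hρ0 : Tendsto ρ atTop (𝓝 0) := by
    have t := h.fwd origin
    have ta := (tendsto_lorentz t (tendsto_const_nhds (x := a))).neg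
    have te := (tendsto_lorentz t (tendsto_const_nhds (x := e))).neg
    rw [lorentz_smul_left, h.null_a.1, mul_zero, neg_zero] at ta
    rw [lorentz_smul_left, hae, origin_lorentz, neg_neg] at te
    have hr := h.null_r.2
    have := ta.div te (by simpa using hr.ne')
    rw [zero_div] at this
    refine this.congr fun i => ?_
    have := (h.pos i).ne'
    have := (hXpos i).ne'
    simp only [hρ, Pi.div_apply, lorentz_smul_left]
    field_simp
  have hl2 : (l⁻¹) ^ 2 < 1 := pow_lt_one₀ (by positivity) (inv_lt_one_of_one_lt₀ hl) two_ne_zero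
  -- Since `β ^ k` multiplies `Y / X` by `l ^ (2 * k)`, this choice brings the ratio into `(l⁻²,
  -- 1]`. For `ρ i > 1`, which is excluded eventually, `k` is a dummy value.
  have hex : ∀ i, ∃ k : ℕ, ρ i ≤ 1 → ((l⁻¹) ^ 2) ^ (k + 1) < ρ i ∧ ρ i ≤ ((l⁻¹) ^ 2) ^ k := by
    intro i
    by_cases hi : ρ i ≤ 1
    · obtain ⟨k, hk⟩ := exists_nat_pow_near_of_lt_one (hρpos i) hi (by positivity) hl2
      exact ⟨k, fun _ => hk⟩
    · exact ⟨0, fun h => absurd h hi⟩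
  choose k hk using hex
  have hρ1 : ∀ᶠ i in atTop, ρ i ≤ 1 := hρ0.eventually_le_const one_pos
  have hk0 : Tendsto (fun i => l⁻¹ ^ k i) atTop (𝓝 0) := by
    refine tendsto_zero_of_sq_le (v := fun i => (l⁻¹ ^ k i) ^ 2) (fun i => le_rfl) ?_
    have h1 : Tendsto (fun i => l ^ 2 * ρ i) atTop (𝓝 0) := by simpa using hρ0.const_mul (l ^ 2)
    refine squeeze_zero' (Eventually.of_forall fun i => by positivity) ?_ h1
    filter_upwards [hρ1] with i hi
    have h2 := (hk i hi).1
    rw [pow_succ, ← pow_mul, mul_comm 2, pow_mul] at h2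
    have h3 : l ^ 2 * ((l⁻¹ ^ k i) ^ 2 * l⁻¹ ^ 2) = (l⁻¹ ^ k i) ^ 2 := by field_simp
    rw [← h3]
    exact mul_le_mul_of_nonneg_left h2.le (by positivity)
  set γ' : ℕ → LSpace ≃ᵃ[ℝ] LSpace := fun i => β ^ k i * γ i with hγ'd
  have hγ' : ∀ i, γ' i ∈ Γ := fun i => Γ.mul_mem (Γ.pow_mem hβΓ _) (hγ i)
  set s' : ℕ → ℝ := fun i => s i * l⁻¹ ^ k i with hs'd
  have hs' : ∀ i, 0 < s' i := fun i => mul_pos (hs i) (by positivity)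
  have hs'0 : Tendsto s' atTop (𝓝 0) := by
    have := hs0.mul hk0
    rwa [zero_mul] at this
  have hq' : Tendsto (fun i => s' i • (γ' i) x) atTop (𝓝 ((-lorentz q a) • e)) :=
    hβ.tendsto_pow_apply hβl hae hk0 hs0 hq
  have hq'0 : (-lorentz q a) • e ≠ 0 := smul_ne_zero (neg_ne_zero.2 hqa) hβ.null_p.ne_zero
  have hinf : Tendsto (fun i => (γ' i).linear origin 2) atTop atTop := by
    rw [tendsto_atTop]
    intro R
    by_contra hcon
    rw [Filter.not_eventually] at hcon
    obtain ⟨η, -, hη⟩ := frequently_eq_of_finite (hdisc.finite R) (f := γ')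
      (hcon.mono fun i hi => ⟨hγ' i, (not_le.1 hi).le⟩)
    have h1 := hq'.sub (hs'0.smul_const (η x))
    rw [zero_smul, sub_zero] at h1
    obtain ⟨i, hi, hi'⟩ := (hη.and_eventually (h1.eventually_ne hq'0)).exists
    rw [hi, sub_self] at hi'
    exact hi' rfl
  obtain ⟨φ, hφ, c', a', r', h', hc'⟩ := exists_rankOne hlin hγ' hinf
  -- the coordinates of the orbit points are comparable
  have hX' : ∀ i, lorentz ((γ' i).linear origin) e =
      l⁻¹ ^ k i * lorentz ((γ i).linear origin) e := fun i => by
    have h1 := (hlin _ (Γ.pow_mem hβΓ (k i))).inner ((γ i).linear origin) e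
    rw [(hβ.pow_linear (k i)).1, lorentz_smul_right] at h1
    rw [← h1, ← mul_assoc, ← mul_pow, inv_mul_cancel₀ hl0.ne', one_pow, one_mul]
    rfl
  have hY' : ∀ i, l⁻¹ ^ k i * lorentz ((γ' i).linear origin) a =
      lorentz ((γ i).linear origin) a := fun i => by
    have h1 := (hlin _ (Γ.pow_mem hβΓ (k i))).inner ((γ i).linear origin) a
    rw [(hβ.pow_linear (k i)).2, lorentz_smul_right] at h1
    exact h1
  have hcmp : ∀ᶠ i in atTop,
      -lorentz ((γ' i).linear origin) a ≤ -lorentz ((γ' i).linear origin) e ∧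
      -lorentz ((γ' i).linear origin) e ≤ l ^ 2 * -lorentz ((γ' i).linear origin) a := by
    filter_upwards [hρ1] with i hi
    obtain ⟨h1, h2⟩ := hk i hi
    have hμ : 0 < l⁻¹ ^ k i := by positivity
    have hX := hXpos i
    simp only [hρ] at h1 h2
    rw [lt_div_iff₀ hX, pow_succ, ← pow_mul, mul_comm 2, pow_mul] at h1
    rw [div_le_iff₀ hX, ← pow_mul, mul_comm 2, pow_mul] at h2
    rw [← hY'] at h1 h2
    rw [hX']
    set μ := l⁻¹ ^ k i
    set X := lorentz ((γ i).linear origin) e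
    set Y := lorentz ((γ' i).linear origin) a
    constructor
    · refine le_of_mul_le_mul_left ?_ hμ
      linarith
    · refine le_of_mul_le_mul_left ?_ hμ
      have h3 : l ^ 2 * (μ ^ 2 * l⁻¹ ^ 2 * -X) = μ ^ 2 * -X := by field_simp
      have h4 := mul_le_mul_of_nonneg_left h1.le (sq_nonneg l)
      rw [h3] at h4
      linarith
  have hcmp' := hφ.tendsto_atTop.eventually hcmp
  have t := h'.fwd origin
  rw [origin_lorentz, neg_neg] at t
  have ta := (tendsto_lorentz t (tendsto_const_nhds (x := a))).neg
  have te := (tendsto_lorentz t (tendsto_const_nhds (x := e))).neg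
  rw [lorentz_smul_left] at ta te
  have hr' := h'.null_r.2
  have hXY1 : -lorentz a' a ≤ -lorentz a' e := by
    have := le_of_tendsto_of_tendsto ta te (by
      filter_upwards [hcmp'] with i hi
      rw [lorentz_smul_left, lorentz_smul_left]
      have := mul_le_mul_of_nonneg_left hi.1 (h'.pos i).le
      simp only [Function.comp_apply]
      linarith)
    refine le_of_mul_le_mul_left ?_ hr'
    linarith
  have hXY2 : -lorentz a' e ≤ l ^ 2 * -lorentz a' a := by
    have := le_of_tendsto_of_tendsto te (ta.const_mul (l ^ 2)) (by
      filter_upwards [hcmp'] with i hi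
      rw [lorentz_smul_left, lorentz_smul_left]
      have := mul_le_mul_of_nonneg_left hi.2 (h'.pos i).le
      simp only [Function.comp_apply]
      linarith)
    refine le_of_mul_le_mul_left ?_ hr'
    linarith
  set X := -lorentz a' e with hXd
  set Y := -lorentz a' a with hYd
  set Z := lorentz a' m with hZd
  have hdec : a' = X • a + Y • e + Z • m := hF.decomp a'
  have hY0 : 0 < Y := by
    have h1 := h'.null_a.lorentz_nonpos hβ.null_m
    have h2 : 0 ≤ Y := by simp only [hYd]; linarith
    refine lt_of_le_of_ne h2 fun h3 => ?_
    obtain ⟨p, hp, hpa⟩ := h'.null_a.exists_smul hβ.null_m (by linarith)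
    rw [← h3, mul_zero] at hXY2
    have h4 : lorentz a e = p * -X := by
      rw [hpa, lorentz_smul_left]; simp only [hXd]; ring
    rw [hae] at h4
    nlinarith
  have hX0 : 0 < X := hY0.trans_le hXY1
  -- The null vector `a'` satisfies `Z ^ 2 = 2 * X * Y`, and both coordinates are positive.
  have hZ0 : Z ≠ 0 := by
    intro h0
    have h1 := h'.null_a.1
    rw [hF.inner_eq] at h1
    have h2 : Z * Z = 2 * (X * Y) := by simp only [hZd, hXd, hYd]; linarith
    rw [h0] at h2
    have := mul_pos hX0 hY0
    linarith
  set u : LSpace := (ε * -lorentz q a) • lorentzCross a' e with hu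
  have hcyc : ∀ v, lorentz v u = ε * -lorentz q a * vol v a' e := fun v => by
    rw [hu, lorentz_smul_right, lorentz_comm v, lorentz_cross_eq_vol]
    congr 1
    simp only [vol]; ring
  have hstar : ∀ f ∈ Γ, 0 ≤ lorentz (f.linear r') u := fun f hf => by
    have := h'.star hlin hnn (fun i => hγ' (φ i)) (s := s' ∘ φ) (fun i => hs' _)
      (hs'0.comp hφ.tendsto_atTop) (hq'.comp hφ.tendsto_atTop) hf
    rw [vol_smul_right] at this
    rw [hcyc]
    linarith
  -- At `a` this determinant is `-Z`, at `β a'` it is `X * (1 - l⁻¹) * Z`: opposite signs.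
  have hvol : ∀ p q s : ℝ, vol (p • a + q • e + s • m) (X • a + Y • e + Z • m) e =
      -(p * Z - s * X) := by
    intro p q s
    have h1 : vol a m e = -1 := by
      have := hF.nn
      rw [hm, lorentz_cross_eq_vol] at this
      rw [← this, ← hm]
      simp only [vol]; ring
    have : vol (p • a + q • e + s • m) (X • a + Y • e + Z • m) e = (p * Z - s * X) * vol a m e := by
      simp only [vol, Pi.add_apply, Pi.smul_apply, smul_eq_mul]; ring
    rw [this, h1]; ring
  have hb1 := h.closure_orbit hγ hirr hlin h'.null_r hstar
  have hb2 := (h'.mul_left hβl).closure_orbit (fun i => Γ.mul_mem hβΓ (hγ' (φ i))) hirr hlin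
    h'.null_r hstar
  have hm' : β.linear m = m := hβ.map_cross hβl
  rw [hcyc] at hb1 hb2
  have e1 := hvol 1 0 0
  rw [one_smul, zero_smul, zero_smul, add_zero, add_zero, ← hdec] at e1
  have e2 : β.linear a' = (X * l⁻¹) • a + (Y * l) • e + Z • m := by
    rw [hdec, map_add, map_add, map_smul, map_smul, map_smul, hβ.map_m, hβ.map_p, hm', smul_smul,
      smul_smul]
  have e3 := hvol (X * l⁻¹) (Y * l) Z
  rw [← e2, ← hdec] at e3
  rw [e1] at hb1
  rw [e3] at hb2
  have hl1 : l⁻¹ < 1 := inv_lt_one_of_one_lt₀ hl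
  have h1 : ε * -lorentz q a * Z ≤ 0 := by linarith
  have h2 : 0 ≤ (X * (1 - l⁻¹)) * (ε * -lorentz q a * Z) := by linarith
  have h3 : 0 ≤ ε * -lorentz q a * Z := nonneg_of_mul_nonneg_right h2 (mul_pos hX0 (by linarith))
  exact mul_ne_zero (mul_ne_zero hε (neg_ne_zero.2 hqa)) hZ0 (le_antisymm h1 h3)

end

/-! ### Orthogonality to the attracting direction -/

section
variable {Γ : Subgroup (LSpace ≃ᵃ[ℝ] LSpace)} {ε : ℝ}

/-- The direction of divergence of an orbit is orthogonal to the attracting direction of the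
linear parts. -/
lemma RankOne.orthogonal {d : ℕ} (hfree : Nonempty (FreeGroup (Fin d) ≃* Γ))
    (hlin : ∀ γ ∈ Γ, IsSO21o γ.linear) (hdisc : IsDiscrete Γ)
    (hirr : Irred Γ) (hnn : NonnegInvariants ε Γ) (hε : ε ≠ 0)
    {γ : ℕ → LSpace ≃ᵃ[ℝ] LSpace} {c : ℕ → ℝ} {a r : LSpace} (h : RankOne γ c a r)
    (hγ : ∀ n, γ n ∈ Γ) {s : ℕ → ℝ} (hs : ∀ n, 0 < s n) (hs0 : Tendsto s atTop (𝓝 0))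
    {x q : LSpace} (hq : Tendsto (fun n => s n • (γ n) x) atTop (𝓝 q)) : lorentz q a = 0 := by
  by_contra hqa
  have hK : ε * lorentz q a ≠ 0 := mul_ne_zero hε hqa
  have hK' : 0 < |ε * lorentz q a| := abs_pos.2 hK
  -- The unit normal of the plane spanned by `a` and `q`, with the sign for which `RankOne.star`
  -- says that the orbit of `r` is on its nonnegative side.
  set n : LSpace := (|ε * lorentz q a|⁻¹ * ε) • lorentzCross a q with hn
  have hnn1 : lorentz n n = 1 := by
    have h1 : |ε * lorentz q a| * |ε * lorentz q a| = (ε * lorentz q a) ^ 2 := by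
      rw [abs_mul_abs_self, sq]
    rw [hn, lorentz_smul_smul, lorentz_cross_cross, h.null_a.1, lorentz_comm a q]
    field_simp
    rw [sq_abs]
    ring
  have han : lorentz a n = 0 := by
    rw [hn, lorentz_smul_right, lorentz_comm a, lorentz_cross_self_left, mul_zero]
  obtain ⟨e, hF⟩ := exists_frame h.null_a hnn1 han
  have hside : ∀ f ∈ Γ, 0 ≤ lorentz (f.linear r) n := fun f hf => by
    have h1 := h.star hlin hnn hγ hs hs0 hq hf
    rw [hn, lorentz_smul_right, lorentz_comm (f.linear r), lorentz_cross_eq_vol, mul_assoc]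
    refine mul_nonneg (inv_pos.2 hK').le ?_
    refine h1.trans_eq ?_
    congr 1
    simp only [vol]; ring
  have hside' : ∀ g ∈ Γ, 0 ≤ lorentz (g.linear a) n := fun g hg =>
    (h.mul_left (hlin _ hg)).closure_orbit (fun i => Γ.mul_mem hg (hγ i)) hirr hlin h.null_r hside
  have hlarge : ∀ x : ℝ, ∃ k ∈ Γ,
      x * -lorentz (k.linear origin) a < lorentz (k.linear origin) n := by
    intro x
    -- A null direction `f r` with large coordinate is approximated by the orbit points of `(γ i *
    -- f⁻¹)⁻¹`.
    obtain ⟨f, hf, hlt⟩ := h.exists_large hγ hirr hlin h.null_r hF hside x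
    have t := (h.mul_right (hlin _ hf)).bwd origin
    rw [origin_lorentz, neg_neg] at t
    have ta := (tendsto_lorentz t (tendsto_const_nhds (x := a))).neg.const_mul x
    have tn := tendsto_lorentz t (tendsto_const_nhds (x := n))
    rw [lorentz_smul_left] at ta tn
    have ha2 := h.null_a.2
    obtain ⟨i, hi⟩ := (ta.eventually_lt tn (by
      have := mul_lt_mul_of_pos_left hlt ha2
      linarith)).exists
    refine ⟨_, Γ.inv_mem (Γ.mul_mem (hγ i) (Γ.inv_mem hf)), ?_⟩
    rw [lorentz_smul_left, lorentz_smul_left] at hi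
    refine lt_of_mul_lt_mul_left ?_ (h.pos i).le
    linarith
  obtain ⟨L, hL, hstep⟩ := exists_stepBound hfree hlin
  have hcoin : ∃ h ∈ Γ, ∃ h' ∈ Γ, h ≠ h' ∧
      lorentz ((h⁻¹).linear a) ((h'⁻¹).linear a) = 0 := by
    -- Either orbit points thin out near the geodesic orthogonal to `n`, and infinitely many are
    -- visible, or infinitely many stay close to it.
    by_cases hfin : ∀ C : ℝ, {k | k ∈ Γ ∧ |lorentz (k.linear origin) n| ≤ C}.Finite
    · exact coincidence_of_visible hlin hdisc hF hL hstep hlarge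
        (infinite_visible hlin hF hL hstep hfin hlarge)
    · push Not at hfin
      obtain ⟨C, hC⟩ := hfin
      exact coincidence_of_conical hlin hF hside' hC
  obtain ⟨g, hg, g', hg', hne, h0⟩ := hcoin
  obtain ⟨l, hl, hl'⟩ := ((hlin _ (Γ.inv_mem hg)).null h.null_a).exists_smul
    ((hlin _ (Γ.inv_mem hg')).null h.null_a) h0
  have hβΓ : g * g'⁻¹ ∈ Γ := Γ.mul_mem hg (Γ.inv_mem hg')
  have hβa : (g * g'⁻¹).linear a = l • a := by
    rw [linear_mul, hl', map_smul, linear_apply_inv]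
  have hβ1 : g * g'⁻¹ ≠ 1 := fun h => hne (mul_inv_eq_one.1 h)
  -- Contracting `a`, fixing it, or expanding it; the last case reduces to the first by inversion.
  rcases lt_trichotomy l 1 with hlt | rfl | hgt
  · obtain ⟨e', hae, hyp⟩ := hF.exists_isHyp (hlin _ hβΓ) hl hlt hβa
    exact hqa (h.orthogonal_of_isHyp hlin hdisc hirr hnn hε hγ hs hs0 hq hβΓ hyp hae)
  · obtain ⟨f, hf, -, -, hfa, -⟩ := hirr.exists_two hlin h.null_r h.null_a
    rw [one_smul] at hβa
    exact hβ1 (eq_one_of_one_sided hlin hdisc hF hf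
      (((hlin _ hf).null h.null_r).lorentz_neg h.null_a hfa) hside hβΓ hβa)
  · have hβa' : ((g * g'⁻¹)⁻¹).linear a = l⁻¹ • a := by
      have := linear_inv_apply (g * g'⁻¹) a
      rw [hβa, map_smul] at this
      conv_rhs => rw [← this]
      rw [smul_smul, inv_mul_cancel₀ hl.ne', one_smul]
    obtain ⟨e', hae, hyp⟩ := hF.exists_isHyp (hlin _ (Γ.inv_mem hβΓ)) (inv_pos.2 hl)
      (inv_lt_one_of_one_lt₀ hgt) hβa'
    exact hqa (h.orthogonal_of_isHyp hlin hdisc hirr hnn hε hγ hs hs0 hq (Γ.inv_mem hβΓ) hyp hae)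

end

/-! ### The topology of the space of rays -/

/-- The projection from nonzero vectors to rays. -/
def toRay (v : {v : Fin 4 → ℝ // v ≠ 0}) : RaySphere := rayOfNeZero ℝ v.1 v.2

lemma continuous_toRay : Continuous toRay := continuous_coinduced_rng

lemma toRay_eq_iff {u v : {v : Fin 4 → ℝ // v ≠ 0}} :
    toRay u = toRay v ↔ ∃ c : ℝ, 0 < c ∧ v.1 = c • u.1 := by
  rw [toRay, toRay, ray_eq_iff]
  constructor
  · intro h
    obtain ⟨c, hc, h⟩ := h.exists_pos_left u.2 v.2
    exact ⟨c, hc, h.symm⟩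
  · rintro ⟨c, hc, h⟩
    rw [h]
    exact SameRay.sameRay_pos_smul_right _ hc

/-- The preimage of the image of an open set is the union of its positive dilates. -/
lemma isOpenMap_toRay : IsOpenMap toRay := by
  intro U hU
  refine isOpen_coinduced.2 ?_
  rw [isOpen_iff_mem_nhds]
  rintro v ⟨u, hu, huv⟩
  obtain ⟨c, hc, h⟩ := toRay_eq_iff.1 huv
  let g : {v : Fin 4 → ℝ // v ≠ 0} → {v : Fin 4 → ℝ // v ≠ 0} := fun w =>
    ⟨c⁻¹ • w.1, smul_ne_zero (inv_pos.2 hc).ne' w.2⟩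
  have hg : Continuous g := by fun_prop
  have hgv : g v = u := Subtype.ext (by
    change c⁻¹ • v.1 = u.1
    rw [h, smul_smul, inv_mul_cancel₀ hc.ne', one_smul])
  refine mem_of_superset ((hU.preimage hg).mem_nhds (by rw [mem_preimage, hgv]; exact hu)) ?_
  intro w hw
  refine ⟨g w, hw, toRay_eq_iff.2 ⟨c, hc, ?_⟩⟩
  change w.1 = c • c⁻¹ • w.1
  rw [smul_smul, mul_inv_cancel₀ hc.ne', one_smul]

lemma idealPoint_eq_iff {u v : LSpace} {hu : u ≠ 0} {hv : v ≠ 0} :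
    idealPoint u hu = idealPoint v hv ↔ ∃ c : ℝ, 0 < c ∧ v = c • u := by
  refine (toRay_eq_iff (u := ⟨_, cons_zero_ne_zero hu⟩) (v := ⟨_, cons_zero_ne_zero hv⟩)).trans ?_
  refine exists_congr fun c => and_congr_right fun _ => ?_
  constructor
  · intro h
    funext i
    simpa using congrFun h i.succ
  · intro h
    funext i
    refine Fin.cases ?_ (fun i => ?_) i
    · simp
    · simpa using congrFun h i

lemma tendsto_idealPoint {ι : Type*} {F : Filter ι} {f : ι → LSpace} {b : LSpace}
    (hf : ∀ i, f i ≠ 0) (hb : b ≠ 0) (h : Tendsto f F (𝓝 b)) :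
    Tendsto (fun i => idealPoint (f i) (hf i)) F (𝓝 (idealPoint b hb)) := by
  have h1 : Tendsto (fun i => (⟨Fin.cons 0 (f i), cons_zero_ne_zero (hf i)⟩ :
      {v : Fin 4 → ℝ // v ≠ 0})) F (𝓝 ⟨Fin.cons 0 b, cons_zero_ne_zero hb⟩) := by
    rw [tendsto_subtype_rng, tendsto_pi_nhds]
    intro i
    refine Fin.cases ?_ (fun i => ?_) i
    · simp only [Fin.cons_zero]
      exact tendsto_const_nhds
    · simpa using tendsto_coord h i
  exact (continuous_toRay.tendsto _).comp h1

/-! ### Limit points as directions of divergence -/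

section
variable {Γ : Subgroup (LSpace ≃ᵃ[ℝ] LSpace)} {ε : ℝ}

/-- Points of the closure of an orbit are limits of rescaled orbit points. -/
lemma exists_seq_of_mem_closure {x : LSpace} {q : RaySphere} (hq : q ∈ closure (affineOrbit Γ x)) :
    ∃ w : {v : Fin 4 → ℝ // v ≠ 0}, toRay w = q ∧ ∃ (γ : ℕ → LSpace ≃ᵃ[ℝ] LSpace) (s : ℕ → ℝ),
      (∀ n, γ n ∈ Γ) ∧ (∀ n, 0 < s n) ∧ Tendsto s atTop (𝓝 (w.1 0)) ∧
      Tendsto (fun n => s n • (γ n) x) atTop (𝓝 (fun i => w.1 i.succ)) := by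
  obtain ⟨w, rfl⟩ : ∃ w, toRay w = q := by
    induction q using Module.Ray.ind with
    | h v hv => exact ⟨⟨v, hv⟩, rfl⟩
  refine ⟨w, rfl, ?_⟩
  have hw := isOpenMap_toRay.preimage_closure_subset_closure_preimage (s := affineOrbit Γ x) hq
  obtain ⟨v, hv, hlim⟩ := mem_closure_iff_seq_limit.1 hw
  have hex : ∀ n, ∃ (γ : LSpace ≃ᵃ[ℝ] LSpace) (s : ℝ), γ ∈ Γ ∧ 0 < s ∧
      (v n).1 = s • (Fin.cons 1 (γ x) : Fin 4 → ℝ) := by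
    intro n
    obtain ⟨γ, hγ, h⟩ := hv n
    obtain ⟨s, hs, h⟩ := (toRay_eq_iff (u := ⟨_, cons_one_ne_zero _⟩)).1 h.symm
    exact ⟨γ, s, hγ, hs, h⟩
  choose γ s hγ hs h using hex
  have hlim' := (continuous_subtype_val.tendsto _).comp hlim
  rw [tendsto_pi_nhds] at hlim'
  refine ⟨γ, s, hγ, hs, ?_, ?_⟩
  · refine (hlim' 0).congr fun n => ?_
    rw [Function.comp_apply, h]
    simp
  · rw [tendsto_pi_nhds]
    intro i
    refine (hlim' i.succ).congr fun n => ?_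
    rw [Function.comp_apply, h]
    simp

/-- Orbits of a proper action are closed in the affine space. -/
lemma IsProper.mem_orbit_of_tendsto (hprop : IsProper Γ) {γ : ℕ → LSpace ≃ᵃ[ℝ] LSpace}
    (hγ : ∀ n, γ n ∈ Γ) {x y : LSpace} (h : Tendsto (fun n => (γ n) x) atTop (𝓝 y)) :
    ∃ η ∈ Γ, y = η x := by
  obtain ⟨R, hR⟩ := (Metric.isBounded_range_of_tendsto _ h).subset_closedBall (0 : LSpace)
  set K := Metric.closedBall (0 : LSpace) (max R ‖x‖)
  have hfin := hprop K (isCompact_closedBall _ _)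
  obtain ⟨η, hη, hfr⟩ := frequently_eq_of_finite hfin (f := γ) (F := atTop)
    (Eventually.frequently (Eventually.of_forall fun n => by
      refine ⟨hγ n, γ n x, ⟨x, ?_, rfl⟩, ?_⟩
      · simp [K]
      · exact Metric.closedBall_subset_closedBall (le_max_left _ _) (hR ⟨n, rfl⟩)))
  refine ⟨η, hη.1, ?_⟩
  by_contra hne
  obtain ⟨n, hn, hn'⟩ := (hfr.and_eventually (h.eventually_ne hne)).exists
  exact hn' (by rw [hn])

/-- A point of the Lorentzian limit set is a direction of divergence of an orbit. -/
lemma exists_divergence (hprop : IsProper Γ) (hlin : ∀ γ ∈ Γ, IsSO21o γ.linear)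
    (hdisc : IsDiscrete Γ) {q : RaySphere} (hq : q ∈ lorentzianLimitSet Γ) :
    ∃ (u : LSpace) (hu : u ≠ 0), q = idealPoint u hu ∧
      ∃ (γ : ℕ → LSpace ≃ᵃ[ℝ] LSpace) (c s : ℕ → ℝ) (a r x : LSpace), RankOne γ c a r ∧
        (∀ n, γ n ∈ Γ) ∧ (∀ n, 0 < s n) ∧ Tendsto s atTop (𝓝 0) ∧
        Tendsto (fun n => s n • (γ n) x) atTop (𝓝 u) := by
  obtain ⟨x, hq, hqn⟩ := mem_iUnion.1 hq
  obtain ⟨w, rfl, γ, s, hγ, hs, hs0, hlim⟩ := exists_seq_of_mem_closure hq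
  set u : LSpace := fun i => w.1 i.succ with hud
  -- A positive first coordinate would make the orbit converge in affine space, and properness would
  -- put the limit in the orbit.
  have hw0 : w.1 0 = 0 := by
    by_contra hne
    have hpos : 0 < w.1 0 := lt_of_le_of_ne (ge_of_tendsto' hs0 fun n => (hs n).le) (Ne.symm hne)
    have h1 : Tendsto (fun n => (γ n) x) atTop (𝓝 ((w.1 0)⁻¹ • u)) := by
      refine ((hs0.inv₀ hne).smul hlim).congr fun n => ?_
      rw [smul_smul, inv_mul_cancel₀ (hs n).ne', one_smul]
    obtain ⟨η, hη, hy⟩ := hprop.mem_orbit_of_tendsto hγ h1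
    refine hqn ⟨η, hη, ?_⟩
    refine (toRay_eq_iff (v := ⟨_, cons_one_ne_zero _⟩)).2 ⟨_, inv_pos.2 hpos, ?_⟩
    rw [← hy]
    funext i
    refine Fin.cases ?_ (fun i => ?_) i
    · simp [hne]
    · simp [hud]
  rw [hw0] at hs0
  have hu : u ≠ 0 := fun h => w.2 (funext fun i => by
    refine Fin.cases hw0 (fun i => ?_) i
    exact congrFun h i)
  have hinf : Tendsto (fun n => (γ n).linear origin 2) atTop atTop := by
    rw [tendsto_atTop]
    intro R
    by_contra hcon
    rw [Filter.not_eventually] at hcon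
    obtain ⟨η, -, hη⟩ := frequently_eq_of_finite (hdisc.finite R) (f := γ)
      (hcon.mono fun i hi => ⟨hγ i, (not_le.1 hi).le⟩)
    have h1 := hlim.sub (hs0.smul_const (η x))
    rw [zero_smul, sub_zero] at h1
    obtain ⟨i, hi, hi'⟩ := (hη.and_eventually (h1.eventually_ne hu)).exists
    rw [hi, sub_self] at hi'
    exact hi' rfl
  obtain ⟨φ, hφ, c, a, r, h, -⟩ := exists_rankOne hlin hγ hinf
  refine ⟨u, hu, ?_, γ ∘ φ, c, s ∘ φ, a, r, x, h, fun n => hγ _, fun n => hs _,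
    hs0.comp hφ.tendsto_atTop, hlim.comp hφ.tendsto_atTop⟩
  refine (toRay_eq_iff (v := ⟨_, cons_zero_ne_zero hu⟩)).2 ⟨1, one_pos, ?_⟩
  rw [one_smul]
  funext i
  refine Fin.cases ?_ (fun i => ?_) i
  · simp [hw0]
  · simp [hud]

/-- The orbit points of the base point converge to `a` in direction and, being timelike, are never
equal to it, so `a` is an accumulation point. -/
lemma RankOne.mem_fuchsianLimitSet (hlin : ∀ γ ∈ Γ, IsSO21o γ.linear)
    {γ : ℕ → LSpace ≃ᵃ[ℝ] LSpace} {c : ℕ → ℝ} {a r : LSpace} (h : RankOne γ c a r)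
    (hγ : ∀ n, γ n ∈ Γ) : idealPoint a h.null_a.ne_zero ∈ fuchsianLimitSet Γ := by
  refine ⟨origin, origin_future, ?_⟩
  rw [accPt_iff_frequently]
  have hself := fun n => orbit_self hlin (hγ n)
  have hne : ∀ n, (γ n).linear origin ≠ 0 := fun n h0 => by
    have := hself n
    rw [h0, lorentz_zero_left] at this
    norm_num at this
  have hne' : ∀ n, c n • (γ n).linear origin ≠ 0 := fun n => smul_ne_zero (h.pos n).ne' (hne n)
  have hb : -lorentz origin r • a ≠ 0 := by
    rw [origin_lorentz, neg_neg]
    exact smul_ne_zero h.null_r.2.ne' h.null_a.ne_zero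
  have hlim := tendsto_idealPoint hne' hb (h.fwd origin)
  have e : idealPoint a h.null_a.ne_zero = idealPoint _ hb :=
    idealPoint_eq_iff.2 ⟨_, by rw [origin_lorentz, neg_neg]; exact h.null_r.2, rfl⟩
  rw [← e] at hlim
  refine hlim.frequently (Frequently.of_forall fun n => ⟨fun heq => ?_, γ n, hγ n, hne n, ?_⟩)
  · obtain ⟨t, ht, hta⟩ := idealPoint_eq_iff.1 heq
    have := h.null_a.1
    rw [hta, lorentz_smul_smul, lorentz_smul_smul, hself n] at this
    have := mul_pos (mul_pos ht ht) (mul_pos (h.pos n) (h.pos n))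
    linarith
  · exact (idealPoint_eq_iff.2 ⟨_, h.pos n, rfl⟩).symm

/-- The orthogonal plane of a null vector is tangent to the cone along it, and so is spanned by `a`
and the horizontal tangent. -/
lemma FutureNull.eq_tangent {a u : LSpace} (ha : FutureNull a) (hu : lorentz u a = 0) :
    u = (u 2 / a 2) • a + ((a 0 * u 1 - a 1 * u 0) / a 2 ^ 2) • boundaryTangent a := by
  have ha2 := ha.2.ne'
  have hn := ha.1
  simp only [lorentz] at hn hu
  apply ext_coord <;> simp only [boundaryTangent, Pi.add_apply, Pi.smul_apply, smul_eq_mul,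
    Matrix.cons_val_zero, Matrix.cons_val_one, Matrix.cons_val]
  · field_simp
    linear_combination a 0 * hu - u 0 * hn
  · field_simp
    linear_combination a 1 * hu - u 1 * hn
  · field_simp
    ring

lemma mem_closure_accordantSegment {a u : LSpace} (ha : FutureNull a) (hu0 : u ≠ 0) {p t : ℝ}
    (hε : ε ≠ 0) (ht : 0 ≤ t) (hu : u = p • a + t • ε • boundaryTangent a) :
    idealPoint u hu0 ∈ closure (accordantSegment ε a) := by
  -- The open segment requires a positive tangential coefficient; the shift by `1 / (n + 1)` also
  -- reaches the endpoints, where `t = 0`.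
  set f : ℕ → LSpace := fun n => p • a + (t + 1 / ((n : ℝ) + 1)) • ε • boundaryTangent a
  have hbpos : ∀ n : ℕ, 0 < t + 1 / ((n : ℝ) + 1) := fun n => by positivity
  have hf : ∀ n, f n ≠ 0 := by
    intro n h0
    have h2 := congrFun h0 2
    have h1 := congrFun h0 1
    have h0 := congrFun h0 0
    have hb := mul_ne_zero (hbpos n).ne' hε
    simp only [f, boundaryTangent, Pi.add_apply, Pi.smul_apply, smul_eq_mul, Pi.zero_apply,
      Matrix.cons_val_zero, Matrix.cons_val_one, Matrix.cons_val, mul_zero, add_zero] at h0 h1 h2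
    have hp := (mul_eq_zero.1 h2).resolve_right ha.2.ne'
    rw [hp, zero_mul, zero_add, ← mul_assoc] at h0 h1
    have e1 := (mul_eq_zero.1 h0).resolve_left hb
    have e0 := (mul_eq_zero.1 h1).resolve_left hb
    have hn := ha.1
    have := ha.2
    rw [neg_eq_zero] at e1
    simp only [lorentz, e0, e1] at hn
    nlinarith
  have hlim : Tendsto f atTop (𝓝 u) := by
    have := tendsto_one_div_add_atTop_nhds_zero_nat (𝕜 := ℝ)
    have := ((this.const_add t).smul_const (ε • boundaryTangent a)).const_add (p • a)
    rwa [add_zero, ← hu] at this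
  exact mem_closure_of_tendsto (tendsto_idealPoint hf hu0 hlim)
    (Eventually.of_forall fun n => ⟨p, _, hbpos n, hf n, rfl⟩)

end

end Margulis

/-! ### Conclusion -/

theorem theorem4p1 (g : ℕ) (hg : 2 ≤ g)
    (Γ : Subgroup (Margulis.LSpace ≃ᵃ[ℝ] Margulis.LSpace))
    (hΓ : Margulis.IsProperAffineFree g Γ)
    (hlin : ∀ γ ∈ Γ, Margulis.IsSO21o γ.linear)
    (ε : ℝ) (hε : ε = 1 ∨ ε = -1)
    (hpos : ∃ γ ∈ Γ, ∃ α : ℝ, Margulis.HasMargulisInvariant ε γ α ∧ 0 < α) :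
    Margulis.lorentzianLimitSet Γ ⊆
      Margulis.accordantPreimage ε (Margulis.fuchsianLimitSet Γ) := by
  have hε0 : ε ≠ 0 := by rcases hε with rfl | rfl <;> norm_num
  have hε2 : ε * ε = 1 := by rcases hε with rfl | rfl <;> norm_num
  have hprop : Margulis.IsProper Γ := hΓ.2
  have hirr := Margulis.irred hg hΓ.1 hlin
  have hnn := Margulis.nonnegInvariants hε hprop hlin hpos
  obtain ⟨h, hh, α, hα, hα0⟩ := hpos
  obtain ⟨l, xm, xp, hyp, -⟩ := hα.exists_hyp hα0
  have hdisc := Margulis.isDiscrete hprop hlin hε0 hnn hirr hh hyp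
  intro q hq
  obtain ⟨u, hu, rfl, γ, c, s, a, r, x, hR, hγ, hs, hs0, hlim⟩ :=
    Margulis.exists_divergence hprop hlin hdisc hq
  refine ⟨a, hR.null_a.ne_zero, hR.null_a, hR.mem_fuchsianLimitSet hlin hγ, ?_⟩
  have hua := hR.orthogonal hΓ.1 hlin hdisc hirr hnn hε0 hγ hs hs0 hlim
  have hdec := hR.null_a.eq_tangent hua
  set p := u 2 / a 2
  set t := (a 0 * u 1 - a 1 * u 0) / a 2 ^ 2
  refine Margulis.mem_closure_accordantSegment hR.null_a hu (p := p) (t := ε * t) hε0 ?_ ?_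
  -- The sign of `ε * t`: an orbit point `f r` not parallel to `a` makes the determinant in
  -- `RankOne.star` a positive multiple of `t`.
  · obtain ⟨f, hf, -, -, hfa, -⟩ := hirr.exists_two hlin hR.null_r hR.null_a
    have hneg := ((hlin _ hf).null hR.null_r).lorentz_neg hR.null_a hfa
    have h1 := hR.star hlin hnn hγ hs hs0 hlim hf
    have h2 : Margulis.vol (f.linear r) a u = t * (a 2 * -Margulis.lorentz (f.linear r) a) := by
      have ha := hR.null_a.1
      rw [hdec]
      simp only [Margulis.lorentz] at ha
      simp only [Margulis.vol, Margulis.boundaryTangent, Margulis.lorentz, Pi.add_apply,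
        Pi.smul_apply, smul_eq_mul, Matrix.cons_val_zero, Matrix.cons_val_one, Matrix.cons_val]
      linear_combination (t * f.linear r 2) * ha
    rw [h2, ← mul_assoc] at h1
    exact nonneg_of_mul_nonneg_left h1 (mul_pos hR.null_a.2 (by linarith))
  · rw [smul_smul, mul_right_comm, hε2, one_mul]
    exact hdec
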